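/- **Setting.** Let $V$ be a finite-dimensional real vector space and $V^*$ its dual, with pairing $(\cdot,\cdot)$ (for a Euclidean space $V$ one identifies $V=V^*$ and $(\cdot,\cdot)$ is the scalar product). Let $R\subset V^*$ be a reduced irreducible crystallographic root system spanning $V^*$, with coroots $\alpha^\vee\in V$ and Weyl group $W$; fix a basis of simple roots and let $R_+$ be the set of positive roots. Let $m_\alpha\in\mathbb Z_{\ge 0}$ ($\alpha\in R$) be $W$-invariant multiplicities. Let $q\in\mathbb C^\times$ be not a root of unity, fix a value of $\log q$, and put $q^a=e^{a\log q}$ and $[a]=q^a-q^{-a}$. Put $$\rho^\vee=\tfrac12\sum_{\alpha\in R_+}m_\alpha\alpha^\vee,\qquad \mathcal N=\Big\{\rho^\vee-\sum_{\alpha\in R_+}l_\alpha\alpha^\vee \;:\; l_\alpha\in\mathbb R,\ 0\le l_\alpha\le m_\alpha\Big\}\subset V,$$ $$P=\{\omega\in V^*: (\omega,\alpha^\vee)\in\mathbb Z\ \forall\alpha\in R\},\qquad P^\vee=\{\nu\in V: (\alpha,\nu)\in\mathbb Z\ \forall\alpha\in R\}.$$ Let $\omega\neq 0$ be a minuscule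 weight ($\omega\in P$ and $|(\omega,\alpha^\vee)|\le 1$ for all $\alpha\in R$) or a quasiminuscule weight ($\omega\in R$ and $|(\omega,\alpha^\vee)|\le1$ for all $\alpha\in R\setminus\{\pm\omega\}$). For $x\in V$ and $z\in V^*$ put $$\mathfrak m_\omega(x)=\sum_{\tau\in W\omega}q^{2(\tau,x)},\qquad Q(z)=q^{2(\rho^\vee,z)}\prod_{\alpha\in R_+}\prod_{j=1}^{m_\alpha}[(\alpha^\vee,z)+j]\,[(\alpha^\vee,z)-j].$$ Let $T^\tau$ be the shift $(T^\tau f)(z)=f(z+\tau)$, and let $D=D^\omega_z$ be the Macdonald operator $$D=\sum_{\tau\in W\omega}a_\tau(z)\,(T^\tau-1)+\sum_{\tau\in W\omega}q^{-2(\rho^\vee,\tau)},$$ $$a_\tau(z)=\prod_{\alpha\in R:\,(\alpha^\vee,\tau)>0}\frac{[(\alpha^\vee,z)-m_\alpha]}{[(\alpha^\vee,z)]}\ \prod_{\alpha\in R:\,(\alpha^\vee,\tau)=2}\frac{[(\alpha^\vee,z)-m_\alpha+1]}{[(\alpha^\vee,z)+1]}.$$ A function $\psi(x,z)$ is called a *Baker–Akhiezer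 function* for $(R,m)$ if (a) $\psi=q^{2(x,z)}\sum_{\nu\in\mathcal N\cap P^\vee}\psi_\nu(x)\,q^{2(\nu,z)}$ for some functions $\psi_\nu$ of $x$, and (b) for all $\alpha\in R$, $s=1,\dots,m_\alpha$ and all $x$, one has $\psi(x,z+\tfrac12 s\alpha)=\psi(x,z-\tfrac12 s\alpha)$ whenever $q^{2(\alpha^\vee,z)}=1$. **Theorem.** Define $$\psi(x,z)=\prod_{\nu}\big(D-\mathfrak m_\omega(x+\nu)\big)\big[q^{2(x,z)}Q(z)\big],$$ the product being over all distinct vectors $\nu\neq0$ of the form $\nu=\sum_{\alpha\in R_+}l_\alpha\alpha^\vee$ with $l_\alpha\in\{0,1,\dots,m_\alpha\}$. (The right-hand side is defined when $[(\alpha^\vee,z)+k]\ne0$ for all $\alpha\in R$, $k\in\mathbb Z$; part of the claim is that it extends to all $z$ in the form (a).) Then: (i) $\psi$ has the form (a); (ii) its coefficient at $\nu=-\rho^\vee$ is $$\psi_{-\rho^\vee}(x)=\prod_\nu\big(\mathfrak m_\omega(x)-\mathfrak m_\omega(x+\nu)\big),$$ with the same set of $\nu$, and this is not identically zero as a function of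 $x$; moreover, the convex hull of $\{\nu:\psi_\nu\not\equiv0\}$ is exactly $\mathcal N$; (iii) $\psi$ is a Baker–Akhiezer function for $(R,m)$; (iv) $D\psi=\mathfrak m_\omega(x)\,\psi$, at all $z$ at which no denominator $[(\alpha^\vee,z)]$, $[(\alpha^\vee,z)+1]$ ($\alpha\in R$) vanishes. -/

import Mathlib

noncomputable section

namespace BakerAkhiezer

open scoped Classical

/-! Throughout, `P` is a root pairing over `ℝ` between `M` (which contains the roots `α`, the
weights and the variable `z`) and `N` (which contains the coroots `α^∨`, the coweights and the
variable `x`); the scalar product `(x, z)` is the pairing `P.toLinearMap z x`.  A root system in a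
Euclidean space `V` is the case `M = N = V` with the inner product as the pairing.

The number `L` is the chosen value of `log q`, so `q = exp L` and `q ^ a = exp (a * L)`. -/

/-- The power `q ^ a = exp (a log q)`, where `L = log q`. -/
def qpow (L : ℂ) (a : ℝ) : ℂ := Complex.exp ((a : ℂ) * L)

/-- The bracket `[a] = q ^ a - q ^ (-a)`. -/
def qbr (L : ℂ) (a : ℝ) : ℂ := qpow L a - qpow L (-a)

variable {ι M N : Type*} [Fintype ι] [AddCommGroup M] [Module ℝ M] [AddCommGroup N] [Module ℝ N]

/-- Integrality of a weight: `(ω, α^∨) ∈ ℤ` for all roots `α`. -/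
def IsWeight (P : RootPairing ι ℝ M N) (ω : M) : Prop :=
  ∀ i, ∃ n : ℤ, P.toLinearMap ω (P.coroot i) = n

/-- Integrality of a coweight: `(α, ν) ∈ ℤ` for all roots `α`. -/
def IsCoweight (P : RootPairing ι ℝ M N) (ν : N) : Prop :=
  ∀ i, ∃ n : ℤ, P.toLinearMap (P.root i) ν = n

/-- Minuscule weights: `-1 ≤ (ω, α^∨) ≤ 1` for all roots `α`. -/
def IsMinuscule (P : RootPairing ι ℝ M N) (ω : M) : Prop :=
  IsWeight P ω ∧ ∀ i, |P.toLinearMap ω (P.coroot i)| ≤ 1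

/-- Quasiminuscule weights: `ω` is a root and `-1 ≤ (ω, α^∨) ≤ 1` for all roots `α ≠ ±ω`. -/
def IsQuasiminuscule (P : RootPairing ι ℝ M N) (ω : M) : Prop :=
  ω ∈ Set.range P.root ∧
    ∀ i, P.root i ≠ ω → P.root i ≠ -ω → |P.toLinearMap ω (P.coroot i)| ≤ 1

/-- The orbit `W ω` of the Weyl group is finite. -/
theorem finite_orbit (P : RootPairing ι ℝ M N) [P.IsRootSystem] (ω : M) :
    (MulAction.orbit P.weylGroup ω).Finite := by
  have h : ω ∈ Submodule.span ℝ (Set.range P.root) := by simp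
  obtain ⟨a, ha⟩ := (Submodule.mem_span_range_iff_exists_fun ℝ).1 h
  refine (Set.finite_range fun σ : Equiv.Perm ι => ∑ i, a i • P.root (σ i)).subset ?_
  rintro _ ⟨g, rfl⟩
  refine ⟨P.weylGroupToPerm g, ?_⟩
  change _ = g • ω
  rw [← ha, Finset.smul_sum]
  refine Finset.sum_congr rfl fun i _ => ?_
  rw [smul_comm, RootPairing.weylGroup_apply_root]

/-- The orbit `W ω`, as a finite set. -/
def weylOrbit (P : RootPairing ι ℝ M N) [P.IsRootSystem] (ω : M) : Finset M :=
  (finite_orbit P ω).toFinset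

/-- The (indices of) positive roots with respect to the basis `b` of simple roots. -/
def posRoots {P : RootPairing ι ℝ M N} (b : P.Base) : Finset ι :=
  Finset.univ.filter b.IsPos

/-- `ρ^∨ = (1/2) ∑_{α > 0} m_α α^∨`. -/
def rhoCheck {P : RootPairing ι ℝ M N} (b : P.Base) (m : ι → ℕ) : N :=
  (1 / 2 : ℝ) • ∑ i ∈ posRoots b, (m i : ℝ) • P.coroot i

/-- The polytope `𝒩 = {ρ^∨ - ∑_{α > 0} l_α α^∨ | 0 ≤ l_α ≤ m_α}`, with real `l_α`. -/
def polytope {P : RootPairing ι ℝ M N} (b : P.Base) (m : ι → ℕ) : Set N :=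
  {ν | ∃ l : ι → ℝ, (∀ i, 0 ≤ l i ∧ l i ≤ m i) ∧
    ν = rhoCheck b m - ∑ i ∈ posRoots b, l i • P.coroot i}

/-- The finite set of all vectors `ν ≠ 0` of the form `ν = ∑_{α > 0} l_α α^∨` with integers
`l_α = 0, …, m_α`. -/
def shifts {P : RootPairing ι ℝ M N} (b : P.Base) (m : ι → ℕ) : Finset N :=
  ((Fintype.piFinset fun i => Finset.range (m i + 1)).image
    fun l : ι → ℕ => ∑ i ∈ posRoots b, l i • P.coroot i).erase 0

/-- The orbit sum `𝔪_ω(x) = ∑_{τ ∈ W ω} q ^ (2 (τ, x))`. -/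
def orbitSum (P : RootPairing ι ℝ M N) [P.IsRootSystem] (L : ℂ) (ω : M) (x : N) : ℂ :=
  ∑ τ ∈ weylOrbit P ω, qpow L (2 * P.toLinearMap τ x)

/-- The coefficient `a_τ(z)` of the Macdonald operator:
`∏_{(α, τ) > 0} [(α^∨, z) - m_α] / [(α^∨, z)]` times
`∏_{(α^∨, τ) = 2} [(α^∨, z) - m_α + 1] / [(α^∨, z) + 1]`.
The condition `(α, τ) > 0` is the same as `(α^∨, τ) > 0`. -/
def macdonaldCoeff (P : RootPairing ι ℝ M N) (m : ι → ℕ) (L : ℂ) (τ : M) (z : M) : ℂ :=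
  (∏ i with 0 < P.toLinearMap τ (P.coroot i),
    qbr L (P.toLinearMap z (P.coroot i) - m i) / qbr L (P.toLinearMap z (P.coroot i))) *
  ∏ i with P.toLinearMap τ (P.coroot i) = 2,
    qbr L (P.toLinearMap z (P.coroot i) - m i + 1) / qbr L (P.toLinearMap z (P.coroot i) + 1)

/-- The shift operator `(T^τ f)(z) = f (z + τ)`. -/
def shiftOp (τ : M) : Module.End ℂ (M → ℂ) := LinearMap.funLeft ℂ ℂ fun z => z + τ

/-- The Macdonald operator
`D^ω_z = ∑_{τ ∈ W ω} a_τ(z) (T^τ - 1) + ∑_{τ ∈ W ω} q ^ (-2 (ρ^∨, τ))` acting on functions of `z`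
(its values are meaningful at those `z` where the denominators do not vanish). -/
def macdonaldOp {P : RootPairing ι ℝ M N} [P.IsRootSystem] (b : P.Base) (m : ι → ℕ) (L : ℂ)
    (ω : M) : Module.End ℂ (M → ℂ) :=
  ∑ τ ∈ weylOrbit P ω, LinearMap.mulLeft ℂ (macdonaldCoeff P m L τ) * (shiftOp τ - 1) +
    algebraMap ℂ (Module.End ℂ (M → ℂ))
      (∑ τ ∈ weylOrbit P ω, qpow L (-2 * P.toLinearMap τ (rhoCheck b m)))

/-- The points `z` where no denominator of the Macdonald operator vanishes. -/
def nonsingularPoints (P : RootPairing ι ℝ M N) (L : ℂ) : Set M :=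
  {z | ∀ i, qbr L (P.toLinearMap z (P.coroot i)) ≠ 0 ∧
    qbr L (P.toLinearMap z (P.coroot i) + 1) ≠ 0}

/-- The points `z` where no denominator of the Macdonald operator or of any of its iterates
vanishes: `[(α^∨, z) + k] ≠ 0` for all roots `α` and all integers `k`.  This set is stable under
shifts by weights, and it is the complement of countably many hyperplanes if `q` is not a root of
unity. -/
def regularPoints (P : RootPairing ι ℝ M N) (L : ℂ) : Set M :=
  {z | ∀ i, ∀ k : ℤ, qbr L (P.toLinearMap z (P.coroot i) + k) ≠ 0}

/-- `Q(z) = q ^ (2 (ρ^∨, z)) ∏_{α > 0} ∏_{j = 1}^{m_α} [(α^∨, z) + j] [(α^∨, z) - j]`. -/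
def polyQ {P : RootPairing ι ℝ M N} (b : P.Base) (m : ι → ℕ) (L : ℂ) (z : M) : ℂ :=
  qpow L (2 * P.toLinearMap z (rhoCheck b m)) *
    ∏ i ∈ posRoots b, ∏ j ∈ Finset.Icc 1 (m i),
      qbr L (P.toLinearMap z (P.coroot i) + j) * qbr L (P.toLinearMap z (P.coroot i) - j)

/-- The function `∏_ν (D - 𝔪_ω(x + ν)) [q ^ (2 (x, z)) Q(z)]`, product over `ν ∈ shifts b m`.
For fixed `x` the factors are the operator `D` in `z` minus scalars; they commute, and their product
is the value at `D` of the polynomial `∏_ν (X - 𝔪_ω(x + ν))`. -/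
def berestFunction {P : RootPairing ι ℝ M N} [P.IsRootSystem] (b : P.Base) (m : ι → ℕ) (L : ℂ)
    (ω : M) (x : N) : M → ℂ :=
  Polynomial.aeval (macdonaldOp b m L ω)
    (∏ ν ∈ shifts b m, (Polynomial.X - Polynomial.C (orbitSum P L ω (x + ν))))
    fun z => qpow L (2 * P.toLinearMap z x) * polyQ b m L z

/-- `ψ(x, z) = q ^ (2 (x, z)) ∑_ν ψ_ν(x) q ^ (2 (ν, z))`, a finite sum over coweights `ν` in the
polytope `𝒩`; the coefficient `ψ_ν(x)` is `c x ν`. -/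
def HasExpansion {P : RootPairing ι ℝ M N} (b : P.Base) (m : ι → ℕ) (L : ℂ)
    (ψ : N → M → ℂ) (c : N → N →₀ ℂ) : Prop :=
  (∀ x, ∀ ν ∈ (c x).support, IsCoweight P ν ∧ ν ∈ polytope b m) ∧
  ∀ x z, ψ x z = qpow L (2 * P.toLinearMap z x) *
    (c x).sum fun ν a => a * qpow L (2 * P.toLinearMap z ν)

/-- Baker–Akhiezer functions: `ψ` has an expansion as above, and for all roots `α` and
`s = 1, …, m_α` one has `ψ(x, z + s α / 2) = ψ(x, z - s α / 2)` whenever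
`q ^ (2 (α^∨, z)) = 1`. -/
def IsBakerAkhiezer {P : RootPairing ι ℝ M N} (b : P.Base) (m : ι → ℕ) (L : ℂ)
    (ψ : N → M → ℂ) : Prop :=
  (∃ c : N → N →₀ ℂ, HasExpansion b m L ψ c) ∧
  ∀ i, ∀ s ∈ Finset.Icc 1 (m i), ∀ x z, qpow L (2 * P.toLinearMap z (P.coroot i)) = 1 →
    ψ x (z + ((s : ℝ) / 2) • P.root i) = ψ x (z - ((s : ℝ) / 2) • P.root i)

end BakerAkhiezer

end

noncomputable section

namespace BakerAkhiezer

open scoped Classical Topology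
open Filter

/-! ### Exponentials -/

section Exponentials

variable {L : ℂ}

/-! Put y = x + ρ^∨ and consider the functions q^{2(y,z)} F(z), where F is an exponential polynomial
with exponents in the lattice spanned by the coroots of nonzero multiplicity. Such a function f is
quasi-invariant if f(s_α z) = f(z) whenever (α^∨, z) is an integer of absolute value at most m_α.
The initial function q^{2(x,z)} Q(z) is quasi-invariant because it vanishes on all these hyperplanes
with (α^∨, z) ≠ 0.

The operator D preserves quasi-invariants (`exists_expFun_eq_macdonaldOp`). The simple poles of its
coefficients cancel, either between τ and s_α τ or because f(z + τ) - f(z) vanishes.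
Quasi-invariance survives because a_τ vanishes where the shift by τ would leave the range |(α^∨, z)|
≤ m_α.

In the direction of a regular ξ, a_τ tends to q^{-2(τ, ρ_ξ)}, where ρ_ξ is the analogue of ρ^∨ for
the chamber of ξ. Hence D multiplies a leading term with exponent y + v by 𝔪_ω(y + v - ρ_ξ)
(`isTop_of_denom_mul_eq`). In particular D does not enlarge the doubled polytope that contains the
exponents of Q, and it acts on the quasi-invariants supported there.

The eigenvalues of this action are restricted by the possible leading exponents v. For y off a
countable union of hyperplanes, quasi-invariance forces every α^∨-string of exponents to have length
at least m_α (`exists_long_string`). Following the maximizer of a functional from ξ to another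
chamber then shows that v - ρ_ξ lies in 𝒩 (`pair_sub_rhoOf_le`, `pair_top_sub_rhoOf_le`). Lattice
points of 𝒩 come from integral l_α (`exists_balanced_of_lattice`), so y + v - ρ_ξ = x + u with u = 0
or u one of the shifts in the product. By triangularity, the product of D - 𝔪_ω(x + u) over all
these u is zero (`aeval_prod_eq_zero`). The product defining ψ omits only u = 0, so (D - 𝔪_ω(x))ψ =
0.

For generic x the values 𝔪_ω(x + u) with u ≠ 0 differ from 𝔪_ω(x), so the eigenvalue equation pins
the leading exponent of ψ in every generic direction to the corresponding vertex of 𝒩. Generic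
points accumulate at every x and the coefficients are continuous along lines, so the eigenvalue
equation and the bound on the exponents hold for all x (`exists_berest_family`). -/

lemma qpow_add (a b : ℝ) : qpow L (a + b) = qpow L a * qpow L b := by
  simp [qpow, add_mul, Complex.exp_add]

@[simp] lemma qpow_zero : qpow L 0 = 1 := by simp [qpow]

lemma qpow_ne_zero (a : ℝ) : qpow L a ≠ 0 := Complex.exp_ne_zero _

lemma qpow_neg (a : ℝ) : qpow L (-a) = (qpow L a)⁻¹ := by
  simp [qpow, Complex.exp_neg]

lemma qpow_sub (a b : ℝ) : qpow L (a - b) = qpow L a / qpow L b := by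
  rw [sub_eq_add_neg, qpow_add, qpow_neg, div_eq_mul_inv]

lemma qpow_sum {κ : Type*} (s : Finset κ) (f : κ → ℝ) :
    qpow L (∑ i ∈ s, f i) = ∏ i ∈ s, qpow L (f i) := by
  simp only [qpow, Complex.ofReal_sum, Finset.sum_mul, Complex.exp_sum]

lemma qpow_int (n : ℤ) : qpow L n = Complex.exp L ^ n := by
  simp [qpow, Complex.exp_int_mul]

lemma qpow_int_mul (n : ℤ) (a : ℝ) : qpow L (n * a) = qpow L a ^ n := by
  simp only [qpow]
  rw [← Complex.exp_int_mul]
  congr 1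
  push_cast
  ring

lemma hasDerivAt_qpow (a b t : ℝ) :
    HasDerivAt (fun t : ℝ => qpow L (a + b * t)) (qpow L (a + b * t) * (b * L)) t := by
  have h : HasDerivAt (fun t : ℝ => ((a + b * t : ℝ) : ℂ) * L) ((b : ℂ) * L) t := by
    have : HasDerivAt (fun t : ℝ => a + b * t) b t := by
      simpa using ((hasDerivAt_id t).const_mul b).const_add a
    exact this.ofReal_comp.mul_const L
  exact h.cexp

lemma continuous_qpow : Continuous (qpow L) := by
  unfold qpow
  fun_prop

/-- `q` is not a root of unity. -/
def NotRootOfUnity (L : ℂ) : Prop := ∀ n : ℤ, n ≠ 0 → qpow L n ≠ 1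

lemma notRootOfUnity_of_pow {q L : ℂ} (hL : Complex.exp L = q)
    (hq : ∀ n : ℕ, 0 < n → q ^ n ≠ 1) : NotRootOfUnity L := by
  intro n hn h
  rw [qpow_int, hL] at h
  have hpos : 0 < n.natAbs := Int.natAbs_pos.2 hn
  apply hq _ hpos
  rcases Int.natAbs_eq n with e | e
  · rw [e, zpow_natCast] at h
    exact h
  · rw [e, zpow_neg, zpow_natCast, inv_eq_one] at h
    exact h

lemma NotRootOfUnity.ne_zero (h : NotRootOfUnity L) : L ≠ 0 := by
  rintro rfl
  exact h 1 one_ne_zero (by simp [qpow])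

lemma qbr_eq_zero_iff (a : ℝ) : qbr L a = 0 ↔ qpow L (2 * a) = 1 := by
  rw [qbr, sub_eq_zero, qpow_neg, two_mul, qpow_add, ← mul_eq_one_iff_eq_inv₀ (qpow_ne_zero a)]

lemma qbr_neg (a : ℝ) : qbr L (-a) = -qbr L a := by simp [qbr]

lemma qbr_zero : qbr L 0 = 0 := by simp [qbr]

lemma NotRootOfUnity.qbr_int_ne_zero (h : NotRootOfUnity L) {n : ℤ} (hn : n ≠ 0) :
    qbr L n ≠ 0 := by
  rw [Ne, qbr_eq_zero_iff]
  have := h (2 * n) (by omega)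
  simpa using this

lemma hasDerivAt_qbr (a b t : ℝ) :
    HasDerivAt (fun t : ℝ => qbr L (a + b * t))
      ((qpow L (a + b * t) + qpow L (-(a + b * t))) * (b * L)) t := by
  have h1 := hasDerivAt_qpow (L := L) a b t
  have h2 := hasDerivAt_qpow (L := L) (-a) (-b) t
  have h3 := h1.sub h2
  have e : (fun t : ℝ => qpow L (a + b * t)) - (fun t : ℝ => qpow L (-a + -b * t)) =
      fun t : ℝ => qbr L (a + b * t) := by
    funext t
    simp only [qbr, Pi.sub_apply]
    congr 2
    ring
  rw [e] at h3
  refine h3.congr_deriv ?_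
  rw [show -a + -b * t = -(a + b * t) by ring]
  push_cast
  ring

/-- An exponential with nonzero exponent takes the value `1` only countably often. -/
lemma countable_qpow_eq_one (hL : L ≠ 0) (a : ℝ) {b : ℝ} (hb : b ≠ 0) :
    {t : ℝ | qpow L (a + b * t) = 1}.Countable := by
  have hsub : {t : ℝ | qpow L (a + b * t) = 1} ⊆
      (fun t : ℝ => ((a + b * t : ℝ) : ℂ) * L) ⁻¹'
        (Set.range fun n : ℤ => (n : ℂ) * (2 * Real.pi * Complex.I)) := by
    intro t ht
    obtain ⟨n, hn⟩ := Complex.exp_eq_one_iff.1 ht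
    exact ⟨n, hn.symm⟩
  refine Set.Countable.mono hsub ((Set.countable_range _).preimage_of_injOn ?_)
  intro s _ t _ hst
  have h1 := mul_right_cancel₀ hL hst
  have h2 : a + b * s = a + b * t := by exact_mod_cast h1
  exact mul_left_cancel₀ hb (add_left_cancel h2)

lemma eq_of_eq_off_countable {f g : ℝ → ℂ} (hf : Continuous f) (hg : Continuous g) {s : Set ℝ}
    (hs : s.Countable) (h : ∀ t ∉ s, f t = g t) : f = g :=
  hf.ext_on (hs.dense_compl ℝ) hg fun t ht => h t ht

lemma eq_of_qpow_mul_eq_one (hL : L ≠ 0) {a : ℝ} (h : ∀ t : ℝ, qpow L (a * t) = 1) : a = 0 := by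
  by_contra ha
  have h1 := countable_qpow_eq_one hL 0 ha
  have h2 : {t : ℝ | qpow L (0 + a * t) = 1} = Set.univ := by
    ext t
    simp [h t]
  rw [h2] at h1
  exact Set.not_countable_univ h1

section Characters

variable {V : Type*} [AddCommGroup V] [Module ℝ V]

/-- The character `v ↦ q ^ φ(v)`. -/
def expChar (L : ℂ) (φ : V →ₗ[ℝ] ℝ) : Multiplicative V →* ℂ where
  toFun v := qpow L (φ v.toAdd)
  map_one' := by simp
  map_mul' v w := by simp [qpow_add]

lemma expChar_injective (hL : L ≠ 0) :
    Function.Injective (expChar L : (V →ₗ[ℝ] ℝ) → (Multiplicative V →* ℂ)) := by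
  intro φ ψ h
  ext v
  rw [← sub_eq_zero]
  refine eq_of_qpow_mul_eq_one hL fun t => ?_
  have := DFunLike.congr_fun h (Multiplicative.ofAdd (t • v))
  simp only [expChar, MonoidHom.coe_mk, OneHom.coe_mk, toAdd_ofAdd, map_smul, smul_eq_mul] at this
  rw [sub_mul, qpow_sub, mul_comm, this, mul_comm, div_self (qpow_ne_zero _)]

/-- If an exponential sum vanishes identically, so does the sum of the coefficients of each
character. -/
lemma sum_fiber_eq_zero (hL : L ≠ 0) {κ : Type*} (s : Finset κ) (φ : κ → (V →ₗ[ℝ] ℝ)) (a : κ → ℂ)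
    (h : ∀ v, ∑ k ∈ s, a k * qpow L (φ k v) = 0) (φ₀ : V →ₗ[ℝ] ℝ) :
    ∑ k ∈ s with φ k = φ₀, a k = 0 := by
  -- Dedekind independence of characters; distinct functionals give distinct characters because L ≠
  -- 0.
  have hli := (linearIndependent_monoidHom (Multiplicative V) ℂ).comp _
    (expChar_injective (V := V) hL)
  rw [linearIndependent_iff'] at hli
  have key := hli (s.image φ) (fun ψ => ∑ k ∈ s with φ k = ψ, a k) (by
    funext v
    rw [Finset.sum_apply]
    refine Eq.trans ?_ (h v.toAdd)
    rw [← Finset.sum_fiberwise_of_maps_to (t := s.image φ) (g := φ)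
      (fun k hk => Finset.mem_image_of_mem _ hk)]
    refine Finset.sum_congr rfl fun ψ _ => ?_
    simp only [Function.comp_apply, Pi.smul_apply, smul_eq_mul, Finset.sum_mul]
    refine Finset.sum_congr rfl fun k hk => ?_
    rw [← (Finset.mem_filter.1 hk).2]
    rfl)
  by_cases h0 : φ₀ ∈ s.image φ
  · exact key _ h0
  · refine Finset.sum_eq_zero fun k hk => ?_
    exact absurd (Finset.mem_image.2 ⟨k, (Finset.mem_filter.1 hk).1, (Finset.mem_filter.1 hk).2⟩) h0

end Characters

end Exponentials

/-! ### Exponential polynomials -/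

section Evaluation

open AddMonoidAlgebra

variable {ι M N : Type*} [AddCommGroup M] [Module ℝ M] [AddCommGroup N] [Module ℝ N]
variable (P : RootPairing ι ℝ M N) (L : ℂ)

/-- Evaluation at `z` of the exponential polynomial whose exponents are given by `N`: the basis
element attached to `ν` becomes `q ^ (2 (z, ν))`. -/
def evalAt (z : M) : AddMonoidAlgebra ℂ N →ₐ[ℂ] ℂ :=
  AddMonoidAlgebra.lift ℂ ℂ N
    (expChar L ((2 : ℝ) • P.toLinearMap z))

variable {P L}

lemma evalAt_apply (z : M) (F : AddMonoidAlgebra ℂ N) :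
    evalAt P L z F = F.coeff.sum fun ν a => a * qpow L (2 * P.toLinearMap z ν) := by
  rw [evalAt, AddMonoidAlgebra.lift_apply]
  rfl

@[simp] lemma evalAt_single (z : M) (ν : N) (a : ℂ) :
    evalAt P L z (single ν a) = a * qpow L (2 * P.toLinearMap z ν) := by
  rw [evalAt_apply, AddMonoidAlgebra.coeff_single, Finsupp.sum_single_index (by simp)]

lemma evalAt_eq_sum (z : M) (F : AddMonoidAlgebra ℂ N) {s : Finset N} (hs : F.coeff.support ⊆ s) :
    evalAt P L z F = ∑ ν ∈ s, F.coeff ν * qpow L (2 * P.toLinearMap z ν) := by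
  rw [evalAt_apply, Finsupp.sum_of_support_subset _ hs _ (by simp)]

lemma evalAt_line (z v : M) (F : AddMonoidAlgebra ℂ N) (t : ℝ) :
    evalAt P L (z + t • v) F = F.coeff.sum fun ν a =>
      a * qpow L (2 * P.toLinearMap z ν + 2 * P.toLinearMap v ν * t) := by
  rw [evalAt_apply]
  refine Finsupp.sum_congr fun ν _ => ?_
  congr 2
  simp
  ring

lemma differentiable_evalAt_line (z v : M) (F : AddMonoidAlgebra ℂ N) :
    Differentiable ℝ fun t : ℝ => evalAt P L (z + t • v) F := by
  simp_rw [evalAt_line]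
  unfold Finsupp.sum
  refine Differentiable.fun_sum fun ν _ => ?_
  exact (fun t => ((hasDerivAt_qpow _ _ t).differentiableAt.const_mul _))

/-- The function `q ^ (2 (z, y)) F(z)`. -/
def expFun (P : RootPairing ι ℝ M N) (L : ℂ) (y : N) (F : AddMonoidAlgebra ℂ N) (z : M) : ℂ :=
  qpow L (2 * P.toLinearMap z y) * evalAt P L z F

lemma expFun_eq_sum (y : N) (F : AddMonoidAlgebra ℂ N) (z : M) :
    expFun P L y F z =
      F.coeff.sum fun ν a => a * qpow L (2 * P.toLinearMap z (y + ν)) := by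
  rw [expFun, evalAt_apply, Finsupp.mul_sum]
  refine Finsupp.sum_congr fun ν _ => ?_
  rw [map_add, mul_add, qpow_add]
  ring

lemma differentiable_expFun_line (y : N) (F : AddMonoidAlgebra ℂ N) (z v : M) :
    Differentiable ℝ fun t : ℝ => expFun P L y F (z + t • v) := by
  refine Differentiable.mul ?_ (differentiable_evalAt_line z v F)
  intro t
  have := (hasDerivAt_qpow (L := L) (2 * P.toLinearMap z y) (2 * P.toLinearMap v y) t)
  refine this.differentiableAt.congr_of_eventuallyEq (Eventually.of_forall fun s => ?_)
  simp only []
  congr 1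
  simp
  ring

/-- If an exponential polynomial vanishes on `z₀ + V`, then the partial sums over the
classes of exponents with the same restriction to `V` vanish. -/
lemma sum_class_eq_zero (hL : L ≠ 0) (V : Submodule ℝ M) (z₀ : M) {κ : Type*} (s : Finset κ)
    (e : κ → N) (a : κ → ℂ)
    (h : ∀ v ∈ V, ∑ k ∈ s, a k * qpow L (2 * P.toLinearMap (z₀ + v) (e k)) = 0) (ν₀ : N) :
    ∑ k ∈ s with (∀ v ∈ V, P.toLinearMap v (e k) = P.toLinearMap v ν₀),
      a k * qpow L (2 * P.toLinearMap z₀ (e k)) = 0 := by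
  let φ : N → (V →ₗ[ℝ] ℝ) := fun ν => (2 : ℝ) • ((P.toLinearMap.flip ν).domRestrict V)
  have := sum_fiber_eq_zero (V := V) hL s (fun k => φ (e k))
    (fun k => a k * qpow L (2 * P.toLinearMap z₀ (e k))) (fun v => by
      rw [← h v v.2]
      refine Finset.sum_congr rfl fun k _ => ?_
      rw [mul_assoc, ← qpow_add]
      congr 2
      simp [φ]
      ring) (φ ν₀)
  convert this using 2
  ext k
  simp only [Finset.mem_filter, and_congr_right_iff]
  intro _
  constructor
  · intro hv
    ext v
    simp [φ, hv v v.2]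
  · intro hv v hvV
    have := LinearMap.congr_fun hv ⟨v, hvV⟩
    simpa [φ] using this

lemma eq_zero_of_evalAt_eq_zero (hL : L ≠ 0) {F : AddMonoidAlgebra ℂ N}
    (h : ∀ z, evalAt P L z F = 0) : F = 0 := by
  rw [← AddMonoidAlgebra.coeff_inj]
  ext ν
  have := sum_class_eq_zero (P := P) hL ⊤ 0 F.coeff.support id F.coeff (fun v _ => by
    rw [← h (0 + v), evalAt_eq_sum _ _ subset_rfl]; rfl) ν
  by_cases hν : ν ∈ F.coeff.support
  · rw [Finset.sum_eq_single_of_mem ν (by simpa using hν)] at this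
    · simpa using this
    · intro k hk hkν
      exfalso
      apply hkν
      apply (LinearMap.IsPerfPair.bijective_right (p := P.toLinearMap)).1
      ext v
      exact (Finset.mem_filter.1 hk).2 v trivial
  · simpa using hν

variable [Finite ι]

lemma exists_forall_coroot_ne_zero (P : RootPairing ι ℝ M N) :
    ∃ v : M, ∀ i, P.toLinearMap v (P.coroot i) ≠ 0 := by
  refine Module.Dual.exists_forall_ne_zero_of_forall_exists
    (fun i => P.toLinearMap.flip (P.coroot i)) fun i => ⟨P.root i, ?_⟩
  simp [P.root_coroot_two]

lemma countable_not_regular (hL : L ≠ 0) (z : M) {v : M}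
    (hv : ∀ i, P.toLinearMap v (P.coroot i) ≠ 0) :
    {t : ℝ | z + t • v ∉ regularPoints P L}.Countable := by
  have : {t : ℝ | z + t • v ∉ regularPoints P L} ⊆ ⋃ i, ⋃ k : ℤ,
      {t : ℝ | qpow L (2 * (P.toLinearMap z (P.coroot i) + k) +
        2 * P.toLinearMap v (P.coroot i) * t) = 1} := by
    intro t ht
    simp only [regularPoints, Set.mem_ofPred_eq, not_forall, not_not, qbr_eq_zero_iff] at ht
    obtain ⟨i, k, h⟩ := ht
    simp only [Set.mem_iUnion, Set.mem_ofPred_eq]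
    refine ⟨i, k, ?_⟩
    rw [← h]
    congr 1
    simp
    ring
  refine Set.Countable.mono this ?_
  refine Set.countable_iUnion fun i => Set.countable_iUnion fun k => ?_
  exact countable_qpow_eq_one hL _ (mul_ne_zero two_ne_zero (hv i))

/-- A line transversal to all coroot hyperplanes is irregular at only countably many parameters, and
continuity settles those. Openness is not available: for |q| = 1 the excluded parameters may be
dense. -/
lemma eq_zero_of_forall_regular (hL : L ≠ 0) {F : AddMonoidAlgebra ℂ N}
    (h : ∀ z ∈ regularPoints P L, evalAt P L z F = 0) : F = 0 := by
  obtain ⟨v, hv⟩ := exists_forall_coroot_ne_zero P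
  refine eq_zero_of_evalAt_eq_zero (P := P) hL fun z => ?_
  have := eq_of_eq_off_countable (differentiable_evalAt_line (P := P) (L := L) z v F).continuous
    continuous_const (countable_not_regular hL z hv) (g := fun _ => 0) (fun t ht => h _ (by
      simpa using ht))
  simpa using congrFun this 0

lemma eq_of_expFun_eq (hL : L ≠ 0) (y : N) {F G : AddMonoidAlgebra ℂ N}
    (h : ∀ z ∈ regularPoints P L, expFun P L y F z = expFun P L y G z) : F = G := by
  rw [← sub_eq_zero]
  refine eq_zero_of_forall_regular (P := P) hL fun z hz => ?_
  rw [map_sub, sub_eq_zero]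
  exact mul_left_cancel₀ (qpow_ne_zero _) (h z hz)

omit [Finite ι] in
lemma regularPoints_subset : regularPoints P L ⊆ nonsingularPoints P L := by
  intro z hz i
  have h0 := hz i 0
  have h1 := hz i 1
  simp at h0 h1
  exact ⟨h0, h1⟩

end Evaluation

end BakerAkhiezer

end

noncomputable section

namespace BakerAkhiezer

open scoped Classical Topology
open Filter

/-! ### Root combinatorics -/

section Roots

variable {ι M N : Type*} [AddCommGroup M] [Module ℝ M] [AddCommGroup N] [Module ℝ N]
variable (P : RootPairing ι ℝ M N)

/-- The index of the root `-α`. -/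
def opp (i : ι) : ι := P.reflectionPerm i i

@[simp] lemma root_opp (i : ι) : P.root (opp P i) = -P.root i := by
  rw [opp, P.root_reflectionPerm, P.reflection_apply_self]

@[simp] lemma coroot_opp (i : ι) : P.coroot (opp P i) = -P.coroot i := by
  rw [opp, P.coroot_reflectionPerm, P.coreflection_apply_self]

@[simp] lemma opp_opp (i : ι) : opp P (opp P i) = i := P.root.injective (by simp)

lemma opp_ne (i : ι) : opp P i ≠ i := by
  intro h
  have h2 := congrArg P.root h
  rw [root_opp, neg_eq_iff_add_eq_zero, ← two_smul ℝ] at h2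
  exact P.ne_zero i ((smul_eq_zero.1 h2).resolve_left two_ne_zero)

/-- Negation as a permutation of the indices. -/
def oppPerm : Equiv.Perm ι := Function.Involutive.toPerm (opp P) (opp_opp P)

@[simp] lemma oppPerm_apply (i : ι) : oppPerm P i = opp P i := rfl

lemma pair_coroot_reflectionPerm (z : M) (i j : ι) :
    P.toLinearMap z (P.coroot (P.reflectionPerm i j)) =
      P.toLinearMap (P.reflection i z) (P.coroot j) := by
  have h := P.root_coroot_two i
  rw [P.coroot_reflectionPerm, P.coreflection_apply, P.reflection_apply]
  simp
  ring

lemma pair_coreflection (z : M) (i : ι) (ν : N) :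
    P.toLinearMap z (P.coreflection i ν) = P.toLinearMap (P.reflection i z) ν := by
  rw [P.coreflection_apply, P.reflection_apply]
  simp
  ring

lemma eq_of_forall_pair {ν μ : N} (h : ∀ z, P.toLinearMap z ν = P.toLinearMap z μ) : ν = μ := by
  apply (LinearMap.IsPerfPair.bijective_right (p := P.toLinearMap)).1
  ext v
  exact h v

lemma exists_pair_ne_zero {ν : N} (h : ν ≠ 0) : ∃ z, P.toLinearMap z ν ≠ 0 := by
  by_contra! hc
  exact h (eq_of_forall_pair P (by simpa using hc))

lemma exists_pair_eq (φ : N →ₗ[ℝ] ℝ) : ∃ z, ∀ ν, P.toLinearMap z ν = φ ν := by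
  obtain ⟨z, hz⟩ := (LinearMap.IsPerfPair.bijective_left (p := P.toLinearMap)).2 φ
  exact ⟨z, fun ν => by rw [← hz]⟩

lemma exists_pair_ne_zero_of_finite {S : Set N} (hS : S.Finite) (h0 : ∀ w ∈ S, w ≠ 0) :
    ∃ v : M, ∀ w ∈ S, P.toLinearMap v w ≠ 0 := by
  have : Finite S := hS
  obtain ⟨v, hv⟩ := Module.Dual.exists_forall_ne_zero_of_forall_exists
    (fun w : S => P.toLinearMap.flip (w : N)) fun w => by
      simpa using exists_pair_ne_zero P (h0 w w.2)
  exact ⟨v, fun w hw => by simpa using hv ⟨w, hw⟩⟩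

lemma eventually_affine_ne_zero (a : ℝ) {b : ℝ} (hb : b ≠ 0) :
    ∀ᶠ t in 𝓝[≠] (0 : ℝ), a + t * b ≠ 0 := by
  by_cases ha : a = 0
  · filter_upwards [self_mem_nhdsWithin] with t ht
    simpa [ha, hb] using ht
  · have hc : ContinuousAt (fun t : ℝ => a + t * b) 0 := by fun_prop
    exact (hc.eventually_ne (by simpa using ha)).filter_mono nhdsWithin_le_nhds

/-- Any vector can be moved off finitely many hyperplanes by a small perturbation. -/
lemma exists_generic_direction {S : Set N} (hS : S.Finite) (h0 : ∀ w ∈ S, w ≠ 0) (ξ : M) :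
    ∃ v : M, ∀ᶠ t in 𝓝[≠] (0 : ℝ), ∀ w ∈ S, P.toLinearMap (ξ + t • v) w ≠ 0 := by
  obtain ⟨v, hv⟩ := exists_pair_ne_zero_of_finite P hS h0
  refine ⟨v, (hS.eventually_all).2 fun w hw => ?_⟩
  filter_upwards [eventually_affine_ne_zero (P.toLinearMap ξ w) (hv w hw)] with t ht
  simpa using ht

/-- `ξ` is regular: no coroot vanishes on it. -/
def IsRegular (ξ : M) : Prop := ∀ i, P.toLinearMap ξ (P.coroot i) ≠ 0

lemma IsRegular.reflection {ξ : M} (h : IsRegular P ξ) (j : ι) :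
    IsRegular P (P.reflection j ξ) := by
  intro i
  rw [← pair_coroot_reflectionPerm]
  exact h _

variable [Fintype ι]

/-- The half sum of the coroots `α^∨`, with multiplicities, over the roots with `(ξ, α^∨) > 0`. -/
def rhoOf (m : ι → ℕ) (ξ : M) : N :=
  (1 / 2 : ℝ) • ∑ i with 0 < P.toLinearMap ξ (P.coroot i), (m i : ℝ) • P.coroot i

/-- The support function of the polytope. -/
def supportFun (m : ι → ℕ) (ξ : M) : ℝ :=
  (1 / 4 : ℝ) * ∑ i, (m i : ℝ) * |P.toLinearMap ξ (P.coroot i)|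

variable {P} in
-- Exactly one of α, -α is positive on a regular vector, so a sum over all roots can be folded with
-- respect to any chamber.
lemma sum_eq_sum_pos {A : Type*} [AddCommMonoid A] {ξ : M} (hξ : IsRegular P ξ) (g : ι → A) :
    ∑ i, g i = ∑ i with 0 < P.toLinearMap ξ (P.coroot i), (g i + g (opp P i)) := by
  rw [Finset.sum_add_distrib,
    ← Finset.sum_filter_add_sum_filter_not Finset.univ
      (fun i => 0 < P.toLinearMap ξ (P.coroot i))]
  congr 1
  refine Finset.sum_equiv (oppPerm P) (fun i => ?_) (fun i _ => by simp)
  simp only [Finset.mem_filter, Finset.mem_univ, true_and, oppPerm_apply, coroot_opp, map_neg,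
    not_lt, Left.neg_pos_iff]
  exact ⟨fun h => lt_of_le_of_ne h (hξ i), le_of_lt⟩

variable {P} in
-- Thus ρ_ξ is the vertex of the polytope at which ξ is largest.
lemma pair_rhoOf_self {m : ι → ℕ} (hm : ∀ i j, m (P.reflectionPerm i j) = m j) {ξ : M}
    (hξ : IsRegular P ξ) : P.toLinearMap ξ (rhoOf P m ξ) = supportFun P m ξ := by
  rw [supportFun, sum_eq_sum_pos hξ, rhoOf, map_smul, map_sum, smul_eq_mul,
    show (1 / 4 : ℝ) = 1 / 2 * (1 / 2) by norm_num, mul_assoc]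
  congr 1
  rw [Finset.mul_sum]
  refine Finset.sum_congr rfl fun i hi => ?_
  rw [opp, hm, ← opp]
  simp only [map_smul, smul_eq_mul, coroot_opp, map_neg, abs_neg,
    abs_of_pos (Finset.mem_filter.1 hi).2]
  ring

lemma supportFun_continuous_line (m : ι → ℕ) (ξ v : M) :
    Continuous fun t : ℝ => supportFun P m (ξ + t • v) := by
  simp only [supportFun, map_add, map_smul, LinearMap.add_apply, LinearMap.smul_apply, smul_eq_mul]
  fun_prop

omit [Fintype ι] in
lemma pair_continuous_line (ξ v : M) (ν : N) :
    Continuous fun t : ℝ => P.toLinearMap (ξ + t • v) ν := by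
  simp only [map_add, map_smul, LinearMap.add_apply, LinearMap.smul_apply, smul_eq_mul]
  fun_prop

variable {P} in
lemma rhoOf_reflection {m : ι → ℕ} (hm : ∀ i j, m (P.reflectionPerm i j) = m j) (ξ : M)
    (j : ι) : rhoOf P m (P.reflection j ξ) = P.coreflection j (rhoOf P m ξ) := by
  rw [rhoOf, rhoOf, map_smul, map_sum]
  congr 1
  refine Finset.sum_equiv (P.reflectionPerm j) (fun i => ?_) fun i _ => ?_
  · rw [Finset.mem_filter, Finset.mem_filter, pair_coroot_reflectionPerm]
    simp
  · rw [hm, map_smul, P.coroot_reflectionPerm, P.coreflection_same]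

lemma rhoOf_congr (m : ι → ℕ) {ξ η : M}
    (h : ∀ i, 0 < P.toLinearMap ξ (P.coroot i) ↔ 0 < P.toLinearMap η (P.coroot i)) :
    rhoOf P m ξ = rhoOf P m η := by
  rw [rhoOf, rhoOf]
  simp only [h]

variable {P}

/-- A vector in the open chamber of a base. -/
lemma exists_dominant [P.IsRootSystem] [P.IsCrystallographic] (b : P.Base) :
    ∃ ξ : M, IsRegular P ξ ∧ ∀ i, b.IsPos i ↔ 0 < P.toLinearMap ξ (P.coroot i) := by
  -- The vector with value 1 on every simple coroot. Positivity is defined by expanding roots, not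
  -- coroots, over the base; polarization, linear in the root and sending it to a positive multiple
  -- of its coroot, bridges the two.
  obtain ⟨ξ, hξ⟩ := exists_pair_eq P (b.toCoweightBasis.constr ℝ fun _ => (1 : ℝ))
  have h1 : ∀ j ∈ b.support, P.toLinearMap ξ (P.coroot j) = 1 := fun j hj => by
    rw [hξ, ← b.toCoweightBasis_apply ⟨j, hj⟩, Module.Basis.constr_basis]
  have hnorm : ∀ i, 0 < P.RootForm (P.root i) (P.root i) := fun i =>
    P.rootForm_pos_of_ne_zero (by simp) (P.ne_zero i)
  have hpol : ∀ i, P.toLinearMap ξ (P.PolarizationEquiv (P.root i)) =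
      P.RootForm (P.root i) (P.root i) / 2 * P.toLinearMap ξ (P.coroot i) := fun i => by
    rw [P.coroot_eq_polarizationEquiv_apply_root i, map_smul, smul_eq_mul]
    field_simp [(hnorm i).ne']
  have key : ∀ i (f : ι → ℤ), P.root i = ∑ j ∈ b.support, f j • P.root j →
      P.RootForm (P.root i) (P.root i) / 2 * P.toLinearMap ξ (P.coroot i) =
        ∑ j ∈ b.support, (f j : ℝ) * (P.RootForm (P.root j) (P.root j) / 2) := fun i f hf => by
    rw [← hpol]
    conv_lhs => rw [hf]
    rw [map_sum, map_sum]
    refine Finset.sum_congr rfl fun j hj => ?_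
    rw [map_zsmul, map_zsmul, hpol, h1 j hj]
    simp
  have main : ∀ i, (b.IsPos i ∧ 0 < P.toLinearMap ξ (P.coroot i)) ∨
      (¬ b.IsPos i ∧ P.toLinearMap ξ (P.coroot i) < 0) := fun i => by
    obtain ⟨f, hf0, hf | hf, hf2⟩ := b.exists_root_eq_sum_int i
    · left
      obtain ⟨hle, j, hj⟩ := Pi.lt_def.1 hf
      have hjs : j ∈ b.support := hf0 (ne_of_gt hj)
      constructor
      · rw [b.isPos_iff, RootPairing.Base.height_eq_sum hf2]
        exact Finset.sum_pos' (fun i _ => hle i) ⟨j, hjs, hj⟩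
      · have h := key i f hf2
        have hpos : 0 < ∑ j ∈ b.support, (f j : ℝ) * (P.RootForm (P.root j) (P.root j) / 2) :=
          Finset.sum_pos' (fun i _ => mul_nonneg (by exact_mod_cast hle i)
            (by linarith [hnorm i])) ⟨j, hjs, mul_pos (by exact_mod_cast hj)
            (by linarith [hnorm j])⟩
        rw [← h] at hpos
        exact (pos_iff_pos_of_mul_pos hpos).1 (by linarith [hnorm i])
    · right
      obtain ⟨hle, j, hj⟩ := Pi.lt_def.1 hf
      have hjs : j ∈ b.support := hf0 (ne_of_lt hj)
      constructor
      · rw [b.isPos_iff, RootPairing.Base.height_eq_sum hf2, not_lt]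
        exact Finset.sum_nonpos fun i _ => hle i
      · have h := key i f hf2
        have hneg : ∑ j ∈ b.support, (f j : ℝ) * (P.RootForm (P.root j) (P.root j) / 2) < 0 :=
          Finset.sum_neg' (fun i _ => mul_nonpos_of_nonpos_of_nonneg (by exact_mod_cast hle i)
            (by linarith [hnorm i])) ⟨j, hjs, mul_neg_of_neg_of_pos (by exact_mod_cast hj)
            (by linarith [hnorm j])⟩
        rw [← h] at hneg
        exact neg_of_mul_neg_right hneg (by linarith [hnorm i])
  refine ⟨ξ, fun i => ?_, fun i => ?_⟩
  · rcases main i with h | h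
    · exact h.2.ne'
    · exact h.2.ne
  · rcases main i with h | h
    · exact iff_of_true h.1 h.2
    · exact iff_of_false h.1 h.2.not_gt

lemma rhoCheck_eq_rhoOf {b : P.Base} (m : ι → ℕ) {ξ : M}
    (h : ∀ i, b.IsPos i ↔ 0 < P.toLinearMap ξ (P.coroot i)) : rhoCheck b m = rhoOf P m ξ := by
  rw [rhoCheck, rhoOf, posRoots]
  congr 2
  ext i
  simp [h]

/-! ### The orbit -/

lemma mem_weylOrbit [P.IsRootSystem] {ω τ : M} :
    τ ∈ weylOrbit P ω ↔ τ ∈ MulAction.orbit P.weylGroup ω := by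
  simp [weylOrbit]

lemma reflection_mem_weylOrbit [P.IsRootSystem] {ω τ : M} (i : ι) (h : τ ∈ weylOrbit P ω) :
    P.reflection i τ ∈ weylOrbit P ω := by
  rw [mem_weylOrbit] at h ⊢
  have h2 : P.reflection i τ = RootPairing.weylGroup.ofIdx P i • τ := rfl
  rw [h2]
  exact MulAction.mem_orbit_of_mem_orbit _ h

lemma self_mem_weylOrbit [P.IsRootSystem] (ω : M) : ω ∈ weylOrbit P ω :=
  mem_weylOrbit.2 (MulAction.mem_orbit_self ω)

lemma weylOrbit_induction [P.IsRootSystem] {ω : M} {p : M → Prop} (h0 : p ω)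
    (h1 : ∀ i τ, p τ → p (P.reflection i τ)) {τ : M} (hτ : τ ∈ weylOrbit P ω) : p τ := by
  rw [mem_weylOrbit] at hτ
  obtain ⟨⟨g, hg⟩, rfl⟩ := hτ
  suffices ∀ σ, p σ → p ((⟨g, hg⟩ : P.weylGroup) • σ) from this ω h0
  induction hg using RootPairing.weylGroup.induction with
  | mem i => exact fun σ hσ => h1 i σ hσ
  | one =>
    intro σ hσ
    have : (⟨1, one_mem _⟩ : P.weylGroup) • σ = σ := one_smul P.weylGroup σ
    rwa [this]
  | mul g₁ g₂ h₁ h₂ ih₁ ih₂ =>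
    intro σ hσ
    have := ih₁ _ (ih₂ _ hσ)
    rwa [← mul_smul] at this

lemma sum_weylOrbit_reflection [P.IsRootSystem] {A : Type*} [AddCommMonoid A] (ω : M) (i : ι)
    (f : M → A) : ∑ τ ∈ weylOrbit P ω, f (P.reflection i τ) = ∑ τ ∈ weylOrbit P ω, f τ := by
  refine Finset.sum_bij' (fun τ _ => P.reflection i τ) (fun τ _ => P.reflection i τ)
    (fun τ h => reflection_mem_weylOrbit i h) (fun τ h => reflection_mem_weylOrbit i h)
    (fun τ _ => P.reflection_same i τ) (fun τ _ => P.reflection_same i τ) fun τ _ => rfl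

/-- The pairings of the shifts in the Macdonald operator with the coroots. -/
def IsSmallWeight (P : RootPairing ι ℝ M N) (τ : M) : Prop :=
  ∀ i, ∃ n : ℤ, P.toLinearMap τ (P.coroot i) = n ∧ (|n| ≤ 1 ∨ τ = P.root i ∨ τ = -P.root i)

omit [Fintype ι] in
lemma isSmallWeight_of_minuscule [P.IsCrystallographic] {ω : M}
    (hω : IsMinuscule P ω ∨ IsQuasiminuscule P ω) : IsSmallWeight P ω := by
  intro i
  rcases hω with ⟨h1, h2⟩ | ⟨⟨j, rfl⟩, h2⟩
  · obtain ⟨n, hn⟩ := h1 i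
    refine ⟨n, hn, Or.inl ?_⟩
    have := h2 i
    rw [hn] at this
    exact_mod_cast this
  · refine ⟨P.pairingIn ℤ j i, ?_, ?_⟩
    · rw [P.root_coroot_eq_pairing]
      exact (P.algebraMap_pairingIn ℤ j i).symm
    · by_cases ha : P.root i = P.root j
      · exact Or.inr (Or.inl ha.symm)
      by_cases hb : P.root i = -P.root j
      · exact Or.inr (Or.inr (by rw [hb, neg_neg]))
      left
      have := h2 i ha hb
      rw [P.root_coroot_eq_pairing, ← P.algebraMap_pairingIn ℤ j i, eq_intCast] at this
      exact_mod_cast this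

omit [Fintype ι] in
lemma IsSmallWeight.reflection {τ : M} (h : IsSmallWeight P τ) (k : ι) :
    IsSmallWeight P (P.reflection k τ) := by
  intro i
  obtain ⟨n, hn, h2⟩ := h (P.reflectionPerm k i)
  rw [pair_coroot_reflectionPerm] at hn
  refine ⟨n, hn, h2.imp_right ?_⟩
  rw [P.root_reflectionPerm]
  rintro (h | h)
  · left
    rw [h, P.reflection_same]
  · right
    rw [h, map_neg, P.reflection_same]

omit [Fintype ι] in
lemma IsSmallWeight.isWeight {τ : M} (h : IsSmallWeight P τ) : IsWeight P τ :=
  fun i => (h i).imp fun _ hn => hn.1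

lemma isSmallWeight_of_mem [P.IsRootSystem] [P.IsCrystallographic] {ω τ : M}
    (hω : IsMinuscule P ω ∨ IsQuasiminuscule P ω) (hτ : τ ∈ weylOrbit P ω) : IsSmallWeight P τ :=
  weylOrbit_induction (isSmallWeight_of_minuscule hω) (fun i _ h => h.reflection i) hτ

/-- The span of the orbit is nonzero and stable under reflections, hence everything by
irreducibility. -/
lemma eq_zero_of_forall_mem_weylOrbit [P.IsRootSystem] [P.IsIrreducible] {ω : M} (hω : ω ≠ 0)
    {ν : N} (h : ∀ τ ∈ weylOrbit P ω, P.toLinearMap τ ν = 0) : ν = 0 := by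
  let V : Submodule ℝ M := Submodule.span ℝ (weylOrbit P ω : Set M)
  have hV : V = ⊤ := by
    refine RootPairing.IsIrreducible.eq_top_of_invtSubmodule_reflection (P := P) V (fun i => ?_) ?_
    · rw [Module.End.mem_invtSubmodule]
      refine Submodule.span_le.2 fun τ hτ => ?_
      exact Submodule.subset_span (reflection_mem_weylOrbit i hτ)
    · rw [Ne, Submodule.span_eq_bot]
      push Not
      exact ⟨ω, self_mem_weylOrbit ω, hω⟩
  refine eq_of_forall_pair P fun z => ?_
  have hz : z ∈ V := by rw [hV]; trivial
  rw [map_zero]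
  have hle : V ≤ LinearMap.ker (P.toLinearMap.flip ν) :=
    Submodule.span_le.2 fun τ hτ => by simpa using h τ hτ
  simpa using hle hz

variable [P.IsRootSystem] [P.IsCrystallographic] [P.IsReduced]

/-- Some element of the Weyl group carries one regular vector to the chamber of another; hence
symmetric functions of `ρ` do not depend on the chamber. -/
lemma apply_rhoOf_eq {A : Type*} {m : ι → ℕ} (hm : ∀ i j, m (P.reflectionPerm i j) = m j)
    (b : P.Base) (f : N → A) (hf : ∀ i ν, f (P.coreflection i ν) = f ν) {ξ : M}
    (hξ : IsRegular P ξ) : f (rhoOf P m ξ) = f (rhoCheck b m) := by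
  obtain ⟨ξ₀, hξ₀, hpos⟩ := exists_dominant b
  rw [rhoCheck_eq_rhoOf m hpos]
  -- Descent on the number of positive roots negative on ξ: the reflection in a simple root of this
  -- kind permutes the other positive roots and removes itself from the count.
  generalize hn : (Finset.univ.filter fun i => b.IsPos i ∧ P.toLinearMap ξ (P.coroot i) < 0).card = n
  induction n using Nat.strong_induction_on generalizing ξ with
  | _ n ih =>
    by_cases hc : ∀ j ∈ b.support, 0 < P.toLinearMap ξ (P.coroot j)
    · congr 1
      have hcl : ∀ ν ∈ AddSubmonoid.closure (P.coroot '' b.support),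
          0 ≤ P.toLinearMap ξ ν ∧ 0 ≤ P.toLinearMap ξ₀ ν := fun ν hν => by
        refine AddSubmonoid.closure_induction ?_ (by simp) ?_ hν
        · rintro _ ⟨j, hj, rfl⟩
          exact ⟨(hc j hj).le, ((hpos j).1 (RootPairing.Base.isPos_of_mem_support hj)).le⟩
        · intro x y _ _ hx hy
          simp only [map_add]
          exact ⟨add_nonneg hx.1 hy.1, add_nonneg hx.2 hy.2⟩
      refine rhoOf_congr P m fun i => ?_
      rcases b.coroot_mem_or_neg_mem i with h | h
      · have := hcl _ h
        exact iff_of_true (lt_of_le_of_ne this.1 (hξ i).symm) (lt_of_le_of_ne this.2 (hξ₀ i).symm)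
      · have := hcl _ h
        simp only [map_neg, Left.nonneg_neg_iff] at this
        exact iff_of_false this.1.not_gt this.2.not_gt
    · push Not at hc
      obtain ⟨j, hj, hjξ⟩ := hc
      have hjξ : P.toLinearMap ξ (P.coroot j) < 0 := lt_of_le_of_ne hjξ (hξ j)
      have hjpos : b.IsPos j := RootPairing.Base.isPos_of_mem_support hj
      rw [← hf j, ← rhoOf_reflection hm]
      refine ih _ ?_ (hξ.reflection P j) rfl
      rw [← hn]
      have hself : P.toLinearMap (P.reflection j ξ) (P.coroot j) =
          -P.toLinearMap ξ (P.coroot j) := by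
        rw [← pair_coroot_reflectionPerm]
        change P.toLinearMap ξ (P.coroot (opp P j)) = _
        rw [coroot_opp, map_neg]
      refine lt_of_le_of_lt (Finset.card_le_card_of_injOn (P.reflectionPerm j)
        (t := (Finset.univ.filter fun i => b.IsPos i ∧ P.toLinearMap ξ (P.coroot i) < 0).erase j)
        (fun i hi => ?_) (P.reflectionPerm j).injective.injOn) (Finset.card_erase_lt_of_mem ?_)
      · simp only [Finset.coe_filter, Finset.mem_univ, true_and, Set.mem_ofPred_eq] at hi
        have hij : i ≠ j := by
          rintro rfl
          rw [hself] at hi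
          linarith [hi.2]
        simp only [Finset.coe_erase, Finset.coe_filter, Finset.mem_univ, true_and,
          Set.mem_sdiff, Set.mem_ofPred_eq, Set.mem_singleton_iff]
        refine ⟨⟨hi.1.reflectionPerm hj hij, by rw [pair_coroot_reflectionPerm]; exact hi.2⟩, ?_⟩
        intro he
        have h2 : i = opp P j := by
          rw [opp, ← P.reflectionPerm_self j i, he]
        have h3 := (hpos i).1 hi.1
        rw [h2, coroot_opp, map_neg] at h3
        linarith [(hpos j).1 hjpos]
      · simpa using ⟨hjpos, hjξ⟩

end Roots

end BakerAkhiezer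

end

noncomputable section

namespace BakerAkhiezer

open scoped Classical Topology
open Filter

/-! ### The polytope and its lattice points -/

section Polytope

variable {ι M N : Type*} [AddCommGroup M] [Module ℝ M] [AddCommGroup N] [Module ℝ N]
variable {P : RootPairing ι ℝ M N}

/-- The image of a compact convex set under a linear map can be strictly separated from any
point outside it. -/
lemma exists_separating [Module.Finite ℝ N] (P : RootPairing ι ℝ M N) {κ : Type*} [Fintype κ]
    {K : Set (κ → ℝ)} (hK : IsCompact K) (hc : Convex ℝ K) (T : (κ → ℝ) →ₗ[ℝ] N) {p : N}
    (hp : p ∉ T '' K) :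
    ∃ ξ : M, ∃ u : ℝ, (∀ k ∈ K, P.toLinearMap ξ (T k) < u) ∧ u < P.toLinearMap ξ p := by
  let e := (Module.finBasis ℝ N).equivFun
  have hcont : Continuous (e.toLinearMap ∘ₗ T) := LinearMap.continuous_of_finiteDimensional _
  obtain ⟨f, u, h1, h2⟩ := geometric_hahn_banach_closed_point
    (s := (e.toLinearMap ∘ₗ T) '' K) (x := e p) (hc.linear_image _)
    (hK.image hcont).isClosed (by
      rintro ⟨k, hk, hkp⟩
      exact hp ⟨k, hk, e.injective hkp⟩)
  obtain ⟨ξ, hξ⟩ := exists_pair_eq P ((f : (Fin _ → ℝ) →ₗ[ℝ] ℝ) ∘ₗ e.toLinearMap)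
  refine ⟨ξ, u, fun k hk => ?_, ?_⟩
  · rw [hξ]
    exact h1 _ ⟨k, hk, rfl⟩
  · rw [hξ]
    exact h2

lemma Base.module_finite [P.IsRootSystem] (b : P.Base) : Module.Finite ℝ N :=
  Module.Finite.of_basis b.toCoweightBasis

variable [Fintype ι]

lemma supportFun_eq_sum_pos {m : ι → ℕ} (hm : ∀ i j, m (P.reflectionPerm i j) = m j) {ξ : M}
    (hξ : IsRegular P ξ) (η : M) :
    supportFun P m η = (1 / 2 : ℝ) * ∑ i with 0 < P.toLinearMap ξ (P.coroot i),
      (m i : ℝ) * |P.toLinearMap η (P.coroot i)| := by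
  rw [supportFun, sum_eq_sum_pos hξ, show (1 / 4 : ℝ) = 1 / 2 * (1 / 2) by norm_num, mul_assoc]
  congr 1
  rw [Finset.mul_sum]
  refine Finset.sum_congr rfl fun i _ => ?_
  rw [opp, hm, ← opp, coroot_opp, map_neg, abs_neg]
  ring

/-- The polytope is an affine image of a box, hence compact and convex and cut out by its support
function. One direction is a termwise estimate, the other separates a point from the image of the
box. -/
lemma mem_polytope_iff [P.IsRootSystem] [P.IsCrystallographic] {b : P.Base} {m : ι → ℕ}
    (hm : ∀ i j, m (P.reflectionPerm i j) = m j) {ν : N} :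
    ν ∈ polytope b m ↔ ∀ ξ, P.toLinearMap ξ ν ≤ supportFun P m ξ := by
  obtain ⟨ξ₀, hξ₀, hpos⟩ := exists_dominant b
  have hposR : posRoots b = Finset.univ.filter fun i => 0 < P.toLinearMap ξ₀ (P.coroot i) := by
    ext i
    simp [posRoots, hpos]
  have hpair : ∀ (ξ : M) (l : ι → ℝ),
      P.toLinearMap ξ (rhoCheck b m - ∑ i ∈ posRoots b, l i • P.coroot i) =
        ∑ i ∈ posRoots b, ((m i : ℝ) / 2 - l i) * P.toLinearMap ξ (P.coroot i) := by
    intro ξ l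
    rw [rhoCheck, map_sub, map_smul, map_sum, map_sum, smul_eq_mul, Finset.mul_sum,
      ← Finset.sum_sub_distrib]
    refine Finset.sum_congr rfl fun i _ => ?_
    simp
    ring
  constructor
  · rintro ⟨l, hl, rfl⟩ ξ
    rw [hpair, supportFun_eq_sum_pos hm hξ₀, hposR, Finset.mul_sum]
    refine Finset.sum_le_sum fun i _ => ?_
    have h1 : |(m i : ℝ) / 2 - l i| ≤ (m i : ℝ) / 2 := by
      rw [abs_le]
      constructor <;> linarith [(hl i).1, (hl i).2]
    calc ((m i : ℝ) / 2 - l i) * P.toLinearMap ξ (P.coroot i)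
        ≤ |((m i : ℝ) / 2 - l i) * P.toLinearMap ξ (P.coroot i)| := le_abs_self _
      _ = |(m i : ℝ) / 2 - l i| * |P.toLinearMap ξ (P.coroot i)| := abs_mul _ _
      _ ≤ (m i : ℝ) / 2 * |P.toLinearMap ξ (P.coroot i)| :=
        mul_le_mul_of_nonneg_right h1 (abs_nonneg _)
      _ = _ := by ring
  · intro h
    by_contra hν
    have := Base.module_finite b
    let T : (ι → ℝ) →ₗ[ℝ] N :=
      -∑ i ∈ posRoots b, (LinearMap.proj i : (ι → ℝ) →ₗ[ℝ] ℝ).smulRight (P.coroot i)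
    have hT : ∀ l, T l = -∑ i ∈ posRoots b, l i • P.coroot i := fun l => by
      simp [T, LinearMap.sum_apply]
    obtain ⟨ξ, u, h1, h2⟩ := exists_separating P (K := Set.Icc 0 fun i => (m i : ℝ))
      isCompact_Icc (convex_Icc _ _) T (p := ν - rhoCheck b m) (by
        rintro ⟨l, hl, hle⟩
        refine hν ⟨l, fun i => ⟨hl.1 i, hl.2 i⟩, ?_⟩
        rw [hT] at hle
        rw [sub_eq_add_neg, hle]
        abel)
    -- The corner of the box where ξ ∘ T is largest; the bound `h1` at this corner places ξ(ν) above
    -- the support function.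
    let l : ι → ℝ := fun i => if P.toLinearMap ξ (P.coroot i) < 0 then m i else 0
    have h3 := h1 l ⟨fun i => by
        simp only [l, Pi.zero_apply]
        split_ifs <;> positivity, fun i => by
        simp only [l]
        split_ifs
        · exact le_rfl
        · positivity⟩
    have h4 : P.toLinearMap ξ (rhoCheck b m) + P.toLinearMap ξ (T l) = supportFun P m ξ := by
      rw [← map_add, hT, ← sub_eq_add_neg, hpair, supportFun_eq_sum_pos hm hξ₀, hposR,
        Finset.mul_sum]
      refine Finset.sum_congr rfl fun i _ => ?_
      simp only [l]
      split_ifs with hs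
      · rw [abs_of_neg hs]
        ring
      · rw [abs_of_nonneg (not_lt.1 hs)]
        ring
    have h5 := h ξ
    rw [map_sub] at h2
    linarith

/-! ### The coroot lattice and balanced coefficients -/

variable (P) in
/-- The lattice generated by the coroots of nonzero multiplicity. -/
def corootLattice (m : ι → ℕ) : AddSubgroup N :=
  AddSubgroup.closure (P.coroot '' {i | 0 < m i})

omit [Fintype ι] in
lemma coroot_mem_corootLattice {m : ι → ℕ} {i : ι} (h : 0 < m i) :
    P.coroot i ∈ corootLattice P m :=
  AddSubgroup.subset_closure ⟨i, h, rfl⟩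

omit [Fintype ι] in
lemma smul_coroot_mem_corootLattice {m : ι → ℕ} (i : ι) :
    (m i : ℝ) • P.coroot i ∈ corootLattice P m := by
  rcases Nat.eq_zero_or_pos (m i) with h | h
  · simp [h]
  · rw [Nat.cast_smul_eq_nsmul]
    exact AddSubgroup.nsmul_mem _ (coroot_mem_corootLattice h) _

omit [Fintype ι] in
lemma exists_int_of_mem_corootLattice [P.IsCrystallographic] {m : ι → ℕ} {ν : N}
    (h : ν ∈ corootLattice P m) (i : ι) : ∃ n : ℤ, P.toLinearMap (P.root i) ν = n := by
  refine AddSubgroup.closure_induction ?_ ⟨0, by simp⟩ ?_ ?_ h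
  · rintro _ ⟨j, -, rfl⟩
    exact ⟨P.pairingIn ℤ i j, (P.algebraMap_pairingIn ℤ i j).symm⟩
  · rintro x y - - ⟨a, ha⟩ ⟨c, hc⟩
    exact ⟨a + c, by simp [ha, hc]⟩
  · rintro x - ⟨a, ha⟩
    exact ⟨-a, by simp [ha]⟩

/-- Where the two chambers disagree on a coroot, the halves contributed by α and -α add up to the
full m_α α^∨; elsewhere they cancel. -/
lemma rhoOf_sub_rhoOf_mem (m : ι → ℕ) (hm : ∀ i j, m (P.reflectionPerm i j) = m j) {ξ η : M}
    (hξ : IsRegular P ξ) (hη : IsRegular P η) :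
    rhoOf P m ξ - rhoOf P m η ∈ corootLattice P m := by
  have h : ∀ {ζ : M}, IsRegular P ζ → rhoOf P m ζ =
      (1 / 2 : ℝ) • ∑ i, (if 0 < P.toLinearMap ζ (P.coroot i) then (m i : ℝ) • P.coroot i
        else 0) := fun _ => by
    rw [rhoOf, Finset.sum_filter]
  have h2 : rhoOf P m ξ - rhoOf P m η = ∑ i with 0 < P.toLinearMap ξ (P.coroot i),
      (if 0 < P.toLinearMap η (P.coroot i) then 0 else (m i : ℝ) • P.coroot i) := by
    rw [h hξ, h hη, ← smul_sub, ← Finset.sum_sub_distrib, sum_eq_sum_pos hξ, Finset.smul_sum]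
    refine Finset.sum_congr rfl fun i hi => ?_
    have hi := (Finset.mem_filter.1 hi).2
    have hmo : m (opp P i) = m i := hm i i
    rcases lt_or_gt_of_ne (hη i) with h3 | h3
    · simp only [hi, coroot_opp, map_neg, Left.neg_pos_iff, h3, h3.not_gt, hi.not_gt, hmo, if_true,
        if_false, smul_neg]
      module
    · simp only [hi, coroot_opp, map_neg, Left.neg_pos_iff, h3, h3.not_gt, hi.not_gt, hmo, if_true,
        if_false, smul_neg]
      module
  rw [h2]
  refine AddSubgroup.sum_mem _ fun i _ => ?_
  split_ifs
  · exact AddSubgroup.zero_mem _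
  · exact smul_coroot_mem_corootLattice i

variable (P) in
/-- Coefficients `l` with `0 ≤ l_α ≤ m_α` and `l_{-α} = m_α - l_α`. -/
def IsBalanced (m : ι → ℕ) (l : ι → ℤ) : Prop :=
  ∀ i, 0 ≤ l i ∧ l i ≤ m i ∧ l (opp P i) = m i - l i

variable (P) in
/-- `(1/2) ∑ l_α α^∨` over all roots. -/
def wt (l : ι → ℤ) : N := (1 / 2 : ℝ) • ∑ i, (l i : ℝ) • P.coroot i

/-- Balanced coefficients live on all roots so that no chamber is preferred; folding along any
regular ξ exhibits the weight as an integral point of the polytope. -/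
lemma wt_eq_of_regular {m : ι → ℕ} {l : ι → ℤ} (hl : IsBalanced P m l) {ξ : M}
    (hξ : IsRegular P ξ) : wt P l =
      ∑ i with 0 < P.toLinearMap ξ (P.coroot i), ((l i : ℝ) - m i / 2) • P.coroot i := by
  rw [wt, sum_eq_sum_pos hξ, Finset.smul_sum]
  refine Finset.sum_congr rfl fun i _ => ?_
  rw [(hl i).2.2, coroot_opp]
  push_cast
  module

/-- Lowering one coefficient by one. -/
lemma exists_balanced_lower {m : ι → ℕ} (hm : ∀ i j, m (P.reflectionPerm i j) = m j)
    {l : ι → ℤ} (hl : IsBalanced P m l) {i : ι} (hi : 0 < l i) :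
    ∃ l', IsBalanced P m l' ∧ wt P l' = wt P l - P.coroot i ∧
      ∀ k, k ≠ i → k ≠ opp P i → l' k = l k := by
  have hmo : ∀ i, m (opp P i) = m i := fun i => hm i i
  let l' : ι → ℤ := fun j => l j - (if j = i then 1 else 0) + (if j = opp P i then 1 else 0)
  refine ⟨l', fun j => ?_, ?_, ?_⟩
  · have hj := hl j
    have h1 := hl i
    have e1 : opp P j = i ↔ j = opp P i :=
      ⟨fun h => by rw [← h, opp_opp], fun h => by rw [h, opp_opp]⟩
    have e2 : opp P j = opp P i ↔ j = i :=
      ⟨fun h => by simpa using congrArg (opp P) h, fun h => by rw [h]⟩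
    have e3 := opp_ne P i
    have e4 := hmo i
    simp only [l', e1, e2]
    by_cases a : j = i
    · subst a
      simp only [e3.symm, if_true, if_false]
      omega
    · by_cases c : j = opp P i
      · subst c
        simp only [e3, if_true, if_false]
        omega
      · simp only [a, c, if_false]
        omega
  · simp only [wt, l', Int.cast_add, Int.cast_sub, Int.cast_ite, Int.cast_one, Int.cast_zero,
      add_smul, sub_smul, ite_smul, one_smul, zero_smul, Finset.sum_add_distrib,
      Finset.sum_sub_distrib, Finset.sum_ite_eq', Finset.mem_univ, if_true, coroot_opp]
    module
  · intro k h1 h2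
    simp [l', h1, h2]

/-- A unit transfer between two opposite pairs of coefficients. -/
lemma exists_balanced_transfer {m : ι → ℕ} (hm : ∀ i j, m (P.reflectionPerm i j) = m j)
    {l : ι → ℤ} (hl : IsBalanced P m l) {i k : ι} (hik : k ≠ i) (hik' : k ≠ opp P i)
    (hi : 0 < l i) (hk : l k < m k) :
    ∃ l', IsBalanced P m l' ∧ wt P l' = wt P l - P.coroot i + P.coroot k := by
  obtain ⟨l₁, hl₁, hw₁, heq⟩ := exists_balanced_lower hm hl hi
  have hmo : m (opp P k) = m k := hm k k
  have h1 : l₁ (opp P k) = l (opp P k) := by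
    refine heq _ (fun h => hik' (by rw [← h, opp_opp])) fun h => hik ?_
    simpa using congrArg (opp P) h
  obtain ⟨l₂, hl₂, hw₂, -⟩ := exists_balanced_lower hm hl₁ (i := opp P k) (by
    rw [h1, (hl k).2.2]
    omega)
  exact ⟨l₂, hl₂, by rw [hw₂, hw₁, coroot_opp, sub_neg_eq_add]⟩

/-! ### Saturation of the integral points of the polytope -/

section Saturation

variable [P.IsCrystallographic] [P.IsReduced]

omit [Fintype ι] [P.IsCrystallographic] in
lemma coroot_ne_two_smul [Finite ι] (i j : ι) : P.coroot j ≠ (2 : ℕ) • P.coroot i := by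
  intro h
  have : Module.IsReflexive ℝ N := .of_isPerfPair P.flip.toLinearMap
  have : IsAddTorsionFree N := .of_isTorsionFree ℝ N
  have h2 := RootPairing.nsmul_notMem_range_root (P := P.flip) (n := 2) (i := i)
  exact h2 ⟨j, h⟩

/-- The set of all `(1/2) ∑ l_α α^∨` is saturated. -/
lemma exists_balanced_sub_coroot {m : ι → ℕ} (hm : ∀ i j, m (P.reflectionPerm i j) = m j)
    {l : ι → ℤ} (hl : IsBalanced P m l) {j : ι} (hj : 0 < m j)
    (hpos : 0 < P.toLinearMap (P.root j) (wt P l)) :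
    ∃ l', IsBalanced P m l' ∧ wt P l' = wt P l - P.coroot j := by
  by_contra hcon
  -- Otherwise `l j` could be lowered by one, which subtracts exactly α_j^∨.
  have hB : l j = 0 := by
    by_contra h0
    have := (hl j).1
    obtain ⟨l', h1, h2, -⟩ := exists_balanced_lower hm hl (i := j) (by omega)
    exact hcon ⟨l', h1, h2⟩
  -- Otherwise moving a unit from i to k changes the weight by α_k^∨ - α_i^∨ = -α_j^∨.
  have hA : ∀ i k, P.coroot k = P.coroot i - P.coroot j → 0 < l i → l k = m k := by
    intro i k hk hi
    by_contra h0
    have := (hl k).2.1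
    have hki : k ≠ i := by
      rintro rfl
      exact P.ne_zero' j (sub_eq_self.1 hk.symm)
    have hki' : k ≠ opp P i := by
      rintro rfl
      rw [coroot_opp] at hk
      refine coroot_ne_two_smul (P := P) i j ?_
      rw [two_nsmul]
      have h3 : P.coroot j = P.coroot i - -P.coroot i := by rw [hk]; abel
      rw [h3]
      abel
    obtain ⟨l', h1, h2⟩ := exists_balanced_transfer hm hl hki hki' hi (by omega)
    exact hcon ⟨l', h1, by rw [h2, hk]; abel⟩
  have hrefl : ∀ i, P.coroot (P.reflectionPerm j i) =
      P.coroot i - P.pairingIn ℤ j i • P.coroot j := fun i => by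
    rw [P.coroot_reflectionPerm, P.coreflection_apply]
    congr 1
    rw [← Int.cast_smul_eq_zsmul ℝ]
    congr 1
    exact (P.algebraMap_pairingIn ℤ j i).symm
  have hsub : ∀ i, i ≠ j → 0 < P.pairingIn ℤ j i →
      ∃ k, P.coroot k = P.coroot i - P.coroot j := fun i hij hp => by
    have h1 : 0 < P.flip.pairingIn ℤ i j := hp
    exact P.flip.root_sub_root_mem_of_pairingIn_pos h1 hij
  -- By `hA` the maximal value propagates from α_i^∨ down its α_j^∨-string to the reflected coroot,
  -- in at most three steps.
  have key : ∀ i, 0 < P.pairingIn ℤ j i → l i ≤ l (P.reflectionPerm j i) := by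
    intro i hp
    by_cases hij : i = j
    · subst hij
      rw [hB]
      exact (hl _).1
    rcases (hl i).1.eq_or_lt with h0 | h0
    · rw [← h0]
      exact (hl _).1
    have hmi := (hl i).2.1
    obtain ⟨k, hk⟩ := hsub i hij hp
    have hlk := hA i k hk h0
    have hne : P.root j ≠ -P.root i := by
      intro h
      have h5 : P.pairingIn ℤ j i = -2 := by
        have : (P.pairingIn ℤ j i : ℝ) = -2 := by
          rw [← eq_intCast (algebraMap ℤ ℝ), P.algebraMap_pairingIn, ← P.root_coroot_eq_pairing, h,
            map_neg, LinearMap.neg_apply, P.root_coroot_two]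
        exact_mod_cast this
      omega
    have hset := P.pairingIn_pairingIn_mem_set_of_isCrystal_of_isRed' j i
      (fun h => hij (P.root.injective h).symm) hne
    have hcases : P.pairingIn ℤ j i = 1 ∨
        (P.pairingIn ℤ i j = 1 ∧ (P.pairingIn ℤ j i = 2 ∨ P.pairingIn ℤ j i = 3)) := by
      simp only [Set.mem_insert_iff, Prod.mk.injEq, Set.mem_singleton_iff] at hset
      omega
    rcases hcases with h1 | ⟨h1, h23⟩
    · have : k = P.reflectionPerm j i := by
        apply P.coroot.injective
        rw [hk, hrefl, h1, one_smul]
      rw [← this, hlk, this, hm]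
      exact hmi
    -- Here α_k is, up to sign, the reflection of α_j in α_i. Its multiplicity is therefore that of
    -- α_j, which is positive, and this is what lets `hA` be applied again from k.
    · have hmk : m k = m j := by
        have : k = opp P (P.reflectionPerm i j) := by
          apply P.coroot.injective
          rw [coroot_opp, P.coroot_reflectionPerm, P.coreflection_apply, hk]
          have : P.root' i (P.coroot j) = 1 := by
            rw [P.root'_coroot_eq_pairing, ← P.algebraMap_pairingIn ℤ, h1]
            simp
          rw [this, one_smul]
          abel
        rw [this, opp, hm, hm]
      have hlk0 : 0 < l k := by rw [hlk, hmk]; exact_mod_cast hj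
      rcases h23 with h2 | h3
      · have := hA k (P.reflectionPerm j i) (by rw [hrefl, h2, hk]; abel) hlk0
        rw [this, hm]
        exact hmi
      · have hpk : P.pairingIn ℤ j k = 1 := by
          have h6 : (P.pairingIn ℤ j k : ℝ) = 1 := by
            rw [← eq_intCast (algebraMap ℤ ℝ), P.algebraMap_pairingIn, ← P.root_coroot_eq_pairing,
              hk, map_sub, P.root_coroot_two, P.root_coroot_eq_pairing,
              ← P.algebraMap_pairingIn ℤ, h3]
            norm_num
          exact_mod_cast h6
        have hlk2 := hA k (P.reflectionPerm j k) (by rw [hrefl, hpk, one_smul]) hlk0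
        rw [hm] at hlk2
        have := hA (P.reflectionPerm j k) (P.reflectionPerm j i)
          (by rw [hrefl, hrefl, h3, hpk, hk]; abel)
          (by rw [hlk2, hmk]; exact_mod_cast hj)
        rw [this, hm]
        exact hmi
  have hpair : ∀ i, P.toLinearMap (P.root j) (P.coroot (P.reflectionPerm j i)) =
      -P.toLinearMap (P.root j) (P.coroot i) := fun i => by
    rw [pair_coroot_reflectionPerm, P.reflection_apply_self, map_neg, LinearMap.neg_apply]
  have hcast : ∀ i, P.toLinearMap (P.root j) (P.coroot i) = P.pairingIn ℤ j i := fun i =>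
    (P.algebraMap_pairingIn ℤ j i).symm
  -- Reindexing by s_j changes the sign of the pairings; averaging both expressions leaves only
  -- terms that `key` makes nonpositive, against `hpos`.
  have hS : P.toLinearMap (P.root j) (wt P l) =
      (1 / 4 : ℝ) * ∑ i, ((l i : ℝ) - l (P.reflectionPerm j i)) *
        P.toLinearMap (P.root j) (P.coroot i) := by
    have h1 : P.toLinearMap (P.root j) (wt P l) =
        (1 / 2 : ℝ) * ∑ i, (l i : ℝ) * P.toLinearMap (P.root j) (P.coroot i) := by
      simp [wt, map_sum]
    have h2 : ∑ i, (l i : ℝ) * P.toLinearMap (P.root j) (P.coroot i) =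
        -∑ i, (l (P.reflectionPerm j i) : ℝ) * P.toLinearMap (P.root j) (P.coroot i) := by
      rw [← Equiv.sum_comp (P.reflectionPerm j), ← Finset.sum_neg_distrib]
      refine Finset.sum_congr rfl fun i _ => ?_
      rw [hpair]
      ring
    simp only [sub_mul, Finset.sum_sub_distrib]
    rw [h1]
    linarith
  have hle : ∑ i, ((l i : ℝ) - l (P.reflectionPerm j i)) *
      P.toLinearMap (P.root j) (P.coroot i) ≤ 0 := by
    refine Finset.sum_nonpos fun i _ => ?_
    rw [hcast]
    rcases lt_trichotomy (P.pairingIn ℤ j i) 0 with h | h | h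
    · have h1 : 0 < P.pairingIn ℤ j (P.reflectionPerm j i) := by
        have := hpair i
        rw [hcast, hcast] at this
        have h2 : P.pairingIn ℤ j (P.reflectionPerm j i) = -P.pairingIn ℤ j i := by
          exact_mod_cast this
        omega
      have h2 := key _ h1
      rw [P.reflectionPerm_self] at h2
      refine mul_nonpos_of_nonneg_of_nonpos ?_ ?_
      · rw [sub_nonneg]
        exact_mod_cast h2
      · exact_mod_cast h.le
    · rw [h]
      simp
    · refine mul_nonpos_of_nonpos_of_nonneg ?_ ?_
      · rw [sub_nonpos]
        exact_mod_cast key i h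
      · exact_mod_cast h.le
  rw [hS] at hpos
  linarith

end Saturation

end Polytope

end BakerAkhiezer

end

noncomputable section

namespace BakerAkhiezer

open scoped Classical Topology
open Filter

/-! ### Lattice points of the polytope are weights of balanced coefficients -/

section LatticePoints

variable {ι M N : Type*} [AddCommGroup M] [Module ℝ M] [AddCommGroup N] [Module ℝ N]
variable {P : RootPairing ι ℝ M N}

lemma Module.exists_dual_forall_mem_apply_eq_ite {κ V : Type*} [AddCommGroup V] [Module ℝ V]
    {v : κ → V} {s : Set κ} (hs : LinearIndepOn ℝ v s) {k : κ} (hk : k ∈ s) :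
    ∃ f : V →ₗ[ℝ] ℝ, ∀ i ∈ s, f (v i) = if i = k then 1 else 0 := by
  let c := Module.Basis.extend (LinearIndepOn.id_image hs)
  let f : V →ₗ[ℝ] ℝ := c.constr ℝ fun w => if (w : V) = v k then 1 else 0
  refine ⟨f, fun i hi => ?_⟩
  have h1 : v i ∈ (LinearIndepOn.id_image hs).extend (Set.subset_univ _) :=
    (LinearIndepOn.id_image hs).subset_extend _ ⟨i, hi, rfl⟩
  have h2 := c.constr_basis ℝ (fun w => if (w : V) = v k then (1 : ℝ) else 0) ⟨v i, h1⟩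
  rw [Module.Basis.extend_apply_self] at h2
  refine h2.trans ?_
  exact if_congr (hs.injOn.eq_iff hi hk) rfl rfl

variable (P) in
/-- The root subsystem on an invariant set of indices. -/
def subPairing (p : ι → Prop) (hp : ∀ i j, p (P.reflectionPerm i j) ↔ p j) :
    RootPairing {i // p i} ℝ M N where
  toLinearMap := P.toLinearMap
  root := (Function.Embedding.subtype p).trans P.root
  coroot := (Function.Embedding.subtype p).trans P.coroot
  root_coroot_two i := P.root_coroot_two i
  reflectionPerm i := Equiv.Perm.subtypePerm (P.reflectionPerm i : Equiv.Perm ι) fun j => hp i j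
  reflectionPerm_root i j := P.reflectionPerm_root i j
  reflectionPerm_coroot i j := P.reflectionPerm_coroot i j

lemma subPairing_isCrystallographic [P.IsCrystallographic] (p : ι → Prop)
    (hp : ∀ i j, p (P.reflectionPerm i j) ↔ p j) : (subPairing P p hp).IsCrystallographic where
  exists_value i j := ⟨P.pairingIn ℤ i j, P.algebraMap_pairingIn ℤ i j⟩

variable [Fintype ι]

/-- Simple coroots of the subsystem of nonzero multiplicities, for the chamber of `ξ`. -/
lemma exists_simple_coroots [P.IsCrystallographic] {m : ι → ℕ}
    (hm : ∀ i j, m (P.reflectionPerm i j) = m j) {ξ : M} (hξ : IsRegular P ξ) :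
    ∃ B : Finset ι, (∀ i ∈ B, 0 < m i ∧ 0 < P.toLinearMap ξ (P.coroot i)) ∧
      LinearIndepOn ℝ P.coroot (B : Set ι) ∧
      ∀ i, 0 < m i → 0 < P.toLinearMap ξ (P.coroot i) →
        P.coroot i ∈ AddSubmonoid.closure (P.coroot '' B) := by
  -- Only coroots of nonzero multiplicity may be subtracted from a balanced weight, so the base is
  -- taken in their subsystem.
  let Q := subPairing P (fun i => 0 < m i) fun i j => by rw [hm]
  have : Q.IsCrystallographic := subPairing_isCrystallographic _ _
  let f : Module.Dual ℝ N := P.toLinearMap ξ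
  let B' : Set {i // 0 < m i} := IsAddIndecomposable.baseOf Q.coroot (f : N →+ ℝ)
  have hli : LinearIndepOn ℝ Q.coroot B' :=
    Q.flip.linearIndepOn_root_baseOf' (S := ℝ) f fun i => hξ i
  have hcl := AddSubmonoid.closure_image_isAddIndecomposable_baseOf Q.coroot (f : N →+ ℝ)
  refine ⟨(Set.toFinite (Subtype.val '' B')).toFinset, ?_, ?_, ?_⟩
  · intro i hi
    obtain ⟨j, hj, rfl⟩ := (Set.Finite.mem_toFinset _).1 hi
    exact ⟨j.2, hj.1⟩
  · rw [Set.Finite.coe_toFinset]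
    exact LinearIndepOn.image_of_comp _ _ hli
  · intro i hi hξi
    rw [Set.Finite.coe_toFinset, ← Set.image_comp]
    have h1 : P.coroot i ∈ AddSubmonoid.closure (Q.coroot '' B') := by
      rw [hcl]
      exact AddSubmonoid.subset_closure ⟨⟨i, hi⟩, hξi, rfl⟩
    exact h1

omit [Fintype ι] in
lemma mem_closure_image_iff {B : Finset ι} {ν : N} :
    ν ∈ AddSubmonoid.closure (P.coroot '' B) ↔ ∃ n : ι → ℕ, ν = ∑ i ∈ B, n i • P.coroot i := by
  constructor
  · intro h
    induction h using AddSubmonoid.closure_induction with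
    | zero => exact ⟨0, by simp⟩
    | mem x hx =>
      obtain ⟨j, hj, rfl⟩ := hx
      refine ⟨Pi.single j 1, ?_⟩
      rw [Finset.sum_eq_single_of_mem j hj fun k _ hk => by simp [hk]]
      simp
    | add x y _ _ hx hy =>
      obtain ⟨a, ha⟩ := hx
      obtain ⟨c, hc⟩ := hy
      exact ⟨a + c, by simp [ha, hc, add_smul, Finset.sum_add_distrib]⟩
  · rintro ⟨n, rfl⟩
    exact AddSubmonoid.sum_mem _ fun i hi =>
      AddSubmonoid.nsmul_mem _ (AddSubmonoid.subset_closure (Set.mem_image_of_mem _ hi)) _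

/-- By Weyl invariance the canonical form against α^∨ is proportional to the pairing with α;
positivity of the form thereby yields positive pairings. -/
lemma corootForm_coroot_left (i : ι) (ν : N) :
    P.CorootForm (P.coroot i) ν =
      P.CorootForm (P.coroot i) (P.coroot i) / 2 * P.toLinearMap (P.root i) ν := by
  have h := congrArg (fun z => P.toLinearMap z ν) (P.corootForm_self_smul_root i)
  simp only [map_smul, LinearMap.smul_apply, smul_eq_mul, map_nsmul, nsmul_eq_mul,
    Nat.cast_ofNat] at h
  have h2 : P.toLinearMap (P.CoPolarization (P.coroot i)) ν = P.CorootForm (P.coroot i) ν := by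
    rw [P.toLinearMap_apply_CoPolarization]
  rw [h2] at h
  linarith

lemma corootForm_coroot_pos (i : ι) : 0 < P.CorootForm (P.coroot i) (P.coroot i) :=
  P.flip.rootForm_pos_of_ne_zero (Submodule.subset_span ⟨i, rfl⟩) (P.ne_zero' i)

variable [P.IsRootSystem] [P.IsCrystallographic] [P.IsReduced]

omit [P.IsCrystallographic] [P.IsReduced] in
lemma corootForm_pos {ν : N} (h : ν ≠ 0) : 0 < P.CorootForm ν ν :=
  P.flip.rootForm_pos_of_ne_zero (by simp) h

omit [P.IsRootSystem] [P.IsCrystallographic] [P.IsReduced] in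
/-- A chamber whose closure contains a given vector. -/
lemma exists_regular_of_coweight (ν : N) :
    ∃ ξ : M, IsRegular P ξ ∧
      ∀ i, 0 < P.toLinearMap ξ (P.coroot i) → 0 ≤ P.toLinearMap (P.root i) ν := by
  -- The vector dual to ν under the canonical form takes on α^∨ the sign of (α, ν); a small generic
  -- perturbation makes it regular and keeps its strict signs.
  let ξ₀ := P.CoPolarization ν
  have h0 : ∀ i, P.toLinearMap ξ₀ (P.coroot i) =
      P.CorootForm (P.coroot i) (P.coroot i) / 2 * P.toLinearMap (P.root i) ν := fun i => by
    rw [← corootForm_coroot_left]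
    have : P.toLinearMap ξ₀ (P.coroot i) = P.CorootForm ν (P.coroot i) := by
      rw [P.toLinearMap_apply_CoPolarization]
    rw [this]
    exact P.flip.rootForm_symmetric.eq _ _
  obtain ⟨v, hv⟩ := exists_generic_direction P (Set.finite_range P.coroot)
    (by rintro _ ⟨i, rfl⟩; exact P.ne_zero' i) ξ₀
  have hev : ∀ᶠ t in 𝓝[≠] (0 : ℝ), ∀ i, P.toLinearMap ξ₀ (P.coroot i) < 0 →
      P.toLinearMap (ξ₀ + t • v) (P.coroot i) < 0 := by
    rw [eventually_all]
    intro i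
    by_cases hi : P.toLinearMap ξ₀ (P.coroot i) < 0
    · have hc := (pair_continuous_line P ξ₀ v (P.coroot i)).continuousAt (x := 0)
      have := hc.eventually_lt continuousAt_const (by simpa using hi)
      filter_upwards [this.filter_mono nhdsWithin_le_nhds] with t ht _
      exact ht
    · exact Eventually.of_forall fun t h => absurd h hi
  obtain ⟨t, h1, h2⟩ := (hv.and hev).exists
  refine ⟨ξ₀ + t • v, fun i => h1 _ ⟨i, rfl⟩, fun i hi => ?_⟩
  by_contra hc
  push Not at hc
  have := h2 i (by
    rw [h0]
    exact mul_neg_of_pos_of_neg (by linarith [corootForm_coroot_pos (P := P) i]) hc)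
  linarith

/-- A lattice point of the polytope is an integral combination of the coroots. -/
theorem exists_balanced_of_lattice {m : ι → ℕ} (hm : ∀ i j, m (P.reflectionPerm i j) = m j)
    {η : M} (hη : IsRegular P η) {ν : N} (hν : ∀ ξ, P.toLinearMap ξ ν ≤ supportFun P m ξ)
    (hlat : ν - rhoOf P m η ∈ corootLattice P m) :
    ∃ l, IsBalanced P m l ∧ wt P l = ν := by
  -- A chamber in which ν is dominant.
  obtain ⟨ξ, hξ, hdom⟩ := exists_regular_of_coweight (P := P) ν
  obtain ⟨B, hB, hli, hcl⟩ := exists_simple_coroots hm hξ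
  have hmo : ∀ i, m (opp P i) = m i := fun i => hm i i
  -- the difference is an integral combination of simple coroots
  have hlat2 : rhoOf P m ξ - ν ∈ corootLattice P m := by
    have h1 := rhoOf_sub_rhoOf_mem m hm hξ hη
    have h2 := AddSubgroup.sub_mem _ h1 hlat
    rwa [sub_sub_sub_cancel_right] at h2
  have hint : ∀ μ ∈ corootLattice P m, ∃ c : ι → ℤ, μ = ∑ i ∈ B, c i • P.coroot i := by
    intro μ hμ
    induction hμ using AddSubgroup.closure_induction with
    | zero => exact ⟨0, by simp⟩
    | mem x hx =>
      obtain ⟨i, hi, rfl⟩ := hx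
      rcases lt_or_gt_of_ne (hξ i) with h | h
      · obtain ⟨n, hn⟩ := mem_closure_image_iff.1 (hcl (opp P i) (by rw [hmo]; exact hi)
          (by simpa using h))
        refine ⟨fun i => -(n i : ℤ), ?_⟩
        simp only [neg_smul, natCast_zsmul, Finset.sum_neg_distrib]
        rw [← hn, coroot_opp, neg_neg]
      · obtain ⟨n, hn⟩ := mem_closure_image_iff.1 (hcl i hi h)
        refine ⟨fun i => (n i : ℤ), ?_⟩
        simp only [natCast_zsmul]
        exact hn
    | add x y _ _ hx hy =>
      obtain ⟨a, ha⟩ := hx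
      obtain ⟨c, hc⟩ := hy
      exact ⟨a + c, by simp [ha, hc, add_smul, Finset.sum_add_distrib]⟩
    | neg x _ hx =>
      obtain ⟨a, ha⟩ := hx
      exact ⟨-a, by simp [ha]⟩
  obtain ⟨c, hc⟩ := hint _ hlat2
  have hval : ∀ k ∈ B, ∃ ζ : M, ∀ n : ι → ℤ,
      P.toLinearMap ζ (∑ i ∈ B, n i • P.coroot i) = n k := by
    intro k hk
    obtain ⟨f, hf⟩ := Module.exists_dual_forall_mem_apply_eq_ite hli hk
    obtain ⟨ζ, hζ⟩ := exists_pair_eq P f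
    refine ⟨ζ, fun n => ?_⟩
    rw [hζ, map_sum, Finset.sum_eq_single_of_mem k hk fun i hi hik => by
      rw [map_zsmul, hf i hi, if_neg hik, smul_zero], map_zsmul, hf k hk, if_pos rfl]
    simp
  have hnonneg : ∀ k ∈ B, 0 ≤ c k := by
    intro k hk
    obtain ⟨ζ, hζ⟩ := hval k hk
    -- ζ is dual to the simple coroot α_k^∨, hence nonnegative on the ξ-positive coroots of nonzero
    -- multiplicity, and ρ_ξ maximizes it on the polytope. So `c k` is the gap between this maximum
    -- and ζ(ν).
    have h1 : P.toLinearMap ζ (rhoOf P m ξ) = supportFun P m ζ := by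
      rw [supportFun_eq_sum_pos hm hξ, rhoOf]
      simp only [map_smul, map_sum, smul_eq_mul]
      congr 1
      refine Finset.sum_congr rfl fun i hi => ?_
      rcases Nat.eq_zero_or_pos (m i) with h0 | h0
      · simp [h0]
      obtain ⟨n, hn⟩ := mem_closure_image_iff.1 (hcl i h0 (Finset.mem_filter.1 hi).2)
      have := hζ fun i => (n i : ℤ)
      simp only [natCast_zsmul, ← hn] at this
      rw [this, abs_of_nonneg (by simp)]
    have h2 := hζ c
    rw [← hc, map_sub, h1] at h2
    have h3 := hν ζ
    have : (0 : ℝ) ≤ c k := by rw [← h2]; linarith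
    exact_mod_cast this
  -- descent from `rhoOf P m ξ`
  have key : ∀ (k : ℕ) (n : ι → ℕ) (l : ι → ℤ), ∑ i ∈ B, n i = k → IsBalanced P m l →
      wt P l = ν + ∑ i ∈ B, n i • P.coroot i → ∃ l, IsBalanced P m l ∧ wt P l = ν := by
    intro k
    induction k with
    | zero =>
      intro n l hn hl hw
      refine ⟨l, hl, ?_⟩
      rw [hw, Finset.sum_eq_zero fun i hi => by
        rw [Finset.sum_eq_zero_iff.1 hn i hi, zero_smul], add_zero]
    | succ k ih =>
      intro n l hn hl hw
      set δ := ∑ i ∈ B, n i • P.coroot i with hδ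
      have hδ0 : δ ≠ 0 := by
        intro h0
        have h1 : P.toLinearMap ξ δ = 0 := by rw [h0, map_zero]
        rw [hδ, map_sum, Finset.sum_eq_zero_iff_of_nonneg] at h1
        · have : ∑ i ∈ B, n i = 0 := Finset.sum_eq_zero fun i hi => by
            have := h1 i hi
            rw [map_nsmul, smul_eq_zero] at this
            exact this.resolve_right (hB i hi).2.ne'
          omega
        · intro i hi
          rw [map_nsmul]
          exact nsmul_nonneg (hB i hi).2.le _
      have hpos := corootForm_pos (P := P) hδ0
      -- If every simple root occurring in δ paired nonpositively with δ, then (δ, δ) ≤ 0. As ν is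
      -- dominant, the root found here also pairs positively with ν + δ, and saturation applies.
      have hex : ∃ i ∈ B, 0 < n i ∧ 0 < P.toLinearMap (P.root i) δ := by
        by_contra hcon
        push Not at hcon
        refine absurd hpos (not_lt.2 ?_)
        have h1 : P.CorootForm δ δ = ∑ i ∈ B, P.CorootForm (n i • P.coroot i) δ := by
          rw [← LinearMap.sum_apply, ← map_sum]
        rw [h1]
        refine Finset.sum_nonpos fun i hi => ?_
        rw [map_nsmul, LinearMap.smul_apply]
        rcases Nat.eq_zero_or_pos (n i) with h0 | h0
        · simp [h0]
        · rw [corootForm_coroot_left]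
          refine smul_nonpos_of_nonneg_of_nonpos (Nat.zero_le _) ?_
          exact mul_nonpos_of_nonneg_of_nonpos
            (by linarith [corootForm_coroot_pos (P := P) i]) (hcon i hi h0)
      obtain ⟨j, hj, hnj, hpj⟩ := hex
      obtain ⟨l', hl', hw'⟩ := exists_balanced_sub_coroot hm hl (hB j hj).1 (by
        rw [hw, map_add]
        linarith [hdom j (hB j hj).2])
      obtain ⟨p, hp⟩ : ∃ p, n j = p + 1 := ⟨n j - 1, by omega⟩
      have hupd : ∀ i ∈ B.erase j, Function.update n j p i = n i := fun i hi =>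
        Function.update_of_ne (Finset.ne_of_mem_erase hi) _ _
      refine ih (Function.update n j p) l' ?_ hl' ?_
      · rw [← Finset.add_sum_erase B _ hj, Function.update_self, Finset.sum_congr rfl hupd]
        rw [← Finset.add_sum_erase B _ hj] at hn
        change p + ∑ i ∈ B.erase j, n i = k
        omega
      · have h1 := Finset.add_sum_erase B (fun i => n i • P.coroot i) hj
        have h2 := Finset.add_sum_erase B (fun i => Function.update n j p i • P.coroot i) hj
        have h3 : ∑ i ∈ B.erase j, Function.update n j p i • P.coroot i =
            ∑ i ∈ B.erase j, n i • P.coroot i :=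
          Finset.sum_congr rfl fun i hi => by rw [hupd i hi]
        rw [hw', hw, hδ, ← h1, ← h2, Function.update_self, hp, add_smul, one_smul, h3]
        abel
  -- the top balanced function
  let l : ι → ℤ := fun i => if 0 < P.toLinearMap ξ (P.coroot i) then m i else 0
  have hl : IsBalanced P m l := by
    intro i
    have hi := hξ i
    simp only [l, coroot_opp, map_neg, Left.neg_pos_iff]
    rcases lt_or_gt_of_ne hi with h | h
    · simp [h, h.not_gt, hmo]
    · simp [h, h.not_gt]
  refine key _ (fun i => (c i).toNat) l rfl hl ?_
  have h1 : ∑ i ∈ B, (c i).toNat • P.coroot i = rhoOf P m ξ - ν := by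
    rw [hc]
    refine Finset.sum_congr rfl fun i hi => ?_
    rw [← natCast_zsmul, Int.toNat_of_nonneg (hnonneg i hi)]
  rw [h1, wt_eq_of_regular hl hξ, rhoOf, add_sub_cancel, Finset.smul_sum]
  refine Finset.sum_congr rfl fun i hi => ?_
  rw [smul_smul]
  congr 1
  simp only [l, (Finset.mem_filter.1 hi).2, if_true]
  push_cast
  ring

end LatticePoints

end BakerAkhiezer

end

noncomputable section

namespace BakerAkhiezer

open scoped Classical Topology
open Filter

/-! ### Primitivity of coroots -/

section Primitivity

variable {ι M N : Type*} [AddCommGroup M] [Module ℝ M] [AddCommGroup N] [Module ℝ N]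
variable {P : RootPairing ι ℝ M N} [Fintype ι] [P.IsRootSystem] [P.IsCrystallographic]
  [P.IsReduced]

omit [Fintype ι] [P.IsCrystallographic] [P.IsReduced] in
-- The fundamental weight: a coordinate functional of the basis of simple coroots, integral because
-- every coroot is an integral combination of them.
lemma exists_weight_of_mem_support (b : P.Base) {i : ι} (hi : i ∈ b.support) :
    ∃ ζ : M, IsWeight P ζ ∧ P.toLinearMap ζ (P.coroot i) = 1 := by
  obtain ⟨ζ, hζ⟩ := exists_pair_eq P (b.toCoweightBasis.coord ⟨i, hi⟩)
  have h : ∀ j, j ∈ b.support → P.toLinearMap ζ (P.coroot j) = if j = i then 1 else 0 := by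
    intro j hj
    rw [hζ, Module.Basis.coord_apply, b.toCoweightBasis_repr_coroot ⟨j, hj⟩,
      Finsupp.single_apply]
    exact if_congr Subtype.mk_eq_mk rfl rfl
  have hcl : ∀ ν ∈ AddSubmonoid.closure (P.coroot '' b.support),
      ∃ n : ℤ, P.toLinearMap ζ ν = n := by
    intro ν hν
    induction hν using AddSubmonoid.closure_induction with
    | zero => exact ⟨0, by simp⟩
    | mem x hx =>
      obtain ⟨j, hj, rfl⟩ := hx
      rw [h j hj]
      exact ⟨if j = i then 1 else 0, by split_ifs <;> simp⟩
    | add x y _ _ hx hy =>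
      obtain ⟨a, ha⟩ := hx
      obtain ⟨c, hc⟩ := hy
      exact ⟨a + c, by rw [map_add, ha, hc]; simp⟩
  refine ⟨ζ, fun j => ?_, by simpa using h i hi⟩
  rcases b.coroot_mem_or_neg_mem j with h1 | h1
  · exact hcl _ h1
  · obtain ⟨n, hn⟩ := hcl _ h1
    refine ⟨-n, ?_⟩
    rw [map_neg] at hn
    push_cast
    linarith

/-- Every coroot is primitive: some weight takes the value `1` on it. -/
lemma exists_weight_eq_one (b : P.Base) (i : ι) :
    ∃ ζ : M, IsWeight P ζ ∧ P.toLinearMap ζ (P.coroot i) = 1 := by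
  -- Every root is conjugate to a simple one, and the property is carried along by reflections.
  refine b.induction_reflect i (p := fun i => ∃ ζ : M, IsWeight P ζ ∧
    P.toLinearMap ζ (P.coroot i) = 1) ?_ (fun i hi => exists_weight_of_mem_support b hi) ?_
  · rintro i ⟨ζ, h1, h2⟩
    refine ⟨-ζ, fun j => ?_, ?_⟩
    · obtain ⟨n, hn⟩ := h1 j
      exact ⟨-n, by simp [hn]⟩
    · change P.toLinearMap (-ζ) (P.coroot (opp P i)) = 1
      simp [h2]
  · rintro i j ⟨ζ, h1, h2⟩ -
    refine ⟨P.reflection j ζ, fun k => ?_, ?_⟩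
    · rw [← pair_coroot_reflectionPerm]
      exact h1 _
    · rw [pair_coroot_reflectionPerm, P.reflection_same, h2]

/-- Consequently lattice points on a common line in direction α^∨ differ by integral multiples of
α^∨: real strings are integral strings. -/
lemma exists_int_of_smul_coroot_mem (b : P.Base) {m : ι → ℕ} {i : ι} {c : ℝ}
    (h : c • P.coroot i ∈ corootLattice P m) : ∃ n : ℤ, c = n := by
  obtain ⟨ζ, h1, h2⟩ := exists_weight_eq_one b i
  have key : ∀ ν ∈ corootLattice P m, ∃ n : ℤ, P.toLinearMap ζ ν = n := by
    intro ν hν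
    induction hν using AddSubgroup.closure_induction with
    | zero => exact ⟨0, by simp⟩
    | mem x hx =>
      obtain ⟨j, hj, rfl⟩ := hx
      exact h1 j
    | add x y _ _ hx hy =>
      obtain ⟨a, ha⟩ := hx
      obtain ⟨c, hc⟩ := hy
      exact ⟨a + c, by rw [map_add, ha, hc]; simp⟩
    | neg x _ hx =>
      obtain ⟨a, ha⟩ := hx
      exact ⟨-a, by rw [map_neg, ha]; simp⟩
  obtain ⟨n, hn⟩ := key _ h
  refine ⟨n, ?_⟩
  rw [← hn, map_smul, h2, smul_eq_mul, mul_one]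

end Primitivity

/-! ### Maximizers of functionals on sets with long strings -/

section Convexity

variable {ι M N : Type*} [AddCommGroup M] [Module ℝ M] [AddCommGroup N] [Module ℝ N]
variable {P : RootPairing ι ℝ M N} [Fintype ι]

lemma rhoOf_sub_rhoOf {m : ι → ℕ} (hm : ∀ i j, m (P.reflectionPerm i j) = m j) {ξ η : M}
    (hξ : IsRegular P ξ) (hη : IsRegular P η) :
    rhoOf P m ξ - rhoOf P m η =
      ∑ i with 0 < P.toLinearMap ξ (P.coroot i) ∧ P.toLinearMap η (P.coroot i) < 0,
        (m i : ℝ) • P.coroot i := by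
  have h1 : ∀ ζ : M, rhoOf P m ζ = (1 / 2 : ℝ) • ∑ i,
      if 0 < P.toLinearMap ζ (P.coroot i) then (m i : ℝ) • P.coroot i else 0 := fun ζ => by
    rw [rhoOf, Finset.sum_filter]
  rw [h1, h1, ← smul_sub, ← Finset.sum_sub_distrib, Finset.sum_filter]
  have h2 : ∀ i, ((if 0 < P.toLinearMap ξ (P.coroot i) then (m i : ℝ) • P.coroot i else 0) -
      if 0 < P.toLinearMap η (P.coroot i) then (m i : ℝ) • P.coroot i else 0) =
      (if 0 < P.toLinearMap ξ (P.coroot i) ∧ P.toLinearMap η (P.coroot i) < 0 then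
        (m i : ℝ) • P.coroot i else 0) +
      if 0 < P.toLinearMap ξ (P.coroot (opp P i)) ∧ P.toLinearMap η (P.coroot (opp P i)) < 0 then
        (m (opp P i) : ℝ) • P.coroot (opp P i) else 0 := by
    intro i
    rw [coroot_opp, show m (opp P i) = m i from hm i i]
    simp only [map_neg, Left.neg_pos_iff, Left.neg_neg_iff]
    rcases lt_or_gt_of_ne (hξ i) with h | h <;> rcases lt_or_gt_of_ne (hη i) with h' | h' <;>
      simp [h, h', h.not_gt, h'.not_gt]
  have h3 := Equiv.sum_comp (oppPerm P) fun i => if 0 < P.toLinearMap ξ (P.coroot i) ∧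
    P.toLinearMap η (P.coroot i) < 0 then (m i : ℝ) • P.coroot i else 0
  change ∑ i, (if 0 < P.toLinearMap ξ (P.coroot (opp P i)) ∧
    P.toLinearMap η (P.coroot (opp P i)) < 0 then
    (m (opp P i) : ℝ) • P.coroot (opp P i) else 0) = _ at h3
  rw [Finset.sum_congr rfl fun i _ => h2 i, Finset.sum_add_distrib, h3, ← two_smul ℝ, smul_smul]
  norm_num

/-- If every `α^∨`-string through a point of a finite set `E` has length at least `m_α`, then the
difference between the maximizer of a generic functional on `E` and the corresponding `ρ` is
monotone. -/
theorem pair_sub_rhoOf_le {m : ι → ℕ} (hm : ∀ i j, m (P.reflectionPerm i j) = m j)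
    {E : Finset N}
    (hE : ∀ v ∈ E, ∀ i, 0 < m i → ∃ a ∈ E, ∃ k : ℝ, m i ≤ k ∧ a + k • P.coroot i ∈ E ∧
      ∃ c : ℝ, a = v + c • P.coroot i)
    {ξ η : M} (hξ : IsRegular P ξ) (hη : IsRegular P η)
    (hgen : ∀ i j, P.toLinearMap ξ (P.coroot i) * P.toLinearMap η (P.coroot j) =
      P.toLinearMap ξ (P.coroot j) * P.toLinearMap η (P.coroot i) → j = i ∨ j = opp P i)
    {v w : N} (hv : v ∈ E) (hvmax : ∀ u ∈ E, P.toLinearMap ξ u ≤ P.toLinearMap ξ v)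
    (hwmax : ∀ u ∈ E, P.toLinearMap η u ≤ P.toLinearMap η w) :
    P.toLinearMap η (v - rhoOf P m ξ) ≤ P.toLinearMap η (w - rhoOf P m η) := by
  let x : ι → ℝ := fun i => P.toLinearMap ξ (P.coroot i)
  let y : ι → ℝ := fun i => P.toLinearMap η (P.coroot i)
  -- One coroot from each opposite pair whose hyperplane is crossed by ξ + tη for t > 0, the
  -- crossing time being `s i`. By `hgen` the walls are crossed one at a time.
  let A : Finset ι := Finset.univ.filter fun i => 0 < x i ∧ y i < 0
  let s : ι → ℝ := fun i => -x i / y i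
  have hspos : ∀ i ∈ A, 0 < s i := fun i hi => by
    obtain ⟨h1, h2⟩ := (Finset.mem_filter.1 hi).2
    exact div_pos_of_neg_of_neg (by linarith) h2
  have hsx : ∀ i ∈ A, x i + s i * y i = 0 := fun i hi => by
    have := (Finset.mem_filter.1 hi).2.2.ne
    simp only [s]
    field_simp
    ring
  have hinj : ∀ i ∈ A, ∀ j ∈ A, s i = s j → j = i := by
    intro i hi j hj h
    have h1 := hsx i hi
    have h2 := hsx j hj
    rw [← h] at h2
    rcases hgen i j (by
      change x i * y j = x j * y i
      linear_combination y j * h1 - y i * h2) with h3 | h3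
    · exact h3
    · have h4 := (Finset.mem_filter.1 hj).2.1
      have h5 := (Finset.mem_filter.1 hi).2.1
      rw [h3] at h4
      simp only [x, coroot_opp, map_neg] at h4 h5
      linarith
  -- The slopes of the convex function t ↦ max over E of ξ + tη do not decrease.
  have slope : ∀ {r t : ℝ} {a c : N}, r < t → a ∈ E → c ∈ E →
      (∀ u ∈ E, P.toLinearMap (ξ + r • η) u ≤ P.toLinearMap (ξ + r • η) a) →
      (∀ u ∈ E, P.toLinearMap (ξ + t • η) u ≤ P.toLinearMap (ξ + t • η) c) →
      P.toLinearMap η a ≤ P.toLinearMap η c := by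
    intro r t a c hrt ha hc h1 h2
    have h3 := h1 c hc
    have h4 := h2 a ha
    simp only [map_add, map_smul, LinearMap.add_apply, LinearMap.smul_apply, smul_eq_mul] at h3 h4
    nlinarith
  -- Induction on the number of crossings before t: each wall raises the slope by at least `m i *
  -- (-y i)`.
  have key : ∀ (n : ℕ) (t : ℝ), 0 < t → (A.filter fun i => s i < t).card = n → ∀ c ∈ E,
      (∀ u ∈ E, P.toLinearMap (ξ + t • η) u ≤ P.toLinearMap (ξ + t • η) c) →
      P.toLinearMap η v + ∑ i ∈ A with s i < t, m i * (-y i) ≤ P.toLinearMap η c := by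
    intro n
    induction n with
    | zero =>
      intro t ht hn c hc hcmax
      rw [Finset.card_eq_zero.1 hn, Finset.sum_empty, add_zero]
      exact slope ht hv hc (by simpa using hvmax) hcmax
    | succ n ih =>
      intro t ht hn c hc hcmax
      obtain ⟨j, hj, hjmax⟩ := Finset.exists_max_image (A.filter fun i => s i < t) s
        (Finset.card_pos.1 (by omega))
      obtain ⟨hjA, hjt⟩ := Finset.mem_filter.1 hj
      have hsplit : (A.filter fun i => s i < t) = insert j (A.filter fun i => s i < s j) := by
        ext i
        simp only [Finset.mem_filter, Finset.mem_insert]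
        constructor
        · rintro ⟨h1, h2⟩
          rcases (hjmax i (Finset.mem_filter.2 ⟨h1, h2⟩)).lt_or_eq with h3 | h3
          · exact Or.inr ⟨h1, h3⟩
          · exact Or.inl (hinj j hjA i h1 h3.symm)
        · rintro (rfl | ⟨h1, h2⟩)
          · exact ⟨hjA, hjt⟩
          · exact ⟨h1, h2.trans hjt⟩
      have hnot : j ∉ A.filter fun i => s i < s j := by simp
      have hcard : (A.filter fun i => s i < s j).card = n := by
        rw [hsplit, Finset.card_insert_of_notMem hnot] at hn
        omega
      obtain ⟨u, hu, humax⟩ := Finset.exists_max_image E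
        (fun u => P.toLinearMap (ξ + s j • η) u) ⟨v, hv⟩
      rw [hsplit, Finset.sum_insert hnot]
      have hyj := (Finset.mem_filter.1 hjA).2.2
      have hzero : P.toLinearMap (ξ + s j • η) (P.coroot j) = 0 := by
        simpa [x, y] using hsx j hjA
      rcases Nat.eq_zero_or_pos (m j) with h0 | h0
      · have h1 := ih (s j) (hspos j hjA) hcard u hu humax
        have h2 := slope hjt hu hc humax hcmax
        rw [h0]
        push_cast
        linarith
      · obtain ⟨a, ha, k, hk, hb, d, hd⟩ := hE u hu j h0
        -- On its wall the functional is constant along the string of α_j^∨, so both ends of a long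
        -- string through u are maximizers. The end a + kα_j^∨ bounds the slope before the crossing
        -- from above, a bounds the slope after it from below.
        have hamax : ∀ u' ∈ E, P.toLinearMap (ξ + s j • η) u' ≤
            P.toLinearMap (ξ + s j • η) a := by
          intro u' hu'
          rw [hd, map_add _ u, map_smul _ d, hzero, smul_zero, add_zero]
          exact humax u' hu'
        have hbmax : ∀ u' ∈ E, P.toLinearMap (ξ + s j • η) u' ≤
            P.toLinearMap (ξ + s j • η) (a + k • P.coroot j) := by
          intro u' hu'
          rw [map_add _ a, map_smul _ k, hzero, smul_zero, add_zero]
          exact hamax u' hu'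
        have h1 := ih (s j) (hspos j hjA) hcard _ hb hbmax
        have h2 := slope hjt ha hc hamax hcmax
        have h3 : P.toLinearMap η (a + k • P.coroot j) = P.toLinearMap η a + k * y j := by
          simp [y]
        have h4 : (k - m j) * y j ≤ 0 :=
          mul_nonpos_of_nonneg_of_nonpos (by linarith) hyj.le
        linarith
  -- Past all walls the accumulated gain is exactly η(ρ_η - ρ_ξ).
  obtain ⟨t, ht, hts⟩ : ∃ t : ℝ, 0 < t ∧ ∀ i ∈ A, s i < t := by
    refine ⟨1 + ∑ i ∈ A, s i, ?_, fun i hi => ?_⟩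
    · linarith [Finset.sum_nonneg fun i hi => (hspos i hi).le]
    · linarith [Finset.single_le_sum (fun i hi => (hspos i hi).le) hi]
  obtain ⟨c, hc, hcmax⟩ := Finset.exists_max_image E
    (fun u => P.toLinearMap (ξ + t • η) u) ⟨v, hv⟩
  have h1 := key _ t ht rfl c hc hcmax
  have h2 := hwmax c hc
  rw [Finset.filter_true_of_mem hts] at h1
  have h3 := congrArg (P.toLinearMap η) (rhoOf_sub_rhoOf hm hξ hη)
  rw [map_sub, map_sum] at h3
  have h4 : ∑ i ∈ A, P.toLinearMap η ((m i : ℝ) • P.coroot i) = -∑ i ∈ A, m i * (-y i) := by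
    rw [← Finset.sum_neg_distrib]
    exact Finset.sum_congr rfl fun i _ => by simp [y]
  have h5 := h3.trans h4
  rw [map_sub, map_sub]
  linarith

end Convexity

end BakerAkhiezer

end

noncomputable section

namespace BakerAkhiezer

open scoped Classical Topology
open Filter AddMonoidAlgebra

/-! ### Exponential polynomials over a lattice and division by binomials -/

section LatticeAlgebra

variable {ι M N : Type*} [AddCommGroup M] [Module ℝ M] [AddCommGroup N] [Module ℝ N]
variable {P : RootPairing ι ℝ M N} {L : ℂ}

/-- The exponential polynomials with exponents in a given lattice. -/
def latticeAlgebra (Λ : AddSubgroup N) : Subalgebra ℂ (AddMonoidAlgebra ℂ N) where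
  carrier := {F | ∀ ν, F.coeff ν ≠ 0 → ν ∈ Λ}
  mul_mem' := by
    intro F G hF hG ν hν
    rw [coeff_mul] at hν
    by_contra hc
    refine hν ?_
    refine Finset.sum_eq_zero fun a ha => Finset.sum_eq_zero fun b hb => ?_
    refine if_neg ?_
    rintro rfl
    exact hc (Λ.add_mem (hF a (Finsupp.mem_support_iff.1 ha)) (hG b (Finsupp.mem_support_iff.1 hb)))
  add_mem' := by
    intro F G hF hG ν hν
    rw [coeff_add, Finsupp.add_apply] at hν
    by_cases h : F.coeff ν = 0
    · exact hG ν fun h' => hν (by rw [h, h', add_zero])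
    · exact hF ν h
  algebraMap_mem' := by
    intro c ν hν
    have h1 : (algebraMap ℂ (AddMonoidAlgebra ℂ N)) c = single 0 c := rfl
    rw [h1, coeff_single] at hν
    have : ν = 0 := by
      by_contra h
      exact hν (Finsupp.single_eq_of_ne h)
    rw [this]
    exact Λ.zero_mem

omit [Module ℝ N] in
lemma single_mem_latticeAlgebra {Λ : AddSubgroup N} {ν : N} (h : ν ∈ Λ) (a : ℂ) :
    single ν a ∈ latticeAlgebra Λ := by
  intro μ hμ
  rw [coeff_single] at hμ
  have : μ = ν := by
    by_contra h'
    exact hμ (Finsupp.single_eq_of_ne h')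
  rwa [this]

omit [AddCommGroup N] [Module ℝ N] in
lemma eq_sum_single (F : AddMonoidAlgebra ℂ N) :
    F = ∑ ν ∈ F.coeff.support, single ν (F.coeff ν) := by
  rw [← AddMonoidAlgebra.coeff_inj, coeff_sum]
  conv_lhs => rw [← Finsupp.sum_single F.coeff]
  rfl

/-- Translation of the argument of an exponential polynomial by `τ`. -/
def translate (P : RootPairing ι ℝ M N) (L : ℂ) (τ : M) (F : AddMonoidAlgebra ℂ N) :
    AddMonoidAlgebra ℂ N :=
  AddMonoidAlgebra.ofCoeff (Finsupp.onFinset F.coeff.support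
    (fun ν => qpow L (2 * P.toLinearMap τ ν) * F.coeff ν) fun ν h => by
      simp only [Finsupp.mem_support_iff]
      exact right_ne_zero_of_mul h)

lemma coeff_translate (τ : M) (F : AddMonoidAlgebra ℂ N) (ν : N) :
    (translate P L τ F).coeff ν = qpow L (2 * P.toLinearMap τ ν) * F.coeff ν := rfl

lemma evalAt_translate (τ z : M) (F : AddMonoidAlgebra ℂ N) :
    evalAt P L z (translate P L τ F) = evalAt P L (z + τ) F := by
  rw [evalAt_eq_sum _ _ subset_rfl, evalAt_eq_sum _ F
    (s := (translate P L τ F).coeff.support) (fun ν hν => by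
      rw [Finsupp.mem_support_iff] at hν ⊢
      exact mul_ne_zero (qpow_ne_zero _) hν)]
  refine Finset.sum_congr rfl fun ν _ => ?_
  rw [coeff_translate, map_add, LinearMap.add_apply, mul_add, qpow_add]
  ring

lemma translate_mem_latticeAlgebra {Λ : AddSubgroup N} {F : AddMonoidAlgebra ℂ N}
    (h : F ∈ latticeAlgebra Λ) (τ : M) : translate P L τ F ∈ latticeAlgebra Λ :=
  fun ν hν => h ν (right_ne_zero_of_mul hν)

/-- Divisibility by a binomial, from the vanishing of the sums over its strings. -/
lemma exists_eq_mul_of_sum_eq_zero {Λ : AddSubgroup N} {α : N} (hα : α ∈ Λ)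
    (hprim : ∀ c : ℝ, c • α ∈ Λ → ∃ n : ℤ, c = n) (z₀ : M) {G : AddMonoidAlgebra ℂ N}
    (hG : G ∈ latticeAlgebra Λ)
    (hsum : ∀ μ, ∑ ν ∈ G.coeff.support with (∃ c : ℝ, ν = μ + c • α),
      G.coeff ν * qpow L (2 * P.toLinearMap z₀ ν) = 0) :
    ∃ G' ∈ latticeAlgebra Λ, G = (single α 1 - single 0 (qpow L (2 * P.toLinearMap z₀ α))) * G' := by
  let χ : N → ℂ := fun ν => qpow L (2 * P.toLinearMap z₀ ν)
  have hχ : ∀ ν, χ ν ≠ 0 := fun ν => qpow_ne_zero _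
  have hχadd : ∀ ν μ, χ (ν + μ) = χ ν * χ μ := fun ν μ => by
    simp only [χ]
    rw [map_add, mul_add, qpow_add]
  let d : AddMonoidAlgebra ℂ N := single α 1 - single 0 (χ α)
  -- Modulo the multiples of d, the normalized monomials `T ν` are constant along a string. Hence G
  -- reduces to its string sums, which vanish by `hsum`.
  let J : Submodule ℂ (AddMonoidAlgebra ℂ N) :=
    (latticeAlgebra Λ).toSubmodule.map (LinearMap.mulLeft ℂ d)
  let T : N → AddMonoidAlgebra ℂ N := fun ν => single ν (χ ν)⁻¹
  have hstep : ∀ μ ∈ Λ, T (μ + α) - T μ ∈ J := by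
    intro μ hμ
    refine ⟨single μ (χ μ * χ α)⁻¹, single_mem_latticeAlgebra hμ _, ?_⟩
    simp only [LinearMap.mulLeft_apply, d, T, sub_mul, single_mul_single, hχadd, zero_add, one_mul]
    rw [add_comm α μ]
    congr 2
    have := hχ μ
    have := hχ α
    field_simp
  have hmem : ∀ (n : ℤ) (μ : N), μ ∈ Λ → T (μ + n • α) - T μ ∈ J := by
    intro n
    induction n with
    | zero => intro μ _; simp
    | succ n ih =>
      intro μ hμ
      have h1 := hstep (μ + (n : ℤ) • α) (Λ.add_mem hμ (Λ.zsmul_mem hα _))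
      have h2 := J.add_mem h1 (ih μ hμ)
      rwa [sub_add_sub_cancel, add_assoc, ← add_one_zsmul] at h2
    | pred n ih =>
      intro μ hμ
      have h1 := hstep (μ + (-(n : ℤ) - 1) • α) (Λ.add_mem hμ (Λ.zsmul_mem hα _))
      rw [add_assoc, ← add_one_zsmul, sub_add_cancel] at h1
      have h2 := J.sub_mem (ih μ hμ) h1
      rwa [sub_sub_sub_cancel_left] at h2
  -- representatives of the strings
  let r : N → N := fun ν => (QuotientAddGroup.mk ν : N ⧸ AddSubgroup.zmultiples α).out
  have hr : ∀ ν, ∃ n : ℤ, ν = r ν + n • α := by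
    intro ν
    have h1 : (QuotientAddGroup.mk (r ν) : N ⧸ AddSubgroup.zmultiples α) = QuotientAddGroup.mk ν :=
      Quotient.out_eq' _
    rw [QuotientAddGroup.eq, AddSubgroup.mem_zmultiples_iff] at h1
    obtain ⟨n, hn⟩ := h1
    exact ⟨n, by rw [hn]; abel⟩
  have hr' : ∀ ν μ, (∃ n : ℤ, ν = μ + n • α) → r ν = r μ := by
    rintro ν μ ⟨n, rfl⟩
    have h1 : (QuotientAddGroup.mk (μ + n • α) : N ⧸ AddSubgroup.zmultiples α) =
        QuotientAddGroup.mk μ := by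
      rw [eq_comm, QuotientAddGroup.eq, AddSubgroup.mem_zmultiples_iff]
      exact ⟨n, by abel⟩
    simp only [r, h1]
  have hrΛ : ∀ ν ∈ Λ, r ν ∈ Λ := by
    intro ν hν
    obtain ⟨n, hn⟩ := hr ν
    have : r ν = ν - n • α := by rw [eq_sub_iff_add_eq, ← hn]
    rw [this]
    exact Λ.sub_mem hν (Λ.zsmul_mem hα _)
  have hsupp : ∀ ν ∈ G.coeff.support, ν ∈ Λ := fun ν hν => hG ν (Finsupp.mem_support_iff.1 hν)
  have h1 : G - ∑ ν ∈ G.coeff.support, (G.coeff ν * χ ν) • T (r ν) ∈ J := by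
    conv => enter [2, 1]; rw [eq_sum_single G]
    rw [← Finset.sum_sub_distrib]
    refine J.sum_mem fun ν hν => ?_
    obtain ⟨n, hn⟩ := hr ν
    have h2 : single ν (G.coeff ν) = (G.coeff ν * χ ν) • T ν := by
      simp only [T, smul_single, smul_eq_mul]
      rw [mul_assoc, mul_inv_cancel₀ (hχ ν), mul_one]
    rw [h2, ← smul_sub]
    refine J.smul_mem _ ?_
    have := hmem n (r ν) (hrΛ ν (hsupp ν hν))
    rwa [← hn] at this
  have h2 : ∑ ν ∈ G.coeff.support, (G.coeff ν * χ ν) • T (r ν) = 0 := by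
    rw [← Finset.sum_fiberwise_of_maps_to (fun ν hν => Finset.mem_image_of_mem r hν)]
    refine Finset.sum_eq_zero fun ρ hρ => ?_
    obtain ⟨μ, hμ, rfl⟩ := Finset.mem_image.1 hρ
    rw [Finset.sum_congr rfl fun ν hν => by rw [(Finset.mem_filter.1 hν).2], ← Finset.sum_smul]
    have h3 := hsum μ
    have h4 : (G.coeff.support.filter fun ν => ∃ c : ℝ, ν = μ + c • α) =
        G.coeff.support.filter fun ν => r ν = r μ := by
      ext ν
      simp only [Finset.mem_filter, and_congr_right_iff]
      intro hν
      constructor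
      · rintro ⟨c, hc⟩
        obtain ⟨n, hn⟩ := hprim c (by
          have : c • α = ν - μ := by rw [hc]; abel
          rw [this]
          exact Λ.sub_mem (hsupp ν hν) (hsupp μ hμ))
        exact hr' _ _ ⟨n, by rw [hc, hn, Int.cast_smul_eq_zsmul]⟩
      · intro h
        obtain ⟨n, hn⟩ := hr ν
        obtain ⟨k, hk⟩ := hr μ
        refine ⟨((n - k : ℤ) : ℝ), ?_⟩
        rw [Int.cast_smul_eq_zsmul, sub_smul]
        rw [h] at hn
        calc ν = r μ + n • α := hn
          _ = (r μ + k • α) + (n • α - k • α) := by abel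
          _ = _ := by rw [← hk]
    rw [← h4, h3, zero_smul]
  rw [h2, sub_zero] at h1
  obtain ⟨G', hG', h3⟩ := h1
  exact ⟨G', hG', h3.symm⟩

/-- Identifies the classes of `sum_class_eq_zero` for the hyperplane α^∨ = 0 with the α^∨-strings;
subtracting a multiple of α moves any z into that hyperplane. -/
lemma forall_pair_eq_iff (i : ι) (ν μ : N) :
    (∀ v ∈ LinearMap.ker (P.toLinearMap.flip (P.coroot i)),
      P.toLinearMap v ν = P.toLinearMap v μ) ↔ ∃ c : ℝ, ν = μ + c • P.coroot i := by
  constructor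
  · intro h
    refine ⟨P.toLinearMap (P.root i) (ν - μ) / 2, ?_⟩
    refine eq_of_forall_pair P fun z => ?_
    have := h (z - (P.toLinearMap z (P.coroot i) / 2) • P.root i) (by
      simp only [LinearMap.mem_ker, LinearMap.flip_apply, map_sub, map_smul, P.root_coroot_two,
        smul_eq_mul]
      ring)
    simp only [map_sub, map_smul, map_add, LinearMap.sub_apply, LinearMap.smul_apply,
      smul_eq_mul] at this ⊢
    linarith
  · rintro ⟨c, rfl⟩ v hv
    have : P.toLinearMap v (P.coroot i) = 0 := hv
    simp [this]

/-- The binomial `q ^ (2 (α^∨, z)) - q ^ (-2 k)`, which vanishes for `(α^∨, z) = -k`. -/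
def binomial (P : RootPairing ι ℝ M N) (L : ℂ) (i : ι) (k : ℝ) : AddMonoidAlgebra ℂ N :=
  single (P.coroot i) 1 - single 0 (qpow L (-2 * k))

lemma evalAt_binomial (z : M) (i : ι) (k : ℝ) :
    evalAt P L z (binomial P L i k) =
      qpow L (P.toLinearMap z (P.coroot i) - k) * qbr L (P.toLinearMap z (P.coroot i) + k) := by
  rw [binomial, map_sub, evalAt_single, evalAt_single, qbr, mul_sub,
    map_zero, mul_zero, qpow_zero, mul_one, one_mul, ← qpow_add, ← qpow_add]
  congr 2 <;> ring

lemma binomial_mem_latticeAlgebra {Λ : AddSubgroup N} {i : ι} (h : P.coroot i ∈ Λ) (k : ℝ) :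
    binomial P L i k ∈ latticeAlgebra Λ :=
  Subalgebra.sub_mem _ (single_mem_latticeAlgebra h _) (single_mem_latticeAlgebra Λ.zero_mem _)

/-- An exponential polynomial that vanishes on the hyperplane `(α^∨, z) = -k` is divisible
by the binomial. -/
lemma exists_eq_binomial_mul (hL : L ≠ 0) {Λ : AddSubgroup N} {i : ι} (hi : P.coroot i ∈ Λ)
    (hprim : ∀ c : ℝ, c • P.coroot i ∈ Λ → ∃ n : ℤ, c = n) {G : AddMonoidAlgebra ℂ N}
    (hG : G ∈ latticeAlgebra Λ) (k : ℝ)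
    (h : ∀ z, P.toLinearMap z (P.coroot i) = -k → evalAt P L z G = 0) :
    ∃ G' ∈ latticeAlgebra Λ, G = binomial P L i k * G' := by
  let z₀ : M := (-k / 2) • P.root i
  have hz₀ : P.toLinearMap z₀ (P.coroot i) = -k := by simp [z₀]
  obtain ⟨G', h1, h2⟩ := exists_eq_mul_of_sum_eq_zero (P := P) (L := L) hi hprim z₀ hG (by
    intro μ
    have := sum_class_eq_zero (P := P) hL (LinearMap.ker (P.toLinearMap.flip (P.coroot i))) z₀
      G.coeff.support id G.coeff (fun v hv => by
        have hv' : P.toLinearMap v (P.coroot i) = 0 := hv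
        rw [← h (z₀ + v) (by rw [map_add, LinearMap.add_apply, hz₀, hv', add_zero]),
          evalAt_eq_sum _ _ subset_rfl]
        rfl) μ
    simp only [id] at this
    simp_rw [forall_pair_eq_iff] at this
    exact this)
  refine ⟨G', h1, ?_⟩
  rw [h2, binomial, hz₀]
  congr 4
  ring

end LatticeAlgebra

end BakerAkhiezer

end

noncomputable section

namespace BakerAkhiezer

open scoped Classical Topology
open Filter

/-! ### Zeros and poles of the coefficients at one pair of opposite coroots -/

section LocalFactors

variable {L : ℂ}

/-- The contribution of one coroot to the coefficients of the Macdonald operator, where `n` is the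
value of the coroot on the shift and `u` is its value on the variable. -/
def factor (L : ℂ) (n : ℝ) (m : ℕ) (u : ℝ) : ℂ :=
  (if 0 < n then qbr L (u - m) / qbr L u else 1) *
    if n = 2 then qbr L (u - m + 1) / qbr L (u + 1) else 1

/-- The contribution of a coroot and its opposite. -/
def pairFactor (L : ℂ) (n : ℝ) (m : ℕ) (u : ℝ) : ℂ := factor L n m u * factor L (-n) m (-u)

lemma continuous_qbr : Continuous (qbr L) :=
  continuous_qpow.sub (continuous_qpow.comp continuous_neg)

lemma continuousAt_factor {n : ℝ} {m : ℕ} {u : ℝ} (h0 : qbr L u ≠ 0) (h1 : qbr L (u + 1) ≠ 0) :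
    ContinuousAt (factor L n m) u := by
  have hc : ∀ g : ℝ → ℝ, Continuous g → ContinuousAt (fun u => qbr L (g u)) u :=
    fun g hg => (continuous_qbr.comp hg).continuousAt
  refine ContinuousAt.mul ?_ ?_
  · split_ifs
    · exact (hc _ (by fun_prop)).div (hc _ continuous_id) h0
    · exact continuousAt_const
  · split_ifs
    · exact (hc _ (by fun_prop)).div (hc _ (by fun_prop)) h1
    · exact continuousAt_const

lemma pairFactor_neg (n : ℝ) (m : ℕ) (u : ℝ) : pairFactor L (-n) m (-u) = pairFactor L n m u := by
  rw [pairFactor, pairFactor, neg_neg, neg_neg, mul_comm]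

lemma pairFactor_zero (m : ℕ) (u : ℝ) : pairFactor L 0 m u = 1 := by
  simp [pairFactor, factor]

lemma pairFactor_one (m : ℕ) (u : ℝ) : pairFactor L 1 m u = qbr L (u - m) / qbr L u := by
  have h : ¬ ((-1 : ℝ) = 2) := by norm_num
  have h' : ¬ ((0 : ℝ) < -1) := by norm_num
  simp [pairFactor, factor, h, h']

lemma pairFactor_two (m : ℕ) (u : ℝ) : pairFactor L 2 m u =
    qbr L (u - m) / qbr L u * (qbr L (u - m + 1) / qbr L (u + 1)) := by
  have h : ¬ ((-2 : ℝ) = 2) := by norm_num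
  have h' : ¬ ((0 : ℝ) < -2) := by norm_num
  simp [pairFactor, factor, h, h']

lemma pairFactor_neg_two (m : ℕ) (u : ℝ) : pairFactor L (-2) m u =
    qbr L (-u - m) / qbr L (-u) * (qbr L (-u - m + 1) / qbr L (-u + 1)) := by
  rw [← neg_neg u, pairFactor_neg, pairFactor_two, neg_neg]

lemma NotRootOfUnity.qbr_ne_zero (h : NotRootOfUnity L) {u : ℝ} (n : ℤ) (hu : u = n)
    (hn : n ≠ 0) : qbr L u ≠ 0 := by
  rw [hu]
  exact h.qbr_int_ne_zero hn

lemma eventually_qbr_ne_zero (hL : L ≠ 0) : ∀ᶠ u in 𝓝[≠] (0 : ℝ), qbr L u ≠ 0 := by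
  have h := hasDerivAt_qbr (L := L) 0 1 0
  simp only [zero_add, one_mul, mul_zero, neg_zero, qpow_zero] at h
  have h2 := h.eventually_ne (c := 0) (by
    refine mul_ne_zero (by norm_num) (mul_ne_zero (by norm_num) hL))
  simpa using h2

/-- At `u = 0` the two factors have at most a simple pole. -/
lemma exists_qbr_mul_pairFactor_eq (hL : NotRootOfUnity L) {n : ℝ} (m : ℕ)
    (hn : n = 0 ∨ n = 1 ∨ n = -1 ∨ n = 2 ∨ n = -2) :
    ∃ k : ℝ → ℂ, ContinuousAt k 0 ∧
      (∀ᶠ u in 𝓝[≠] (0 : ℝ), qbr L u * pairFactor L n m u = k u) ∧ (k 0 = 0 ∨ |n| ≤ m) := by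
  have hc : ∀ g : ℝ → ℝ, Continuous g → ContinuousAt (fun u => qbr L (g u)) 0 :=
    fun g hg => (continuous_qbr.comp hg).continuousAt
  have hpos : ∀ n : ℝ, n = 1 ∨ n = 2 → ∃ k : ℝ → ℂ, ContinuousAt k 0 ∧
      (∀ᶠ u in 𝓝[≠] (0 : ℝ), qbr L u * pairFactor L n m u = k u) ∧ (k 0 = 0 ∨ |n| ≤ m) := by
    rintro n (rfl | rfl)
    · refine ⟨fun u => qbr L (u - m), hc _ (by fun_prop), ?_, ?_⟩
      · filter_upwards [eventually_qbr_ne_zero hL.ne_zero] with u hu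
        rw [pairFactor_one, mul_div_cancel₀ _ hu]
      · rcases Nat.eq_zero_or_pos m with h | h
        · left
          simp [h, qbr_zero]
        · right
          rw [abs_one]
          exact_mod_cast h
    · refine ⟨fun u => qbr L (u - m) * (qbr L (u - m + 1) / qbr L (u + 1)),
        (hc _ (by fun_prop)).mul ((hc _ (by fun_prop)).div (hc _ (by fun_prop)) ?_), ?_, ?_⟩
      · exact hL.qbr_ne_zero 1 (by simp) one_ne_zero
      · filter_upwards [eventually_qbr_ne_zero hL.ne_zero] with u hu
        rw [pairFactor_two, ← mul_assoc, mul_div_cancel₀ _ hu]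
      -- At u = 0 the numerator vanishes through [u - m] if m = 0 and through [u - m + 1] if m = 1.
      · rcases lt_or_ge m 2 with h | h
        · left
          interval_cases m <;> simp [qbr_zero]
        · right
          rw [abs_two]
          exact_mod_cast h
  have hneg : ∀ n : ℝ, n = 1 ∨ n = 2 → ∃ k : ℝ → ℂ, ContinuousAt k 0 ∧
      (∀ᶠ u in 𝓝[≠] (0 : ℝ), qbr L u * pairFactor L (-n) m u = k u) ∧ (k 0 = 0 ∨ |-n| ≤ m) := by
    intro n hn
    obtain ⟨k, h1, h2, h3⟩ := hpos n hn
    refine ⟨fun u => -k (-u), ?_, ?_, ?_⟩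
    · refine (ContinuousAt.comp (f := fun u : ℝ => -u) (x := 0) (by simpa using h1)
        continuousAt_neg).neg
    · have : Tendsto (fun u : ℝ => -u) (𝓝[≠] 0) (𝓝[≠] 0) := by
        refine tendsto_nhdsWithin_iff.2 ⟨?_, ?_⟩
        · simpa using (continuous_neg.tendsto (0 : ℝ)).mono_left nhdsWithin_le_nhds
        · filter_upwards [self_mem_nhdsWithin] with u hu
          simpa using hu
      filter_upwards [this.eventually h2] with u hu
      rw [← hu, ← pairFactor_neg, neg_neg, qbr_neg]
      ring
    · simpa using h3
  rcases hn with rfl | rfl | rfl | rfl | rfl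
  · exact ⟨qbr L, continuous_qbr.continuousAt, by simp [pairFactor_zero], Or.inl qbr_zero⟩
  · exact hpos 1 (Or.inl rfl)
  · exact hneg 1 (Or.inl rfl)
  · exact hpos 2 (Or.inr rfl)
  · exact hneg 2 (Or.inr rfl)

lemma continuousAt_pairFactor {n : ℝ} {m : ℕ} {u : ℝ} (h0 : qbr L u ≠ 0)
    (h1 : n = 2 → qbr L (u + 1) ≠ 0) (h2 : n = -2 → qbr L (-u + 1) ≠ 0) :
    ContinuousAt (pairFactor L n m) u := by
  have hc : ∀ g : ℝ → ℝ, Continuous g → ContinuousAt (fun u => qbr L (g u)) u :=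
    fun g hg => (continuous_qbr.comp hg).continuousAt
  have h0' : qbr L (-u) ≠ 0 := by rwa [qbr_neg, neg_ne_zero]
  refine ContinuousAt.mul (ContinuousAt.mul ?_ ?_) (ContinuousAt.mul ?_ ?_)
  · split_ifs
    · exact (hc _ (by fun_prop)).div (hc _ continuous_id) h0
    · exact continuousAt_const
  · split_ifs with h
    · exact (hc _ (by fun_prop)).div (hc _ (by fun_prop)) (h1 h)
    · exact continuousAt_const
  · split_ifs
    · exact (hc _ (by fun_prop)).div (hc _ continuous_neg) h0'
    · exact continuousAt_const
  · split_ifs with h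
    · exact (hc _ (by fun_prop)).div (hc _ (by fun_prop)) (h2 (by linarith))
    · exact continuousAt_const

/-- The numerators [u - m] and [u - m + 1] vanish at those u = s from which the shift by n would
leave the range |u| ≤ m. -/
lemma pairFactor_eq_zero {n : ℝ} {m : ℕ} {s : ℤ} (hs : 1 ≤ s) (hsm : s ≤ m)
    (hn : n = 0 ∨ n = 1 ∨ n = -1 ∨ n = 2 ∨ n = -2) :
    pairFactor L n m s = 0 ∨ |s + n| ≤ m := by
  have hs' : (1 : ℝ) ≤ s := by exact_mod_cast hs
  have hsm' : (s : ℝ) ≤ m := by exact_mod_cast hsm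
  rcases hn with rfl | rfl | rfl | rfl | rfl
  · right
    rw [abs_le]
    constructor <;> linarith
  · rcases hsm.lt_or_eq with h | h
    · right
      have : (s : ℝ) + 1 ≤ m := by exact_mod_cast h
      rw [abs_le]
      constructor <;> linarith
    · left
      have : (s : ℝ) = m := by exact_mod_cast h
      rw [pairFactor_one, this, sub_self, qbr_zero, zero_div]
  · right
    rw [abs_le]
    constructor <;> linarith
  · rcases le_or_gt (s + 2) m with h | h
    · right
      have : (s : ℝ) + 2 ≤ m := by exact_mod_cast h
      rw [abs_le]
      constructor <;> linarith
    · left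
      rw [pairFactor_two]
      rcases hsm.lt_or_eq with h' | h'
      · have : s = m - 1 := by omega
        have : (s : ℝ) = m - 1 := by exact_mod_cast this
        have h0 : (s : ℝ) - m + 1 = 0 := by linarith
        rw [h0, qbr_zero, zero_div, mul_zero]
      · have : (s : ℝ) = m := by exact_mod_cast h'
        rw [this, sub_self, qbr_zero, zero_div, zero_mul]
  · right
    rw [abs_le]
    constructor <;> linarith

end LocalFactors

/-! ### The Macdonald coefficients near a coroot hyperplane -/

section Coefficients

variable {ι M N : Type*} [Fintype ι] [AddCommGroup M] [Module ℝ M] [AddCommGroup N] [Module ℝ N]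
variable {P : RootPairing ι ℝ M N} {L : ℂ} {m : ι → ℕ}

lemma macdonaldCoeff_eq_prod (τ z : M) : macdonaldCoeff P m L τ z =
    ∏ i, factor L (P.toLinearMap τ (P.coroot i)) (m i) (P.toLinearMap z (P.coroot i)) := by
  rw [macdonaldCoeff, Finset.prod_filter, Finset.prod_filter, ← Finset.prod_mul_distrib]
  rfl

lemma macdonaldCoeff_reflection (hm : ∀ i j, m (P.reflectionPerm i j) = m j) (i : ι) (τ z : M) :
    macdonaldCoeff P m L (P.reflection i τ) (P.reflection i z) = macdonaldCoeff P m L τ z := by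
  rw [macdonaldCoeff_eq_prod, macdonaldCoeff_eq_prod,
    ← Equiv.prod_comp (P.reflectionPerm i : Equiv.Perm ι) fun j =>
      factor L (P.toLinearMap τ (P.coroot j)) (m j) (P.toLinearMap z (P.coroot j))]
  refine Finset.prod_congr rfl fun j _ => ?_
  rw [hm, pair_coroot_reflectionPerm, pair_coroot_reflectionPerm]

lemma macdonaldOp_apply [P.IsRootSystem] (b : P.Base) (ω : M) (f : M → ℂ) (z : M) :
    macdonaldOp b m L ω f z =
      ∑ τ ∈ weylOrbit P ω, macdonaldCoeff P m L τ z * (f (z + τ) - f z) +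
        (∑ τ ∈ weylOrbit P ω, qpow L (-2 * P.toLinearMap τ (rhoCheck b m))) * f z := by
  simp [macdonaldOp, shiftOp, LinearMap.funLeft_apply, Finset.sum_mul]

/-- `z` is off the singular hyperplanes of all roots other than `±α`. -/
def IsGenericOff (P : RootPairing ι ℝ M N) (L : ℂ) (i : ι) (z : M) : Prop :=
  ∀ j, j ≠ i → j ≠ opp P i → ∀ n : ℤ, qbr L (P.toLinearMap z (P.coroot j) + n) ≠ 0

/-- At a point generic off ±α only the factors of α and -α can be singular; all the others go into
the continuous factor. -/
lemma macdonaldCoeff_line {i : ι} {z : M} (hz : IsGenericOff P L i z) (hm : m (opp P i) = m i)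
    (τ : M) :
    ∃ g : ℝ → ℂ, ContinuousAt g 0 ∧ ∀ t : ℝ, macdonaldCoeff P m L τ (z + t • P.root i) =
      g t * pairFactor L (P.toLinearMap τ (P.coroot i)) (m i)
        (P.toLinearMap z (P.coroot i) + 2 * t) := by
  refine ⟨fun t => ∏ j ∈ (Finset.univ.erase i).erase (opp P i),
    factor L (P.toLinearMap τ (P.coroot j)) (m j)
      (P.toLinearMap (z + t • P.root i) (P.coroot j)), ?_, fun t => ?_⟩
  · refine tendsto_finsetProd _ fun j hj => ?_
    have h1 := Finset.ne_of_mem_erase hj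
    have h2 := Finset.ne_of_mem_erase (Finset.mem_of_mem_erase hj)
    refine ContinuousAt.comp (g := factor L (P.toLinearMap τ (P.coroot j)) (m j))
      (continuousAt_factor ?_ ?_) (pair_continuous_line P z (P.root i) _).continuousAt
    · simpa using hz j h2 h1 0
    · simpa using hz j h2 h1 1
  · rw [macdonaldCoeff_eq_prod, ← Finset.mul_prod_erase _ _ (Finset.mem_univ i),
      ← Finset.mul_prod_erase (Finset.univ.erase i) _
        (Finset.mem_erase.2 ⟨opp_ne P i, Finset.mem_univ _⟩), pairFactor, hm, coroot_opp]
    have : P.toLinearMap (z + t • P.root i) (P.coroot i) =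
        P.toLinearMap z (P.coroot i) + 2 * t := by
      simp
      ring
    rw [map_neg, map_neg, this]
    ring

end Coefficients

end BakerAkhiezer

end

noncomputable section

namespace BakerAkhiezer

open scoped Classical Topology
open Filter

/-! ### Cancellation of poles and of the antisymmetric part -/

section Limits

variable {ι M N : Type*} [Fintype ι] [AddCommGroup M] [Module ℝ M] [AddCommGroup N] [Module ℝ N]
variable {P : RootPairing ι ℝ M N} {L : ℂ} {m : ι → ℕ}

/-- Quasi-invariance: `f (s_α z) = f z` if `(α^∨, z)` is an integer between `-m_α` and `m_α`. -/
def IsQuasiInvariant (P : RootPairing ι ℝ M N) (m : ι → ℕ) (f : M → ℂ) : Prop :=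
  ∀ i (n : ℤ), |n| ≤ m i → ∀ z, P.toLinearMap z (P.coroot i) = n → f (P.reflection i z) = f z

omit [Fintype ι] in
lemma IsSmallWeight.cases {τ : M} (h : IsSmallWeight P τ) (i : ι) :
    P.toLinearMap τ (P.coroot i) = 0 ∨ P.toLinearMap τ (P.coroot i) = 1 ∨
      P.toLinearMap τ (P.coroot i) = -1 ∨
      (P.toLinearMap τ (P.coroot i) = 2 ∧ τ = P.root i) ∨
      (P.toLinearMap τ (P.coroot i) = -2 ∧ τ = -P.root i) := by
  obtain ⟨n, hn, h1 | h1 | h1⟩ := h i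
  · obtain ⟨h2, h3⟩ := abs_le.1 h1
    interval_cases n <;> simp [hn]
  · simp [h1]
  · simp [h1]

omit [Fintype ι] in
lemma IsSmallWeight.cases' {τ : M} (h : IsSmallWeight P τ) (i : ι) :
    P.toLinearMap τ (P.coroot i) = 0 ∨ P.toLinearMap τ (P.coroot i) = 1 ∨
      P.toLinearMap τ (P.coroot i) = -1 ∨ P.toLinearMap τ (P.coroot i) = 2 ∨
      P.toLinearMap τ (P.coroot i) = -2 := by
  rcases h.cases i with h | h | h | h | h <;> simp [h]

omit [Fintype ι] in
lemma IsQuasiInvariant.eq_of_abs_le {f : M → ℂ} (hf : IsQuasiInvariant P m f) {i : ι} {z : M}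
    {x : ℝ} (hx : P.toLinearMap z (P.coroot i) = x) {n : ℤ} (hn : x = n) (h : |x| ≤ m i) :
    f (P.reflection i z) = f z := by
  refine hf i n ?_ z (by rw [hx, hn])
  rw [hn] at h
  exact_mod_cast h

lemma tendsto_const_mul_punctured {c : ℝ} (hc : c ≠ 0) :
    Tendsto (fun t : ℝ => c * t) (𝓝[≠] 0) (𝓝[≠] 0) := by
  refine tendsto_nhdsWithin_iff.2 ⟨?_, ?_⟩
  · have : Tendsto (fun t : ℝ => c * t) (𝓝 0) (𝓝 (c * 0)) :=
      (continuous_const.mul continuous_id).tendsto 0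
    rw [mul_zero] at this
    exact this.mono_left nhdsWithin_le_nhds
  · filter_upwards [self_mem_nhdsWithin] with t ht
    exact mul_ne_zero hc ht

omit [Fintype ι] in
lemma reflection_line (i : ι) (z : M) (t : ℝ) :
    P.reflection i (z + t • P.root i) = P.reflection i z + (-t) • P.root i := by
  rw [map_add, map_smul, P.reflection_apply_self, smul_neg, neg_smul]

omit [Fintype ι] in
lemma reflection_eq_self {i : ι} {z : M} (h : P.toLinearMap z (P.coroot i) = 0) :
    P.reflection i z = z := by
  rw [P.reflection_apply, show P.coroot' i z = 0 from h, zero_smul, sub_zero]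

omit [Fintype ι] in
lemma pair_line (i : ι) (z : M) (t : ℝ) : P.toLinearMap (z + t • P.root i) (P.coroot i) =
    P.toLinearMap z (P.coroot i) + 2 * t := by
  simp
  ring

lemma continuousAt_pairFactor_line {n : ℝ} {k : ℕ} {c : ℝ}
    (h : ContinuousAt (pairFactor L n k) c) :
    ContinuousAt (fun t : ℝ => pairFactor L n k (c + 2 * t)) 0 :=
  ContinuousAt.comp (g := pairFactor L n k) (f := fun t : ℝ => c + 2 * t) (x := 0)
    (by simpa using h) (by fun_prop)

variable [P.IsRootSystem] [P.IsCrystallographic]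

/-- The sum `∑ a_τ(z) (f(z + τ) - f(z))`. -/
def differenceSum (P : RootPairing ι ℝ M N) [P.IsRootSystem] (m : ι → ℕ) (L : ℂ) (ω : M)
    (f : M → ℂ) (z : M) : ℂ :=
  ∑ τ ∈ weylOrbit P ω, macdonaldCoeff P m L τ z * (f (z + τ) - f z)

/-- On the wall (α^∨, z) = 0 the terms of τ and s_α τ have opposite residues. Either the residue is
zero or |(τ, α^∨)| ≤ m_α, and then quasi-invariance gives f(z + τ) = f(z + s_α τ). -/
lemma tendsto_qbr_mul_differenceSum (hL : NotRootOfUnity L)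
    (hm : ∀ i j, m (P.reflectionPerm i j) = m j) {ω : M}
    (hω : IsMinuscule P ω ∨ IsQuasiminuscule P ω) {f : M → ℂ}
    (hf : ∀ z v, Continuous fun t : ℝ => f (z + t • v)) (hq : IsQuasiInvariant P m f)
    {i : ι} {z : M} (hz : IsGenericOff P L i z) (hz0 : P.toLinearMap z (P.coroot i) = 0) :
    Tendsto (fun t : ℝ => qbr L (2 * t) * differenceSum P m L ω f (z + t • P.root i))
      (𝓝[≠] 0) (𝓝 0) := by
  let φ : M → ℝ → ℂ := fun τ t => f (z + t • P.root i + τ) - f (z + t • P.root i)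
  have hφ : ∀ τ, Continuous (φ τ) := fun τ => by
    refine Continuous.sub ?_ (hf z _)
    simp_rw [add_right_comm z]
    exact hf (z + τ) _
  have key : ∀ τ ∈ weylOrbit P ω, Tendsto (fun t : ℝ => qbr L (2 * t) *
      (macdonaldCoeff P m L τ (z + t • P.root i) * φ τ t +
        macdonaldCoeff P m L (P.reflection i τ) (z + t • P.root i) * φ (P.reflection i τ) t))
      (𝓝[≠] 0) (𝓝 0) := by
    intro τ hτ
    have hsmall := isSmallWeight_of_mem hω hτ
    obtain ⟨g, hg, hg'⟩ := macdonaldCoeff_line (m := m) hz (hm i i) τ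
    obtain ⟨k, hk, hk', hk0⟩ := exists_qbr_mul_pairFactor_eq hL (m i) (hsmall.cases' i)
    let K : ℝ → ℂ := fun t => g t * k (2 * t)
    have hK : ContinuousAt K 0 := by
      refine hg.mul (ContinuousAt.comp (f := fun t : ℝ => 2 * t) (x := 0) (by simpa using hk) ?_)
      fun_prop
    have hK2 : ContinuousAt (fun t => K (-t)) 0 :=
      ContinuousAt.comp (g := K) (f := fun t : ℝ => -t) (x := 0) (by simpa using hK)
        continuousAt_neg
    have hlim : Tendsto (fun t => K t * φ τ t - K (-t) * φ (P.reflection i τ) t) (𝓝[≠] 0)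
        (𝓝 0) := by
      have h1 : ContinuousAt (fun t => K t * φ τ t - K (-t) * φ (P.reflection i τ) t) 0 :=
        (hK.mul (hφ _).continuousAt).sub (hK2.mul (hφ _).continuousAt)
      have h2 : K 0 * φ τ 0 - K (-0) * φ (P.reflection i τ) 0 = 0 := by
        rw [neg_zero, ← mul_sub]
        rcases hk0 with h | h
        · simp [K, h]
        · obtain ⟨n, hn⟩ := hsmall.isWeight i
          have h3 := hq.eq_of_abs_le (z := z + τ) (i := i)
            (by rw [map_add, LinearMap.add_apply, hz0, zero_add]) hn h
          rw [map_add, reflection_eq_self hz0] at h3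
          simp [φ, h3]
      have h3 := h1.tendsto
      rw [h2] at h3
      exact h3.mono_left nhdsWithin_le_nhds
    refine hlim.congr' ?_
    filter_upwards [(tendsto_const_mul_punctured two_ne_zero).eventually hk',
      (tendsto_const_mul_punctured (c := -2) (by norm_num)).eventually hk'] with t h1 h2
    have h3 : macdonaldCoeff P m L (P.reflection i τ) (z + t • P.root i) =
        macdonaldCoeff P m L τ (z + (-t) • P.root i) := by
      rw [← macdonaldCoeff_reflection hm i τ, reflection_line, reflection_eq_self hz0, neg_neg]
    rw [h3, hg', hg', hz0, zero_add, zero_add]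
    simp only [K]
    rw [← h1, show 2 * -t = -2 * t by ring, ← h2, show -2 * t = -(2 * t) by ring, qbr_neg]
    ring
  have h2 := tendsto_finsetSum (weylOrbit P ω) key
  rw [Finset.sum_const_zero] at h2
  have h3 := h2.const_mul (1 / 2 : ℂ)
  rw [mul_zero] at h3
  refine h3.congr fun t => ?_
  rw [← Finset.mul_sum, Finset.sum_add_distrib, sum_weylOrbit_reflection ω i fun τ =>
    macdonaldCoeff P m L τ (z + t • P.root i) * φ τ t, differenceSum]
  ring

/-- At (α^∨, z) = -1 a pole occurs only for τ = α. There z + α = s_α z, so quasi-invariance makes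
f(z + τ) - f(z) vanish; this needs m_α ≥ 1. -/
lemma tendsto_qbr_add_one_mul_differenceSum (hL : NotRootOfUnity L)
    (hm : ∀ i j, m (P.reflectionPerm i j) = m j) {ω : M}
    (hω : IsMinuscule P ω ∨ IsQuasiminuscule P ω) {f : M → ℂ}
    (hf : ∀ z v, Continuous fun t : ℝ => f (z + t • v)) (hq : IsQuasiInvariant P m f)
    {i : ι} (hi : 0 < m i) {z : M} (hz : IsGenericOff P L i z)
    (hz0 : P.toLinearMap z (P.coroot i) = -1) :
    Tendsto (fun t : ℝ => qbr L (2 * t) * differenceSum P m L ω f (z + t • P.root i))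
      (𝓝[≠] 0) (𝓝 0) := by
  simp_rw [differenceSum, Finset.mul_sum]
  suffices h : ∀ τ ∈ weylOrbit P ω, Tendsto (fun t : ℝ => qbr L (2 * t) *
      (macdonaldCoeff P m L τ (z + t • P.root i) *
        (f (z + t • P.root i + τ) - f (z + t • P.root i)))) (𝓝[≠] 0) (𝓝 0) by
    simpa only [Finset.sum_const_zero] using tendsto_finsetSum _ h
  intro τ hτ
  have hsmall := isSmallWeight_of_mem hω hτ
  obtain ⟨g, hg, hg'⟩ := macdonaldCoeff_line (m := m) hz (hm i i) τ
  let φ : ℝ → ℂ := fun t => f (z + t • P.root i + τ) - f (z + t • P.root i)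
  have hφ : Continuous φ := by
    refine Continuous.sub ?_ (hf z _)
    simp_rw [add_right_comm z]
    exact hf (z + τ) _
  have hqbr : Continuous fun t : ℝ => qbr L (2 * t) := continuous_qbr.comp (by fun_prop)
  have hm1 : qbr L (-1) ≠ 0 := hL.qbr_ne_zero (-1) (by simp) (by norm_num)
  by_cases h2 : P.toLinearMap τ (P.coroot i) = 2
  · have hτi : τ = P.root i := by
      rcases hsmall.cases i with h | h | h | h | h
      all_goals first | exact h.2 | (exfalso; linarith [h.1]) | (exfalso; linarith)
    have h1 : ContinuousAt (fun t : ℝ => g t * ((qbr L (-1 + 2 * t - m i) /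
        qbr L (-1 + 2 * t)) * qbr L (-1 + 2 * t - m i + 1)) * φ t) 0 := by
      have hc : ∀ h : ℝ → ℝ, Continuous h → ContinuousAt (fun u => qbr L (h u)) 0 :=
        fun h hh => (continuous_qbr.comp hh).continuousAt
      refine (hg.mul (((hc _ (by fun_prop)).div (hc _ (by fun_prop)) ?_).mul
        (hc _ (by fun_prop)))).mul hφ.continuousAt
      simpa using hm1
    have h3 : φ 0 = 0 := by
      have h4 := hq i (-1) (by simpa using Nat.one_le_iff_ne_zero.2 hi.ne') z (by rw [hz0]; simp)
      have h5 : P.reflection i z = z + P.root i := by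
        rw [P.reflection_apply, show P.coroot' i z = -1 from hz0, neg_smul, one_smul, sub_neg_eq_add]
      rw [h5] at h4
      simp [φ, hτi, h4]
    have h4 := h1.tendsto
    simp only [h3, mul_zero] at h4
    refine (h4.mono_left nhdsWithin_le_nhds).congr' ?_
    filter_upwards [(tendsto_const_mul_punctured two_ne_zero).eventually
      (eventually_qbr_ne_zero hL.ne_zero)] with t ht
    rw [hg', h2, hz0, pairFactor_two, show -1 + 2 * t + 1 = 2 * t by ring]
    simp only [φ]
    field_simp
  · have h1 : ContinuousAt (fun t : ℝ => qbr L (2 * t) *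
        (macdonaldCoeff P m L τ (z + t • P.root i) * φ t)) 0 := by
      simp_rw [hg']
      refine hqbr.continuousAt.mul
        ((hg.mul (continuousAt_pairFactor_line ?_)).mul hφ.continuousAt)
      rw [hz0]
      refine continuousAt_pairFactor hm1 (fun h => absurd h h2) fun _ => ?_
      exact hL.qbr_ne_zero 2 (by norm_num) (by norm_num)
    have h3 := h1.tendsto
    simp only [mul_zero, qbr_zero, zero_mul] at h3
    exact h3.mono_left nhdsWithin_le_nhds

/-- By equivariance the difference is D applied to the antisymmetric function Δ, which vanishes
where (α^∨, z) is an integer between -m_α and m_α. Each term tends to zero because Δ(z + τ) = 0 or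
the coefficient vanishes, except for one singular term. -/
lemma tendsto_differenceSum_sub_reflection (hL : NotRootOfUnity L)
    (hm : ∀ i j, m (P.reflectionPerm i j) = m j) {ω : M}
    (hω : IsMinuscule P ω ∨ IsQuasiminuscule P ω) {f : M → ℂ}
    (hf : ∀ z v, Differentiable ℝ fun t : ℝ => f (z + t • v)) (hq : IsQuasiInvariant P m f)
    {i : ι} {s : ℤ} (hs : 1 ≤ s) (hsm : s ≤ m i) {z : M} (hz : IsGenericOff P L i z)
    (hz0 : P.toLinearMap z (P.coroot i) = s) :
    Tendsto (fun t : ℝ => differenceSum P m L ω f (z + t • P.root i) -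
      differenceSum P m L ω f (P.reflection i (z + t • P.root i))) (𝓝[≠] 0) (𝓝 0) := by
  let Δ : M → ℂ := fun w => f w - f (P.reflection i w)
  have hΔ : ∀ w v, Differentiable ℝ fun t : ℝ => Δ (w + t • v) := fun w v => by
    refine (hf w v).sub ?_
    simp_rw [map_add, map_smul]
    exact hf _ _
  have hΔs : ∀ w, Δ (P.reflection i w) = -Δ w := fun w => by
    simp [Δ]
  have hΔ0 : ∀ w, ∀ n : ℤ, P.toLinearMap w (P.coroot i) = n → |(n : ℝ)| ≤ m i → Δ w = 0 := by
    intro w n h1 h2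
    simp only [Δ]
    rw [hq.eq_of_abs_le h1 rfl h2, sub_self]
  have hdiff : ∀ w, differenceSum P m L ω f w - differenceSum P m L ω f (P.reflection i w) =
      ∑ τ ∈ weylOrbit P ω, macdonaldCoeff P m L τ w * (Δ (w + τ) - Δ w) := by
    intro w
    rw [differenceSum, differenceSum, ← sum_weylOrbit_reflection ω i fun τ =>
      macdonaldCoeff P m L τ (P.reflection i w) *
        (f (P.reflection i w + τ) - f (P.reflection i w)), ← Finset.sum_sub_distrib]
    refine Finset.sum_congr rfl fun τ _ => ?_
    rw [macdonaldCoeff_reflection hm]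
    simp only [Δ, map_add]
    ring
  simp_rw [hdiff]
  suffices h : ∀ τ ∈ weylOrbit P ω, Tendsto (fun t : ℝ => macdonaldCoeff P m L τ (z + t • P.root i) *
      (Δ (z + t • P.root i + τ) - Δ (z + t • P.root i))) (𝓝[≠] 0) (𝓝 0) by
    simpa only [Finset.sum_const_zero] using tendsto_finsetSum _ h
  intro τ hτ
  have hsmall := isSmallWeight_of_mem hω hτ
  obtain ⟨g, hg, hg'⟩ := macdonaldCoeff_line (m := m) hz (hm i i) τ
  have hs' : (1 : ℝ) ≤ s := by exact_mod_cast hs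
  have hsm' : (s : ℝ) ≤ m i := by exact_mod_cast hsm
  have hzΔ : Δ z = 0 := hΔ0 z s hz0 (by rw [abs_le]; constructor <;> linarith)
  have hφ : Continuous fun t : ℝ => Δ (z + t • P.root i + τ) - Δ (z + t • P.root i) := by
    refine Continuous.sub ?_ (hΔ z _).continuous
    simp_rw [add_right_comm z]
    exact (hΔ (z + τ) _).continuous
  -- For s = 1 and τ = -α the coefficient has a simple pole. But z - α = s_α z, so antisymmetry
  -- makes the increment of Δ an even function of t vanishing at 0, hence of vanishing derivative,
  -- which beats the pole.
  by_cases hspec : s = 1 ∧ P.toLinearMap τ (P.coroot i) = -2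
  · obtain ⟨rfl, h2⟩ := hspec
    have hτi : τ = -P.root i := by
      rcases hsmall.cases i with h | h | h | h | h
      all_goals first | exact h.2 | (exfalso; linarith [h.1]) | (exfalso; linarith)
    have hc : ∀ h : ℝ → ℝ, Continuous h → ContinuousAt (fun u => qbr L (h u)) 0 :=
      fun h hh => (continuous_qbr.comp hh).continuousAt
    have hk : ContinuousAt (fun t : ℝ => g t * (qbr L (-(1 + 2 * t) - m i) / qbr L (-(1 + 2 * t)) *
        qbr L (-(1 + 2 * t) - m i + 1))) 0 := by
      refine hg.mul (((hc _ (by fun_prop)).div (hc _ (by fun_prop)) ?_).mul (hc _ (by fun_prop)))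
      exact hL.qbr_ne_zero (-1) (by simp) (by norm_num)
    let E : ℝ → ℂ := fun t => Δ (z + t • P.root i + τ) - Δ (z + t • P.root i)
    have hE : E = fun t => -Δ (z + (-t) • P.root i) - Δ (z + t • P.root i) := by
      funext t
      simp only [E]
      rw [← hΔs, reflection_line, neg_neg]
      congr 2
      have : P.reflection i z = z - P.root i := by
        rw [P.reflection_apply, show P.coroot' i z = 1 by simpa using hz0, one_smul]
      rw [this, hτi]
      abel
    have hE0 : E 0 = 0 := by simp [hE, hzΔ]
    have hEd : HasDerivAt E 0 0 := by
      obtain ⟨e, h3⟩ : ∃ e, HasDerivAt (fun t : ℝ => Δ (z + t • P.root i)) e 0 :=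
        ⟨_, (hΔ z (P.root i) 0).hasDerivAt⟩
      have h4 : HasDerivAt (fun t : ℝ => Δ (z + (-t) • P.root i)) ((-1 : ℝ) • e) 0 :=
        HasDerivAt.scomp (h := fun t : ℝ => -t) (g₁ := fun t : ℝ => Δ (z + t • P.root i))
          (0 : ℝ) (by rwa [neg_zero]) (hasDerivAt_neg (0 : ℝ))
      have h5 := h4.neg.sub h3
      rw [neg_smul, one_smul, neg_neg, sub_self] at h5
      rw [hE]
      exact h5
    have hq2 : HasDerivAt (fun t : ℝ => qbr L (-(2 * t))) ((1 + 1) * (((-2 : ℝ) : ℂ) * L)) 0 := by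
      have h3 := hasDerivAt_qbr (L := L) 0 (-2) 0
      simp only [zero_add, mul_zero, neg_zero, qpow_zero] at h3
      simpa only [neg_mul] using h3
    have hquot : Tendsto (fun t => E t / qbr L (-(2 * t))) (𝓝[≠] 0) (𝓝 0) := by
      have h3 := hasDerivAt_iff_tendsto_slope_zero.1 hEd
      have h4 := hasDerivAt_iff_tendsto_slope_zero.1 hq2
      have h5 := h3.div h4 (mul_ne_zero (by norm_num) (mul_ne_zero (by norm_num) hL.ne_zero))
      rw [zero_div] at h5
      refine h5.congr' ?_
      filter_upwards [self_mem_nhdsWithin] with t ht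
      have ht' : (t : ℂ) ≠ 0 := by exact_mod_cast ht
      simp only [Pi.div_apply, zero_add, hE0, sub_zero, mul_zero, neg_zero, qbr_zero,
        Complex.real_smul, Complex.ofReal_inv]
      rw [mul_div_mul_left _ _ (inv_ne_zero ht')]
    have h6 := (hk.tendsto.mono_left nhdsWithin_le_nhds).mul hquot
    rw [mul_zero] at h6
    refine h6.congr' ?_
    filter_upwards with t
    rw [hg', h2, hz0, pairFactor_neg_two, Int.cast_one,
      show -(1 + 2 * t) + 1 = -(2 * t) by ring]
    simp only [E]
    ring
  · have h1 : ContinuousAt (fun t : ℝ => macdonaldCoeff P m L τ (z + t • P.root i) *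
        (Δ (z + t • P.root i + τ) - Δ (z + t • P.root i))) 0 := by
      simp_rw [hg']
      refine (hg.mul (continuousAt_pairFactor_line ?_)).mul hφ.continuousAt
      rw [hz0]
      refine continuousAt_pairFactor (hL.qbr_ne_zero s rfl (by omega)) (fun _ => ?_) fun h => ?_
      · exact hL.qbr_ne_zero (s + 1) (by push_cast; ring) (by omega)
      · exact hL.qbr_ne_zero (-s + 1) (by push_cast; ring) (by
          intro h'
          exact hspec ⟨by omega, h⟩)
    have h3 := h1.tendsto
    have h4 : macdonaldCoeff P m L τ (z + (0 : ℝ) • P.root i) *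
        (Δ (z + (0 : ℝ) • P.root i + τ) - Δ (z + (0 : ℝ) • P.root i)) = 0 := by
      rw [hg', hz0, mul_zero, add_zero, zero_smul, add_zero, hzΔ, sub_zero]
      rcases pairFactor_eq_zero (L := L) hs hsm (hsmall.cases' i) with h | h
      · rw [h, mul_zero, zero_mul]
      · obtain ⟨n, hn⟩ := hsmall.isWeight i
        rw [hΔ0 (z + τ) (s + n) (by
          rw [map_add, LinearMap.add_apply, hz0, hn]; push_cast; ring) (by
          push_cast
          rwa [← hn]), mul_zero]
    rw [h4] at h3
    exact h3.mono_left nhdsWithin_le_nhds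

end Limits

end BakerAkhiezer

end

noncomputable section

namespace BakerAkhiezer

open scoped Classical Topology
open Filter AddMonoidAlgebra

/-! ### The Macdonald operator over a common denominator -/

section Fractions

variable {ι M N : Type*} [Fintype ι] [AddCommGroup M] [Module ℝ M] [AddCommGroup N] [Module ℝ N]
variable (P : RootPairing ι ℝ M N) (m : ι → ℕ) (L : ℂ)

/-- The index set of the denominators of the Macdonald operator. -/
def poles : Finset (ι × ℕ) := (Finset.univ.filter fun i => 0 < m i) ×ˢ Finset.range 2

/-- A common denominator of the coefficients of the Macdonald operator. -/
def denom : AddMonoidAlgebra ℂ N := ∏ p ∈ poles m, binomial P L p.1 p.2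

/-- The factor at a coroot of the numerator of a coefficient of the Macdonald operator. -/
def numFactor (τ : M) (i : ι) : AddMonoidAlgebra ℂ N :=
  if P.toLinearMap τ (P.coroot i) = 2 then
    qpow L (-2 * m i) • (binomial P L i (-m i) * binomial P L i (1 - m i))
  else if 0 < P.toLinearMap τ (P.coroot i) then
    qpow L (-m i) • (binomial P L i (-m i) * binomial P L i 1)
  else binomial P L i 0 * binomial P L i 1

/-- The numerator of a coefficient of the Macdonald operator. -/
def num (τ : M) : AddMonoidAlgebra ℂ N := ∏ i with 0 < m i, numFactor P m L τ i

variable {P m L}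

lemma denom_eq_prod : denom P m L =
    ∏ i with 0 < m i, (binomial P L i 0 * binomial P L i 1) := by
  rw [denom, poles, Finset.prod_product]
  refine Finset.prod_congr rfl fun i _ => ?_
  simp [Finset.prod_range_succ]

omit [Fintype ι] in
-- The scalar powers of q in `numFactor` compensate the prefactors by which binomials differ from
-- brackets.
lemma evalAt_numFactor {τ z : M} {i : ι}
    (h0 : qbr L (P.toLinearMap z (P.coroot i)) ≠ 0)
    (h1 : qbr L (P.toLinearMap z (P.coroot i) + 1) ≠ 0) :
    evalAt P L z (numFactor P m L τ i) = evalAt P L z (binomial P L i 0 * binomial P L i 1) *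
      factor L (P.toLinearMap τ (P.coroot i)) (m i) (P.toLinearMap z (P.coroot i)) := by
  set u := P.toLinearMap z (P.coroot i)
  set n := P.toLinearMap τ (P.coroot i)
  have e1 : qpow L (u + m i) = qpow L u * qpow L (m i) := qpow_add _ _
  have e2 : qpow L (u - -(m i : ℝ)) = qpow L u * qpow L (m i) := by rw [sub_neg_eq_add, e1]
  have e3 : qpow L (u - (1 - m i)) = qpow L (u - 1) * qpow L (m i) := by
    rw [← qpow_add]; congr 1; ring
  have e4 : qpow L (-m i) = (qpow L (m i))⁻¹ := qpow_neg _
  have e6 : qpow L (m i) ≠ 0 := qpow_ne_zero _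
  have e5 : qpow L (-2 * m i) = qpow L (-m i) * qpow L (-m i) := by
    rw [← qpow_add]; congr 1; ring
  rw [numFactor, factor]
  by_cases h2 : n = 2
  · have hpos : 0 < n := by rw [h2]; norm_num
    rw [if_pos h2, if_pos h2, if_pos hpos, map_smul, map_mul, map_mul, evalAt_binomial,
      evalAt_binomial, evalAt_binomial, evalAt_binomial, e2, e3, e5, smul_eq_mul, sub_zero,
      add_zero, ← sub_eq_add_neg, show u + (1 - (m i : ℝ)) = u - m i + 1 by ring]
    rw [e4]
    field_simp
    simp only [u]
    ring
  · rw [if_neg h2, if_neg h2, mul_one]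
    by_cases hpos : 0 < n
    · rw [if_pos hpos, if_pos hpos, map_smul, map_mul, map_mul, evalAt_binomial,
        evalAt_binomial, evalAt_binomial, e2, smul_eq_mul, sub_zero, add_zero, ← sub_eq_add_neg]
      rw [e4]
      field_simp
      simp only [u]
      ring
    · rw [if_neg hpos, if_neg hpos, mul_one]

/-- Roots of multiplicity zero drop out, so that only coroots of the lattice enter numerators and
denominators. -/
lemma factor_zero_mult {n u : ℝ} (h0 : qbr L u ≠ 0) (h1 : qbr L (u + 1) ≠ 0) :
    factor L n 0 u = 1 := by
  simp [factor, div_self h0, div_self h1]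

lemma evalAt_num {τ z : M} (hz : z ∈ nonsingularPoints P L) :
    evalAt P L z (num P m L τ) = evalAt P L z (denom P m L) * macdonaldCoeff P m L τ z := by
  rw [num, denom_eq_prod, map_prod, map_prod, macdonaldCoeff_eq_prod,
    ← Finset.prod_filter_mul_prod_filter_not Finset.univ (fun i => 0 < m i)
      fun i => factor L (P.toLinearMap τ (P.coroot i)) (m i) (P.toLinearMap z (P.coroot i)),
    Finset.prod_eq_one (s := Finset.univ.filter fun i => ¬ 0 < m i), mul_one,
    ← Finset.prod_mul_distrib]
  · exact Finset.prod_congr rfl fun i _ => evalAt_numFactor (hz i).1 (hz i).2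
  · intro i hi
    have : m i = 0 := by simpa using hi
    rw [this]
    exact factor_zero_mult (hz i).1 (hz i).2

lemma evalAt_binomial_ne_zero {z : M} (hz : z ∈ nonsingularPoints P L) {p : ι × ℕ}
    (hp : p ∈ poles m) : evalAt P L z (binomial P L p.1 p.2) ≠ 0 := by
  rw [evalAt_binomial]
  refine mul_ne_zero (qpow_ne_zero _) ?_
  have h := Finset.mem_range.1 (Finset.mem_product.1 hp).2
  have : p.2 = 0 ∨ p.2 = 1 := by omega
  rcases this with h | h
  · simpa [h] using (hz p.1).1
  · simpa [h] using (hz p.1).2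

omit [Fintype ι] in
lemma binomial_mem {i : ι} (hi : 0 < m i) (k : ℝ) :
    binomial P L i k ∈ latticeAlgebra (corootLattice P m) :=
  binomial_mem_latticeAlgebra (coroot_mem_corootLattice hi) k

lemma denom_mem : denom P m L ∈ latticeAlgebra (corootLattice P m) :=
  Subalgebra.prod_mem _ fun _ hp =>
    binomial_mem (Finset.mem_filter.1 (Finset.mem_product.1 hp).1).2 _

lemma num_mem (τ : M) : num P m L τ ∈ latticeAlgebra (corootLattice P m) := by
  refine Subalgebra.prod_mem _ fun i hi => ?_
  have h := fun k => binomial_mem (P := P) (L := L) (Finset.mem_filter.1 hi).2 k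
  rw [numFactor]
  split_ifs
  · exact Subalgebra.smul_mem _ (Subalgebra.mul_mem _ (h _) (h _)) _
  · exact Subalgebra.smul_mem _ (Subalgebra.mul_mem _ (h _) (h _)) _
  · exact Subalgebra.mul_mem _ (h _) (h _)

omit [Fintype ι] in
lemma expFun_add_arg (y : N) (F : AddMonoidAlgebra ℂ N) (z τ : M) :
    expFun P L y F (z + τ) =
      qpow L (2 * P.toLinearMap z y) *
        evalAt P L z (qpow L (2 * P.toLinearMap τ y) • translate P L τ F) := by
  rw [expFun, map_smul, evalAt_translate, map_add, LinearMap.add_apply, mul_add, qpow_add,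
    smul_eq_mul, mul_assoc]

variable [P.IsRootSystem]

variable (m L) in
/-- The product of the common denominator with the value of the Macdonald operator. -/
def opNum (b : P.Base) (ω : M) (y : N) (F : AddMonoidAlgebra ℂ N) : AddMonoidAlgebra ℂ N :=
  ∑ τ ∈ weylOrbit P ω,
      num P m L τ * (qpow L (2 * P.toLinearMap τ y) • translate P L τ F - F) +
    (∑ τ ∈ weylOrbit P ω, qpow L (-2 * P.toLinearMap τ (rhoCheck b m))) • (denom P m L * F)

lemma expFun_opNum (b : P.Base) (ω : M) (y : N) (F : AddMonoidAlgebra ℂ N) {z : M}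
    (hz : z ∈ nonsingularPoints P L) :
    expFun P L y (opNum m L b ω y F) z =
      evalAt P L z (denom P m L) * macdonaldOp b m L ω (expFun P L y F) z := by
  rw [expFun, opNum, map_add, map_sum, map_smul, macdonaldOp_apply, mul_add, mul_add,
    Finset.mul_sum, Finset.mul_sum]
  congr 1
  · refine Finset.sum_congr rfl fun τ _ => ?_
    rw [map_mul, map_sub, evalAt_num hz, expFun_add_arg, expFun]
    ring
  · rw [map_mul, expFun, smul_eq_mul]
    ring

lemma opNum_mem (b : P.Base) (ω : M) (y : N) {F : AddMonoidAlgebra ℂ N}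
    (hF : F ∈ latticeAlgebra (corootLattice P m)) :
    opNum m L b ω y F ∈ latticeAlgebra (corootLattice P m) := by
  refine Subalgebra.add_mem _ (Subalgebra.sum_mem _ fun τ _ => ?_)
    (Subalgebra.smul_mem _ (Subalgebra.mul_mem _ denom_mem hF) _)
  exact Subalgebra.mul_mem _ (num_mem τ) (Subalgebra.sub_mem _
    (Subalgebra.smul_mem _ (translate_mem_latticeAlgebra hF τ) _) hF)

end Fractions

/-! ### Generic points of a coroot hyperplane -/

section Genericity

variable {ι M N : Type*} [Fintype ι] [AddCommGroup M] [Module ℝ M] [AddCommGroup N] [Module ℝ N]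
variable {P : RootPairing ι ℝ M N} {L : ℂ}

lemma countable_not_genericOff (hL : L ≠ 0) (i : ι) (z : M) {v : M}
    (hv : ∀ j, j ≠ i → j ≠ opp P i → P.toLinearMap v (P.coroot j) ≠ 0) :
    {t : ℝ | ¬ IsGenericOff P L i (z + t • v)}.Countable := by
  have : {t : ℝ | ¬ IsGenericOff P L i (z + t • v)} ⊆
      ⋃ j ∈ {j | j ≠ i ∧ j ≠ opp P i}, ⋃ k : ℤ,
      {t : ℝ | qpow L (2 * (P.toLinearMap z (P.coroot j) + k) +
        2 * P.toLinearMap v (P.coroot j) * t) = 1} := by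
    intro t ht
    simp only [IsGenericOff, Set.mem_ofPred_eq, not_forall, not_not, qbr_eq_zero_iff] at ht
    obtain ⟨j, h1, h2, k, h⟩ := ht
    simp only [Set.mem_iUnion, Set.mem_ofPred_eq]
    refine ⟨j, ⟨h1, h2⟩, k, ?_⟩
    rw [← h]
    congr 1
    simp
    ring
  refine Set.Countable.mono this ?_
  refine Set.Countable.biUnion (Set.to_countable _) fun j hj => Set.countable_iUnion fun k => ?_
  exact countable_qpow_eq_one hL _ (mul_ne_zero two_ne_zero (hv j hj.1 hj.2))

lemma eventually_qbr_int_add_ne_zero (hL : NotRootOfUnity L) (n : ℤ) :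
    ∀ᶠ t in 𝓝[≠] (0 : ℝ), qbr L (n + 2 * t) ≠ 0 := by
  by_cases hn : n = 0
  · filter_upwards [(tendsto_const_mul_punctured two_ne_zero).eventually
      (eventually_qbr_ne_zero hL.ne_zero)] with t ht
    simpa [hn] using ht
  · have hc : Continuous fun t : ℝ => qbr L (n + 2 * t) := continuous_qbr.comp (by fun_prop)
    have := hc.continuousAt.eventually_ne (x := 0) (y := 0) (by
      simpa using hL.qbr_int_ne_zero hn)
    exact this.filter_mono nhdsWithin_le_nhds

lemma eventually_mem_nonsingularPoints (hL : NotRootOfUnity L) {i : ι} {z : M}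
    (hz : IsGenericOff P L i z) {s : ℤ} (hs : P.toLinearMap z (P.coroot i) = s) :
    ∀ᶠ t in 𝓝[≠] (0 : ℝ), z + t • P.root i ∈ nonsingularPoints P L := by
  simp only [nonsingularPoints, Set.mem_ofPred_eq]
  rw [eventually_all]
  intro j
  by_cases h1 : j = i
  · subst h1
    filter_upwards [eventually_qbr_int_add_ne_zero hL s,
      eventually_qbr_int_add_ne_zero hL (s + 1)] with t h2 h3
    rw [pair_line, hs]
    refine ⟨h2, ?_⟩
    convert h3 using 2
    push_cast
    ring
  by_cases h2 : j = opp P i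
  · subst h2
    filter_upwards [eventually_qbr_int_add_ne_zero hL s,
      eventually_qbr_int_add_ne_zero hL (s - 1)] with t h2 h3
    rw [coroot_opp, map_neg, pair_line, hs]
    refine ⟨by rwa [qbr_neg, neg_ne_zero], ?_⟩
    rw [← neg_ne_zero, ← qbr_neg]
    convert h3 using 2
    push_cast
    ring
  · have hc : ∀ n : ℤ, ∀ᶠ t in 𝓝[≠] (0 : ℝ),
        qbr L (P.toLinearMap (z + t • P.root i) (P.coroot j) + n) ≠ 0 := fun n => by
      have hc : Continuous fun t : ℝ =>
          qbr L (P.toLinearMap (z + t • P.root i) (P.coroot j) + n) :=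
        continuous_qbr.comp ((pair_continuous_line P z _ _).add continuous_const)
      have := hc.continuousAt.eventually_ne (x := 0) (y := 0) (by
        simpa using hz j h1 h2 n)
      exact this.filter_mono nhdsWithin_le_nhds
    filter_upwards [hc 0, hc 1] with t h3 h4
    exact ⟨by simpa using h3, by simpa using h4⟩

variable [P.IsReduced]

/-- A direction inside the hyperplane of `α^∨` along which the other hyperplanes are crossed. -/
lemma exists_transversal (i : ι) : ∃ v : M, P.toLinearMap v (P.coroot i) = 0 ∧
    ∀ j, j ≠ i → j ≠ opp P i → P.toLinearMap v (P.coroot j) ≠ 0 := by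
  -- The coroots projected along α_i^∨; they are nonzero because in a reduced system only ±α_i^∨ is
  -- proportional to α_i^∨.
  let w : ι → N := fun j =>
    P.coroot j - (P.toLinearMap (P.root i) (P.coroot j) / 2) • P.coroot i
  obtain ⟨v, hv⟩ := exists_pair_ne_zero_of_finite P
    (S := w '' {j | j ≠ i ∧ j ≠ opp P i}) (Set.toFinite _) (by
      rintro _ ⟨j, ⟨h1, h2⟩, rfl⟩ h0
      have h3 : ¬ LinearIndependent ℝ ![P.coroot i, P.coroot j] := by
        rw [LinearIndependent.pair_iff]
        push Not
        refine ⟨-(P.toLinearMap (P.root i) (P.coroot j) / 2), 1, ?_, fun _ => one_ne_zero⟩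
        rw [← h0]
        simp only [w]
        module
      rcases RootPairing.IsReduced.eq_or_eq_neg (P := P.flip) i j h3 with h | h
      · exact h1 (P.coroot.injective h).symm
      · refine h2 (P.coroot.injective ?_)
        have h4 : P.coroot i = -P.coroot j := h
        rw [coroot_opp, h4, neg_neg])
  refine ⟨v - (P.toLinearMap v (P.coroot i) / 2) • P.root i, ?_, fun j h1 h2 => ?_⟩
  · simp
  · have := hv _ ⟨j, ⟨h1, h2⟩, rfl⟩
    simp only [w, map_sub, map_smul, LinearMap.sub_apply, LinearMap.smul_apply, smul_eq_mul]
      at this ⊢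
    intro h
    apply this
    linear_combination h

end Genericity

end BakerAkhiezer

end

noncomputable section

namespace BakerAkhiezer

open scoped Classical Topology
open Filter AddMonoidAlgebra

/-! ### The Macdonald operator preserves quasi-invariants -/

section Preservation

variable {ι M N : Type*} [Fintype ι] [AddCommGroup M] [Module ℝ M] [AddCommGroup N] [Module ℝ N]
variable {P : RootPairing ι ℝ M N} {L : ℂ} {m : ι → ℕ}

/-- A continuous function on a hyperplane that vanishes at its generic points is zero. -/
lemma eq_of_forall_genericOff [P.IsReduced] (hL : L ≠ 0) {i : ι} {c : ℝ} {f g : M → ℂ}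
    (hf : ∀ z v, Continuous fun t : ℝ => f (z + t • v))
    (hg : ∀ z v, Continuous fun t : ℝ => g (z + t • v))
    (h : ∀ z, P.toLinearMap z (P.coroot i) = c → IsGenericOff P L i z → f z = g z)
    {z : M} (hz : P.toLinearMap z (P.coroot i) = c) : f z = g z := by
  obtain ⟨v, hv, hv'⟩ := exists_transversal (P := P) i
  have := eq_of_eq_off_countable (hf z v) (hg z v) (countable_not_genericOff hL i z hv')
    (fun t ht => h _ (by simp [hv, hz]) (by simpa using ht))
  simpa using congrFun this 0

omit [Fintype ι] in
lemma continuous_expFun_line (y : N) (F : AddMonoidAlgebra ℂ N) (z v : M) :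
    Continuous fun t : ℝ => expFun P L y F (z + t • v) :=
  (differentiable_expFun_line y F z v).continuous

omit [Fintype ι] in
lemma reflection_opp (i : ι) : P.reflection (opp P i) = P.reflection i := by
  ext z
  rw [P.reflection_apply, P.reflection_apply, root_opp,
    show P.coroot' (opp P i) z = -P.coroot' i z by
      change P.toLinearMap z (P.coroot (opp P i)) = -P.toLinearMap z (P.coroot i)
      rw [coroot_opp, map_neg], smul_neg, neg_smul, neg_neg]

variable [P.IsRootSystem] [P.IsCrystallographic] [P.IsReduced]

omit [P.IsCrystallographic] [P.IsReduced] in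
lemma macdonaldOp_eq_differenceSum (b : P.Base) (ω : M) (f : M → ℂ) (z : M) :
    macdonaldOp b m L ω f z = differenceSum P m L ω f z +
      (∑ τ ∈ weylOrbit P ω, qpow L (-2 * P.toLinearMap τ (rhoCheck b m))) * f z :=
  macdonaldOp_apply b ω f z

omit [P.IsReduced] in
lemma tendsto_qbr_mul_macdonaldOp (hL : NotRootOfUnity L)
    (hm : ∀ i j, m (P.reflectionPerm i j) = m j) (b : P.Base) {ω : M}
    (hω : IsMinuscule P ω ∨ IsQuasiminuscule P ω) {f : M → ℂ}
    (hf : ∀ z v, Continuous fun t : ℝ => f (z + t • v)) (hq : IsQuasiInvariant P m f)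
    {p : ι × ℕ} (hp : p ∈ poles m) {z : M} (hz : IsGenericOff P L p.1 z)
    (hz0 : P.toLinearMap z (P.coroot p.1) = -p.2) :
    Tendsto (fun t : ℝ => qbr L (2 * t) * macdonaldOp b m L ω f (z + t • P.root p.1))
      (𝓝[≠] 0) (𝓝 0) := by
  have h1 : Tendsto (fun t : ℝ => qbr L (2 * t) * differenceSum P m L ω f (z + t • P.root p.1))
      (𝓝[≠] 0) (𝓝 0) := by
    obtain ⟨hp1, hp2⟩ := Finset.mem_product.1 hp
    have h2 := Finset.mem_range.1 hp2
    have : p.2 = 0 ∨ p.2 = 1 := by omega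
    rcases this with h | h
    · exact tendsto_qbr_mul_differenceSum hL hm hω hf hq hz (by simp [hz0, h])
    · exact tendsto_qbr_add_one_mul_differenceSum hL hm hω hf hq (Finset.mem_filter.1 hp1).2 hz
        (by simp [hz0, h])
  have h3 : Tendsto (fun t : ℝ => qbr L (2 * t) *
      ((∑ τ ∈ weylOrbit P ω, qpow L (-2 * P.toLinearMap τ (rhoCheck b m))) *
        f (z + t • P.root p.1))) (𝓝[≠] 0) (𝓝 0) := by
    have h4 : Continuous fun t : ℝ => qbr L (2 * t) *
      ((∑ τ ∈ weylOrbit P ω, qpow L (-2 * P.toLinearMap τ (rhoCheck b m))) *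
        f (z + t • P.root p.1)) :=
      (continuous_qbr.comp (by fun_prop)).mul (continuous_const.mul (hf _ _))
    have h5 := h4.tendsto 0
    rw [mul_zero, qbr_zero, zero_mul] at h5
    exact h5.mono_left nhdsWithin_le_nhds
  have h6 := h1.add h3
  rw [add_zero] at h6
  refine h6.congr fun t => ?_
  rw [macdonaldOp_eq_differenceSum, mul_add]

/-- Division of the numerator by the denominators, one at a time. -/
lemma exists_expFun_eq_of_mul (hL : NotRootOfUnity L)
    (hm : ∀ i j, m (P.reflectionPerm i j) = m j) (b : P.Base) {ω : M}
    (hω : IsMinuscule P ω ∨ IsQuasiminuscule P ω) {f : M → ℂ}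
    (hf : ∀ z v, Continuous fun t : ℝ => f (z + t • v)) (hq : IsQuasiInvariant P m f) (y : N)
    (T : Finset (ι × ℕ)) (hT : T ⊆ poles m) {G : AddMonoidAlgebra ℂ N}
    (hG : G ∈ latticeAlgebra (corootLattice P m))
    (h : ∀ z ∈ nonsingularPoints P L, expFun P L y G z =
      (∏ p ∈ T, evalAt P L z (binomial P L p.1 p.2)) * macdonaldOp b m L ω f z) :
    ∃ H ∈ latticeAlgebra (corootLattice P m), ∀ z ∈ nonsingularPoints P L,
      expFun P L y H z = macdonaldOp b m L ω f z := by
  induction T using Finset.induction_on generalizing G with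
  | empty => exact ⟨G, hG, fun z hz => by simpa using h z hz⟩
  | insert p T hpT ih =>
    have hp := hT (Finset.mem_insert_self p T)
    have hpi : 0 < m p.1 := (Finset.mem_filter.1 (Finset.mem_product.1 hp).1).2
    -- Near a generic point of the hyperplane the factor of p is [2t] times a unit, and [2t] D f
    -- tends to 0. Hence G vanishes there and is divisible by the binomial.
    have hvan : ∀ z, P.toLinearMap z (P.coroot p.1) = -p.2 → expFun P L y G z = 0 := by
      intro z hz
      refine eq_of_forall_genericOff (g := fun _ => 0) hL.ne_zero (continuous_expFun_line y G)
        (fun _ _ => continuous_const) (fun z hz hgen => ?_) hz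
      have h1 := (continuous_expFun_line (P := P) (L := L) y G z (P.root p.1)).tendsto 0
      rw [zero_smul, add_zero] at h1
      refine tendsto_nhds_unique (h1.mono_left (nhdsWithin_le_nhds (s := {0}ᶜ))) ?_
      have h2 := tendsto_qbr_mul_macdonaldOp hL hm b hω hf hq hp hgen hz
      have h3 : Continuous fun t : ℝ => (∏ p' ∈ T, evalAt P L (z + t • P.root p.1)
          (binomial P L p'.1 p'.2)) * qpow L (-p.2 + 2 * t - p.2) := by
        refine Continuous.mul (continuous_finsetProd _ fun p' _ =>
          (differentiable_evalAt_line _ _ _).continuous) (continuous_qpow.comp (by fun_prop))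
      have h4 := ((h3.tendsto 0).mono_left nhdsWithin_le_nhds).mul h2
      rw [mul_zero] at h4
      refine h4.congr' ?_
      filter_upwards [eventually_mem_nonsingularPoints hL hgen (s := -p.2) (by simpa using hz)]
        with t ht
      rw [h _ ht, Finset.prod_insert hpT, evalAt_binomial, pair_line, hz,
        show -(p.2 : ℝ) + 2 * t + p.2 = 2 * t by ring]
      ring
    obtain ⟨G', hG', hGG'⟩ := exists_eq_binomial_mul (P := P) hL.ne_zero
      (coroot_mem_corootLattice hpi) (fun c hc => exists_int_of_smul_coroot_mem b hc) hG p.2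
      (fun z hz => (mul_eq_zero.1 (hvan z hz)).resolve_left (qpow_ne_zero _))
    refine ih ((Finset.subset_insert _ _).trans hT) hG' fun z hz => ?_
    have h1 := h z hz
    rw [Finset.prod_insert hpT, hGG', expFun, map_mul] at h1
    refine mul_left_cancel₀ (evalAt_binomial_ne_zero hz hp) ?_
    rw [expFun]
    linear_combination h1

omit [Fintype ι] [P.IsRootSystem] [P.IsCrystallographic] [P.IsReduced] in
lemma reflection_mem_nonsingularPoints {z : M} (hz : z ∈ nonsingularPoints P L) (i : ι) :
    P.reflection i z ∈ nonsingularPoints P L := by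
  intro j
  rw [← pair_coroot_reflectionPerm]
  exact hz _

/-- The Macdonald operator preserves quasi-invariance. -/
lemma isQuasiInvariant_of_eq_macdonaldOp (hL : NotRootOfUnity L)
    (hm : ∀ i j, m (P.reflectionPerm i j) = m j) (b : P.Base) {ω : M}
    (hω : IsMinuscule P ω ∨ IsQuasiminuscule P ω) {f : M → ℂ}
    (hf : ∀ z v, Differentiable ℝ fun t : ℝ => f (z + t • v)) (hq : IsQuasiInvariant P m f)
    {g : M → ℂ} (hg : ∀ z v, Continuous fun t : ℝ => g (z + t • v))
    (h : ∀ z ∈ nonsingularPoints P L, g z = macdonaldOp b m L ω f z) :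
    IsQuasiInvariant P m g := by
  have hpos : ∀ i (n : ℤ), 1 ≤ n → n ≤ m i → ∀ z, P.toLinearMap z (P.coroot i) = n →
      g (P.reflection i z) = g z := by
    intro i n h1 hn z hz
    have hgs : ∀ z v, Continuous fun t : ℝ => g (P.reflection i (z + t • v)) := fun z v => by
      simp_rw [map_add, map_smul]
      exact hg _ _
    refine eq_of_forall_genericOff (f := fun z => g (P.reflection i z)) hL.ne_zero hgs hg
      (fun z hz hgen => ?_) hz
    -- The difference part of D is handled by this limit, its constant term by the quasi-invariance
    -- of f itself.
    have h2 := tendsto_differenceSum_sub_reflection hL hm hω hf hq h1 hn hgen hz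
    have hfs : f (P.reflection i z) = f z := hq i n (by rw [abs_le]; omega) z hz
    let c : ℂ := ∑ τ ∈ weylOrbit P ω, qpow L (-2 * P.toLinearMap τ (rhoCheck b m))
    have h3 : Tendsto (fun t : ℝ => c * (f (z + t • P.root i) -
        f (P.reflection i (z + t • P.root i)))) (𝓝[≠] 0) (𝓝 0) := by
      have h4 : Continuous fun t : ℝ => c * (f (z + t • P.root i) -
          f (P.reflection i (z + t • P.root i))) := by
        refine continuous_const.mul ((hf _ _).continuous.sub ?_)
        simp_rw [map_add, map_smul]
        exact (hf _ _).continuous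
      have h5 := h4.tendsto 0
      rw [zero_smul, add_zero, hfs, sub_self, mul_zero] at h5
      exact h5.mono_left nhdsWithin_le_nhds
    have h6 : Tendsto (fun t : ℝ => g (z + t • P.root i) - g (P.reflection i (z + t • P.root i)))
        (𝓝[≠] 0) (𝓝 0) := by
      have h7 := h2.add h3
      rw [add_zero] at h7
      refine h7.congr' ?_
      filter_upwards [eventually_mem_nonsingularPoints hL hgen hz] with t ht
      rw [h _ ht, h _ (reflection_mem_nonsingularPoints ht i), macdonaldOp_eq_differenceSum,
        macdonaldOp_eq_differenceSum]
      ring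
    have h8 : Tendsto (fun t : ℝ => g (z + t • P.root i) -
        g (P.reflection i (z + t • P.root i))) (𝓝 0) _ :=
      ((hg z (P.root i)).sub (hgs z (P.root i))).tendsto 0
    simp only [Pi.sub_apply, zero_smul, add_zero] at h8
    have h9 := tendsto_nhds_unique (h8.mono_left nhdsWithin_le_nhds) h6
    exact (sub_eq_zero.1 h9).symm
  intro i n hn z hz
  rcases lt_trichotomy n 0 with h0 | h0 | h0
  · rw [abs_of_neg h0] at hn
    have h1 := hpos (opp P i) (-n) (by omega) (by rwa [opp, hm]) z (by
      rw [coroot_opp, map_neg, hz]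
      simp)
    rwa [reflection_opp] at h1
  · rw [reflection_eq_self (by simp [hz, h0])]
  · rw [abs_of_pos h0] at hn
    exact hpos i n (by omega) hn z hz

variable (P m L) in
/-- The quasi-invariant exponential polynomials with exponents in `y + Λ`, where `Λ` is the
lattice generated by the coroots of nonzero multiplicity. -/
def quasiInvariants (y : N) : Submodule ℂ (AddMonoidAlgebra ℂ N) where
  carrier := {F | F ∈ latticeAlgebra (corootLattice P m) ∧
    IsQuasiInvariant P m (expFun P L y F)}
  zero_mem' := ⟨Subalgebra.zero_mem _, fun i n _ z _ => by simp [expFun]⟩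
  add_mem' := by
    rintro F G ⟨h1, h2⟩ ⟨h3, h4⟩
    refine ⟨Subalgebra.add_mem _ h1 h3, fun i n hn z hz => ?_⟩
    have h5 := h2 i n hn z hz
    have h6 := h4 i n hn z hz
    simp only [expFun, map_add, mul_add] at h5 h6 ⊢
    rw [h5, h6]
  smul_mem' := by
    rintro c F ⟨h1, h2⟩
    refine ⟨Subalgebra.smul_mem _ h1 _, fun i n hn z hz => ?_⟩
    have h5 := h2 i n hn z hz
    simp only [expFun, map_smul, smul_eq_mul] at h5 ⊢
    linear_combination c * h5

/-- The Macdonald operator acts on quasi-invariant exponential polynomials. -/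
theorem exists_expFun_eq_macdonaldOp (hL : NotRootOfUnity L)
    (hm : ∀ i j, m (P.reflectionPerm i j) = m j) (b : P.Base) {ω : M}
    (hω : IsMinuscule P ω ∨ IsQuasiminuscule P ω) {y : N} {F : AddMonoidAlgebra ℂ N}
    (hF : F ∈ quasiInvariants P L m y) :
    ∃ H ∈ quasiInvariants P L m y,
      (∀ z ∈ nonsingularPoints P L,
        expFun P L y H z = macdonaldOp b m L ω (expFun P L y F) z) ∧
      denom P m L * H = opNum m L b ω y F := by
  obtain ⟨H, h1, h2⟩ := exists_expFun_eq_of_mul hL hm b hω (continuous_expFun_line y F) hF.2 y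
    (poles m) subset_rfl (opNum_mem b ω y hF.1) (fun z hz => by
      rw [expFun_opNum b ω y F hz, denom, map_prod])
  refine ⟨H, ⟨h1, isQuasiInvariant_of_eq_macdonaldOp hL hm b hω
    (differentiable_expFun_line y F) hF.2 (continuous_expFun_line y H) h2⟩, h2, ?_⟩
  refine eq_of_expFun_eq (P := P) hL.ne_zero y fun z hz => ?_
  have hz' := regularPoints_subset hz
  rw [expFun_opNum b ω y F hz', ← h2 z hz', expFun, expFun, map_mul]
  ring

end Preservation

end BakerAkhiezer

end

noncomputable section

namespace BakerAkhiezer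

open scoped Classical Topology
open Filter AddMonoidAlgebra

/-! ### Leading terms in the direction of a functional -/

section LeadingTerms

variable {ι M N : Type*} [AddCommGroup M] [Module ℝ M] [AddCommGroup N] [Module ℝ N]
variable (P : RootPairing ι ℝ M N)

/-- The exponents of `F` lie in the half space `(ξ, ·) ≤ B`. -/
def IsBelow (ξ : M) (F : AddMonoidAlgebra ℂ N) (B : ℝ) : Prop :=
  ∀ ν, F.coeff ν ≠ 0 → P.toLinearMap ξ ν ≤ B

/-- `v` is the unique highest exponent of `F` in the direction `ξ`, with coefficient `c`. -/
def IsTop (ξ : M) (F : AddMonoidAlgebra ℂ N) (v : N) (c : ℂ) : Prop :=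
  F.coeff v = c ∧ ∀ ν, F.coeff ν ≠ 0 → ν = v ∨ P.toLinearMap ξ ν < P.toLinearMap ξ v

variable {P} {ξ : M} {F G : AddMonoidAlgebra ℂ N} {v w : N} {c d : ℂ} {A B : ℝ}

omit [Module ℝ N] in
lemma exists_coeff_ne_zero_of_mul {μ : N} (h : (F * G).coeff μ ≠ 0) :
    ∃ a b, F.coeff a ≠ 0 ∧ G.coeff b ≠ 0 ∧ a + b = μ := by
  rw [coeff_mul] at h
  obtain ⟨a, ha, h1⟩ := Finset.exists_ne_zero_of_sum_ne_zero h
  obtain ⟨b, hb, h2⟩ := Finset.exists_ne_zero_of_sum_ne_zero h1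
  refine ⟨a, b, Finsupp.mem_support_iff.1 ha, Finsupp.mem_support_iff.1 hb, ?_⟩
  by_contra hab
  exact h2 (if_neg hab)

lemma IsTop.isBelow (h : IsTop P ξ F v c) : IsBelow P ξ F (P.toLinearMap ξ v) := by
  intro ν hν
  rcases h.2 ν hν with rfl | h1
  · exact le_rfl
  · exact h1.le

lemma IsBelow.mul (hF : IsBelow P ξ F A) (hG : IsBelow P ξ G B) : IsBelow P ξ (F * G) (A + B) := by
  intro μ hμ
  obtain ⟨a, b, ha, hb, rfl⟩ := exists_coeff_ne_zero_of_mul hμ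
  rw [map_add]
  exact add_le_add (hF a ha) (hG b hb)

lemma IsBelow.add (hF : IsBelow P ξ F A) (hG : IsBelow P ξ G A) : IsBelow P ξ (F + G) A := by
  intro μ hμ
  by_cases h : F.coeff μ = 0
  · refine hG μ fun h' => hμ ?_
    rw [coeff_add, Finsupp.add_apply, h, h', add_zero]
  · exact hF μ h

lemma IsBelow.smul (hF : IsBelow P ξ F A) (c : ℂ) : IsBelow P ξ (c • F) A := by
  intro μ hμ
  refine hF μ fun h => hμ ?_
  rw [coeff_smul_apply, h, smul_zero]

lemma IsBelow.sum {κ : Type*} {s : Finset κ} {F : κ → AddMonoidAlgebra ℂ N}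
    (h : ∀ k ∈ s, IsBelow P ξ (F k) A) : IsBelow P ξ (∑ k ∈ s, F k) A := by
  induction s using Finset.induction_on with
  | empty => intro μ hμ; simp at hμ
  | insert k s hk ih =>
    rw [Finset.sum_insert hk]
    exact (h k (Finset.mem_insert_self k s)).add
      (ih fun k' hk' => h k' (Finset.mem_insert_of_mem hk'))

lemma IsBelow.sub (hF : IsBelow P ξ F A) (hG : IsBelow P ξ G A) : IsBelow P ξ (F - G) A := by
  rw [sub_eq_add_neg, ← neg_one_smul ℂ]
  exact hF.add (hG.smul _)

lemma IsBelow.translate {L : ℂ} (hF : IsBelow P ξ F A) (τ : M) :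
    IsBelow P ξ (translate P L τ F) A :=
  fun ν hν => hF ν (right_ne_zero_of_mul hν)

/-- Every other pair of exponents with the same sum is excluded by comparing ξ-values. -/
lemma IsTop.coeff_mul_of_isBelow (hF : IsTop P ξ F v c) {μ : N}
    (hG : IsBelow P ξ G (P.toLinearMap ξ μ)) : (F * G).coeff (v + μ) = c * G.coeff μ := by
  rw [coeff_mul, Finsupp.sum, Finset.sum_eq_single v]
  · rw [Finsupp.sum, Finset.sum_eq_single μ]
    · simp [hF.1]
    · intro b _ hb
      refine if_neg fun h => hb (add_left_cancel h)
    · intro h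
      rw [Finsupp.notMem_support_iff.1 h]
      simp
  · intro a ha hav
    refine Finset.sum_eq_zero fun b hb => if_neg fun h => ?_
    have h1 := (hF.2 a (Finsupp.mem_support_iff.1 ha)).resolve_left hav
    have h2 := hG b (Finsupp.mem_support_iff.1 hb)
    have h3 := congrArg (P.toLinearMap ξ) h
    rw [map_add, map_add] at h3
    linarith
  · intro h
    rw [Finsupp.notMem_support_iff.1 h]
    simp

lemma IsTop.mul (hF : IsTop P ξ F v c) (hG : IsTop P ξ G w d) :
    IsTop P ξ (F * G) (v + w) (c * d) := by
  refine ⟨by rw [hF.coeff_mul_of_isBelow hG.isBelow, hG.1], fun μ hμ => ?_⟩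
  obtain ⟨a, b, ha, hb, rfl⟩ := exists_coeff_ne_zero_of_mul hμ
  rw [map_add, map_add]
  rcases hF.2 a ha with rfl | h1 <;> rcases hG.2 b hb with rfl | h2
  · exact Or.inl rfl
  all_goals right; linarith

lemma IsTop.one : IsTop P ξ (1 : AddMonoidAlgebra ℂ N) 0 1 := by
  refine ⟨by simp [AddMonoidAlgebra.one_def, coeff_single], fun ν hν => ?_⟩
  by_contra h
  push Not at h
  rw [AddMonoidAlgebra.one_def, coeff_single, Finsupp.single_eq_of_ne h.1] at hν
  exact hν rfl

lemma IsTop.prod {κ : Type*} {s : Finset κ} {F : κ → AddMonoidAlgebra ℂ N} {v : κ → N}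
    {c : κ → ℂ} (h : ∀ k ∈ s, IsTop P ξ (F k) (v k) (c k)) :
    IsTop P ξ (∏ k ∈ s, F k) (∑ k ∈ s, v k) (∏ k ∈ s, c k) := by
  induction s using Finset.induction_on with
  | empty => exact IsTop.one
  | insert k s hk ih =>
    rw [Finset.prod_insert hk, Finset.sum_insert hk, Finset.prod_insert hk]
    exact (h k (Finset.mem_insert_self k s)).mul
      (ih fun k' hk' => h k' (Finset.mem_insert_of_mem hk'))

/-- The leading coefficient is allowed to be zero. This makes the notion additive, so sums over τ
can be treated termwise even if leading terms cancel. -/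
lemma IsTop.add (hF : IsTop P ξ F v c) (hG : IsTop P ξ G v d) : IsTop P ξ (F + G) v (c + d) := by
  refine ⟨by rw [coeff_add, Finsupp.add_apply, hF.1, hG.1], fun μ hμ => ?_⟩
  by_cases h : F.coeff μ = 0
  · refine hG.2 μ fun h' => hμ ?_
    rw [coeff_add, Finsupp.add_apply, h, h', add_zero]
  · exact hF.2 μ h

lemma IsTop.smul (hF : IsTop P ξ F v c) (a : ℂ) : IsTop P ξ (a • F) v (a * c) := by
  refine ⟨by rw [coeff_smul_apply, hF.1, smul_eq_mul], fun μ hμ => hF.2 μ fun h => hμ ?_⟩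
  rw [coeff_smul_apply, h, smul_zero]

lemma IsTop.sub (hF : IsTop P ξ F v c) (hG : IsTop P ξ G v d) : IsTop P ξ (F - G) v (c - d) := by
  have := hF.add (hG.smul (-1))
  rwa [neg_one_smul, ← sub_eq_add_neg, neg_one_mul, ← sub_eq_add_neg] at this

lemma IsTop.zero : IsTop P ξ (0 : AddMonoidAlgebra ℂ N) v 0 :=
  ⟨by simp, fun ν hν => absurd (by simp) hν⟩

lemma IsTop.sum {κ : Type*} {s : Finset κ} {F : κ → AddMonoidAlgebra ℂ N} {c : κ → ℂ}
    (h : ∀ k ∈ s, IsTop P ξ (F k) v (c k)) : IsTop P ξ (∑ k ∈ s, F k) v (∑ k ∈ s, c k) := by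
  induction s using Finset.induction_on with
  | empty => exact IsTop.zero
  | insert k s hk ih =>
    rw [Finset.sum_insert hk, Finset.sum_insert hk]
    exact (h k (Finset.mem_insert_self k s)).add
      (ih fun k' hk' => h k' (Finset.mem_insert_of_mem hk'))

lemma IsTop.translate {L : ℂ} (hF : IsTop P ξ F v c) (τ : M) :
    IsTop P ξ (translate P L τ F) v (qpow L (2 * P.toLinearMap τ v) * c) :=
  ⟨by rw [coeff_translate, hF.1], fun ν hν => hF.2 ν (right_ne_zero_of_mul hν)⟩

/-- Cancellation of a factor with nonzero leading coefficient. -/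
lemma IsTop.isBelow_of_mul (hF : IsTop P ξ F v c) (hc : c ≠ 0)
    (h : IsBelow P ξ (F * G) (P.toLinearMap ξ v + B)) : IsBelow P ξ G B := by
  intro ν hν
  -- An exponent of G with largest ξ-value: its product with the leading term of F cannot cancel.
  obtain ⟨μ, hμ, hmax⟩ := Finset.exists_max_image G.coeff.support (fun μ => P.toLinearMap ξ μ)
    ⟨ν, Finsupp.mem_support_iff.2 hν⟩
  have h1 := hF.coeff_mul_of_isBelow (G := G) (μ := μ) fun b hb =>
    hmax b (Finsupp.mem_support_iff.2 hb)
  have h2 := h (v + μ) (by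
    rw [h1]
    exact mul_ne_zero hc (Finsupp.mem_support_iff.1 hμ))
  rw [map_add] at h2
  linarith [hmax ν (Finsupp.mem_support_iff.2 hν)]

lemma IsTop.of_mul (hF : IsTop P ξ F v c) (hc : c ≠ 0)
    (h : IsTop P ξ (F * G) (v + w) (c * d)) : IsTop P ξ G w d := by
  have hb : IsBelow P ξ G (P.toLinearMap ξ w) :=
    hF.isBelow_of_mul hc (by simpa using h.isBelow)
  refine ⟨?_, fun ν hν => ?_⟩
  · have h1 := hF.coeff_mul_of_isBelow hb
    rw [h.1] at h1
    exact (mul_left_cancel₀ hc h1).symm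
  · rcases (hb ν hν).lt_or_eq with h1 | h1
    · exact Or.inr h1
    · left
      have h2 := hF.coeff_mul_of_isBelow (G := G) (μ := ν) (by rwa [h1])
      rcases h.2 (v + ν) (by rw [h2]; exact mul_ne_zero hc hν) with h3 | h3
      · exact add_left_cancel h3
      · rw [map_add, map_add] at h3
        linarith

lemma isTop_single (v : N) (c : ℂ) : IsTop P ξ (single v c) v c := by
  refine ⟨by simp [coeff_single], fun ν hν => ?_⟩
  by_contra h
  push Not at h
  rw [coeff_single, Finsupp.single_eq_of_ne h.1] at hν
  exact hν rfl

lemma IsTop.add_of_lt (hF : IsTop P ξ F v c) (hG : IsTop P ξ G w d)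
    (h : P.toLinearMap ξ w < P.toLinearMap ξ v) : IsTop P ξ (F + G) v c := by
  have h1 : IsTop P ξ G v 0 := by
    have h2 : ∀ ν, G.coeff ν ≠ 0 → P.toLinearMap ξ ν < P.toLinearMap ξ v := fun ν hν =>
      (hG.isBelow ν hν).trans_lt h
    refine ⟨?_, fun ν hν => Or.inr (h2 ν hν)⟩
    by_contra h3
    exact lt_irrefl _ (h2 v h3)
  simpa using hF.add h1

lemma isTop_binomial_of_pos {L : ℂ} {i : ι} (h : 0 < P.toLinearMap ξ (P.coroot i)) (k : ℝ) :
    IsTop P ξ (binomial P L i k) (P.coroot i) 1 := by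
  rw [binomial, sub_eq_add_neg, ← single_neg]
  exact (isTop_single _ _).add_of_lt (isTop_single _ _) (by simpa using h)

lemma isTop_binomial_of_neg {L : ℂ} {i : ι} (h : P.toLinearMap ξ (P.coroot i) < 0) (k : ℝ) :
    IsTop P ξ (binomial P L i k) 0 (-qpow L (-2 * k)) := by
  rw [binomial, sub_eq_add_neg, ← single_neg, add_comm]
  exact (isTop_single _ _).add_of_lt (isTop_single _ _) (by simpa using h)

end LeadingTerms

/-! ### Leading terms of the Macdonald operator -/

section OperatorLeadingTerms

variable {ι M N : Type*} [Fintype ι] [AddCommGroup M] [Module ℝ M] [AddCommGroup N] [Module ℝ N]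
variable {P : RootPairing ι ℝ M N} {L : ℂ} {m : ι → ℕ} {ξ : M}

variable (P) in
/-- The leading exponent of a factor of the denominator. -/
def factorTop (ξ : M) (i : ι) : N :=
  if 0 < P.toLinearMap ξ (P.coroot i) then P.coroot i + P.coroot i else 0

variable (P L) in
/-- The leading coefficient of a factor of the denominator. -/
def factorTopCoeff (ξ : M) (i : ι) : ℂ :=
  if 0 < P.toLinearMap ξ (P.coroot i) then 1 else qpow L (-2)

variable (P m) in
/-- The exponent of the ratio of the leading coefficients of numerator and denominator. -/
def factorShift (ξ τ : M) (i : ι) : ℝ :=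
  if 0 < P.toLinearMap ξ (P.coroot i) then -(m i * max (P.toLinearMap τ (P.coroot i)) 0)
  else m i * max (P.toLinearMap τ (P.coroot i)) 0

omit [Fintype ι] in
lemma isTop_binomial_mul_binomial (hξ : IsRegular P ξ) (i : ι) (k l : ℝ) :
    IsTop P ξ (binomial P L i k * binomial P L i l) (factorTop P ξ i)
      (if 0 < P.toLinearMap ξ (P.coroot i) then 1 else qpow L (-2 * k + -2 * l)) := by
  rw [factorTop]
  rcases lt_or_gt_of_ne (hξ i) with h | h
  · have h1 := (isTop_binomial_of_neg (L := L) h k).mul (isTop_binomial_of_neg (L := L) h l)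
    rw [neg_mul_neg, add_zero] at h1
    rwa [if_neg h.not_gt, if_neg h.not_gt, qpow_add]
  · have h1 := (isTop_binomial_of_pos (L := L) h k).mul (isTop_binomial_of_pos (L := L) h l)
    rw [one_mul] at h1
    rwa [if_pos h, if_pos h]

lemma isTop_denom (hξ : IsRegular P ξ) :
    IsTop P ξ (denom P m L) (∑ i with 0 < m i, factorTop P ξ i)
      (∏ i with 0 < m i, factorTopCoeff P L ξ i) := by
  rw [denom_eq_prod]
  refine IsTop.prod fun i _ => ?_
  convert isTop_binomial_mul_binomial hξ i 0 1 using 1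
  simp [factorTopCoeff]

omit [Fintype ι] in
lemma isTop_numFactor (hξ : IsRegular P ξ) {τ : M} (hτ : IsSmallWeight P τ) (i : ι) :
    IsTop P ξ (numFactor P m L τ i) (factorTop P ξ i)
      (factorTopCoeff P L ξ i * qpow L (factorShift P m ξ τ i)) := by
  rw [numFactor, factorTopCoeff, factorShift]
  have key : ∀ (a k l : ℝ) (n : ℝ), (0 < P.toLinearMap ξ (P.coroot i) → a = -(m i * max n 0)) →
      (a + (-2 * k + -2 * l) = -2 + m i * max n 0) →
      IsTop P ξ (qpow L a • (binomial P L i k * binomial P L i l)) (factorTop P ξ i)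
      ((if 0 < P.toLinearMap ξ (P.coroot i) then 1 else qpow L (-2)) *
      qpow L (if 0 < P.toLinearMap ξ (P.coroot i) then -(m i * max n 0) else m i * max n 0)) := by
    intro a k l n h1 h2
    convert (isTop_binomial_mul_binomial (L := L) hξ i k l).smul (qpow L a) using 1
    split_ifs with h
    · rw [h1 h, one_mul, mul_one]
    · rw [← qpow_add, ← qpow_add, h2]
  by_cases h2 : P.toLinearMap τ (P.coroot i) = 2
  · rw [if_pos h2, h2]
    refine key _ _ _ _ (fun _ => ?_) ?_ <;> norm_num <;> ring
  rw [if_neg h2]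
  by_cases hp : 0 < P.toLinearMap τ (P.coroot i)
  · have h1 : P.toLinearMap τ (P.coroot i) = 1 := by
      rcases hτ.cases' i with h | h | h | h | h
      all_goals first | exact h | (exfalso; linarith) | exact absurd h h2
    rw [if_pos hp, h1]
    refine key _ _ _ _ (fun _ => ?_) ?_ <;> norm_num
    ring
  · have h1 := key 0 0 1 0 (fun _ => by simp) (by simp)
    rw [qpow_zero, one_smul, max_self] at h1
    rwa [if_neg hp, max_eq_right (not_lt.1 hp)]

lemma sum_factorShift (hm : ∀ i j, m (P.reflectionPerm i j) = m j) (hξ : IsRegular P ξ) (τ : M) :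
    ∑ i with 0 < m i, factorShift P m ξ τ i = -2 * P.toLinearMap τ (rhoOf P m ξ) := by
  have h0 : ∑ i with 0 < m i, factorShift P m ξ τ i = ∑ i, factorShift P m ξ τ i := by
    refine Finset.sum_subset (Finset.filter_subset _ _) fun i _ hi => ?_
    have : m i = 0 := by simpa using hi
    simp [factorShift, this]
  rw [h0, sum_eq_sum_pos hξ, rhoOf, map_smul, map_sum, smul_eq_mul,
    show (-2 : ℝ) * (1 / 2 * ∑ i with 0 < P.toLinearMap ξ (P.coroot i),
      P.toLinearMap τ ((m i : ℝ) • P.coroot i)) = -∑ i with 0 < P.toLinearMap ξ (P.coroot i),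
      P.toLinearMap τ ((m i : ℝ) • P.coroot i) by ring, ← Finset.sum_neg_distrib]
  refine Finset.sum_congr rfl fun i hi => ?_
  have h1 := (Finset.mem_filter.1 hi).2
  have h2 : ¬ 0 < P.toLinearMap ξ (P.coroot (opp P i)) := by
    rw [coroot_opp, map_neg]
    linarith
  rw [factorShift, factorShift, if_pos h1, if_neg h2, coroot_opp, map_neg,
    show m (opp P i) = m i from hm i i, map_smul, smul_eq_mul]
  rcases le_total 0 (P.toLinearMap τ (P.coroot i)) with h | h
  · rw [max_eq_left h, max_eq_right (by linarith)]
    ring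
  · rw [max_eq_right h, max_eq_left (by linarith)]
    ring

/-- Relative to `isTop_denom`, this says that a_τ tends to q^{-2(τ, ρ_ξ)} in the direction ξ. -/
lemma isTop_num (hm : ∀ i j, m (P.reflectionPerm i j) = m j) (hξ : IsRegular P ξ) {τ : M}
    (hτ : IsSmallWeight P τ) :
    IsTop P ξ (num P m L τ) (∑ i with 0 < m i, factorTop P ξ i)
      ((∏ i with 0 < m i, factorTopCoeff P L ξ i) *
        qpow L (-2 * P.toLinearMap τ (rhoOf P m ξ))) := by
  rw [← sum_factorShift hm hξ, qpow_sum, ← Finset.prod_mul_distrib]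
  exact IsTop.prod fun i _ => isTop_numFactor hξ hτ i

lemma prod_factorTopCoeff_ne_zero : ∏ i with 0 < m i, factorTopCoeff P L ξ i ≠ 0 := by
  refine Finset.prod_ne_zero_iff.2 fun i _ => ?_
  rw [factorTopCoeff]
  split_ifs
  · exact one_ne_zero
  · exact qpow_ne_zero _

variable [P.IsRootSystem] [P.IsCrystallographic] [P.IsReduced]

/-- An orbit sum is a Weyl-invariant function of the coweight, so it does not see the chamber of ρ.
-/
lemma sum_qpow_rhoCheck (hm : ∀ i j, m (P.reflectionPerm i j) = m j) (b : P.Base) (ω : M)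
    (hξ : IsRegular P ξ) :
    ∑ τ ∈ weylOrbit P ω, qpow L (-2 * P.toLinearMap τ (rhoCheck b m)) =
      ∑ τ ∈ weylOrbit P ω, qpow L (-2 * P.toLinearMap τ (rhoOf P m ξ)) := by
  refine (apply_rhoOf_eq hm b
    (fun ν => ∑ τ ∈ weylOrbit P ω, qpow L (-2 * P.toLinearMap τ ν)) (fun i ν => ?_) hξ).symm
  simp_rw [pair_coreflection]
  exact sum_weylOrbit_reflection ω i fun τ => qpow L (-2 * P.toLinearMap τ ν)

/-- The action of the Macdonald operator on leading terms. -/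
lemma isTop_of_denom_mul_eq (hm : ∀ i j, m (P.reflectionPerm i j) = m j) (b : P.Base) {ω : M}
    (hω : IsMinuscule P ω ∨ IsQuasiminuscule P ω) (hξ : IsRegular P ξ) {y v : N}
    {F H : AddMonoidAlgebra ℂ N} {a : ℂ} (hF : IsTop P ξ F v a)
    (hH : denom P m L * H = opNum m L b ω y F) :
    IsTop P ξ H v (orbitSum P L ω (y + v - rhoOf P m ξ) * a) := by
  refine (isTop_denom (L := L) (m := m) hξ).of_mul prod_factorTopCoeff_ne_zero ?_
  rw [hH, opNum]
  convert (IsTop.sum fun τ hτ => (isTop_num (L := L) hm hξ (isSmallWeight_of_mem hω hτ)).mul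
    (((hF.translate (L := L) τ).smul (qpow L (2 * P.toLinearMap τ y))).sub hF)).add
    (((isTop_denom (L := L) (m := m) hξ).mul hF).smul
      (∑ τ ∈ weylOrbit P ω, qpow L (-2 * P.toLinearMap τ (rhoCheck b m)))) using 1
  -- The constant term of D cancels the contribution of the -1 in T^τ - 1; the sum of q^{2(τ, y + v
  -- - ρ_ξ)} remains.
  rw [sum_qpow_rhoCheck hm b ω hξ, orbitSum, Finset.sum_mul, Finset.mul_sum, Finset.sum_mul,
    ← Finset.sum_add_distrib]
  refine Finset.sum_congr rfl fun τ _ => ?_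
  have : qpow L (2 * P.toLinearMap τ (y + v - rhoOf P m ξ)) =
      qpow L (-2 * P.toLinearMap τ (rhoOf P m ξ)) * qpow L (2 * P.toLinearMap τ y) *
        qpow L (2 * P.toLinearMap τ v) := by
    rw [← qpow_add, ← qpow_add, map_sub, map_add]
    congr 1
    ring
  rw [this]
  ring

omit [P.IsReduced] in
lemma isBelow_of_denom_mul_eq (hm : ∀ i j, m (P.reflectionPerm i j) = m j) (b : P.Base) {ω : M}
    (hω : IsMinuscule P ω ∨ IsQuasiminuscule P ω) (hξ : IsRegular P ξ) {y : N} {B : ℝ}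
    {F H : AddMonoidAlgebra ℂ N} (hF : IsBelow P ξ F B)
    (hH : denom P m L * H = opNum m L b ω y F) : IsBelow P ξ H B := by
  refine (isTop_denom (L := L) (m := m) hξ).isBelow_of_mul prod_factorTopCoeff_ne_zero ?_
  rw [hH, opNum]
  refine (IsBelow.sum fun τ hτ => ?_).add (((isTop_denom hξ).isBelow.mul hF).smul _)
  exact (isTop_num hm hξ (isSmallWeight_of_mem hω hτ)).isBelow.mul
    (((hF.translate τ).smul _).sub hF)

end OperatorLeadingTerms

end BakerAkhiezer

end

noncomputable section

namespace BakerAkhiezer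

open scoped Classical Topology
open Filter AddMonoidAlgebra

/-! ### Strings of exponents of quasi-invariants -/

section Strings

/-- A relation between odd Laurent monomials needs sufficiently many terms. -/
lemma lt_card_of_sum_zpow_sub_eq_zero {κ : Type*} {S : Finset κ} (hS : S.Nonempty) {a w : κ → ℂ}
    (ha : ∀ k ∈ S, a k ≠ 0) (hw : ∀ k ∈ S, w k ≠ 0) (hw1 : ∀ k ∈ S, w k - (w k)⁻¹ ≠ 0)
    (hinj : ∀ k ∈ S, ∀ l ∈ S, w k + (w k)⁻¹ = w l + (w l)⁻¹ → k = l) {n : ℕ}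
    (h : ∀ s : ℕ, 1 ≤ s → s ≤ n → ∑ k ∈ S, a k * (w k ^ s - (w k)⁻¹ ^ s) = 0) :
    n < S.card := by
  -- Induction through the identity (w^{s+1} - w^{-s-1})(w + w⁻¹) = (w^{s+2} - w^{-s-2}) + (w^s -
  -- w^{-s}).
  have hmain : ∀ r s : ℕ, s + r ≤ n →
      ∑ k ∈ S, a k * (w k ^ s - (w k)⁻¹ ^ s) * (w k + (w k)⁻¹) ^ r = 0 := by
    intro r
    induction r with
    | zero =>
      intro s hs
      rcases Nat.eq_zero_or_pos s with rfl | h0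
      · simp
      · simpa using h s h0 (by omega)
    | succ r ih =>
      intro s hs
      rcases Nat.eq_zero_or_pos s with rfl | h0
      · simp
      · obtain ⟨s, rfl⟩ : ∃ s', s = s' + 1 := ⟨s - 1, by omega⟩
        rw [← add_zero (0 : ℂ)]
        nth_rw 1 [← ih (s + 2) (by omega)]
        rw [← ih s (by omega), ← Finset.sum_add_distrib]
        refine Finset.sum_congr rfl fun k hk => ?_
        have h1 : w k * (w k)⁻¹ = 1 := mul_inv_cancel₀ (hw k hk)
        generalize (w k)⁻¹ = x at h1 ⊢
        rw [pow_succ (w k + x) r]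
        linear_combination (a k * (w k + x) ^ r * (w k ^ s - x ^ s)) * h1
  by_contra! hcard
  obtain ⟨k₀, hk₀⟩ := hS
  -- If |S| ≤ n, this polynomial has degree below n and vanishes at every node w_k + w_k⁻¹ except
  -- that of k₀, so it isolates a single nonzero term.
  let p : Polynomial ℂ := ∏ k ∈ S.erase k₀, (Polynomial.X - Polynomial.C (w k + (w k)⁻¹))
  have hdeg : p.natDegree < n := by
    refine (Polynomial.natDegree_prod_le _ _).trans_lt ?_
    simp only [Polynomial.natDegree_X_sub_C, Finset.sum_const, smul_eq_mul, mul_one]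
    rw [Finset.card_erase_of_mem hk₀]
    have := Finset.card_pos.2 ⟨k₀, hk₀⟩
    omega
  have h1 : ∑ k ∈ S, a k * (w k - (w k)⁻¹) * p.eval (w k + (w k)⁻¹) = 0 := by
    simp_rw [Polynomial.eval_eq_sum_range' hdeg, Finset.mul_sum]
    rw [Finset.sum_comm]
    refine Finset.sum_eq_zero fun r hr => ?_
    have h2 := hmain r 1 (by have := Finset.mem_range.1 hr; omega)
    simp only [pow_one] at h2
    rw [← mul_zero (p.coeff r), ← h2, Finset.mul_sum]
    refine Finset.sum_congr rfl fun k _ => ?_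
    ring
  rw [Finset.sum_eq_single_of_mem k₀ hk₀] at h1
  · refine mul_ne_zero (mul_ne_zero (ha _ hk₀) (hw1 _ hk₀)) ?_ h1
    rw [Polynomial.eval_prod, Finset.prod_ne_zero_iff]
    intro k hk
    have hk' := Finset.mem_erase.1 hk
    simp only [Polynomial.eval_sub, Polynomial.eval_X, Polynomial.eval_C]
    exact fun h => hk'.1 (hinj _ hk₀ _ hk'.2 (sub_eq_zero.1 h)).symm
  · intro k hk hne
    rw [Polynomial.eval_prod, Finset.prod_eq_zero (Finset.mem_erase.2 ⟨hne, hk⟩) (by simp),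
      mul_zero]

variable {ι M N : Type*} [Fintype ι] [AddCommGroup M] [Module ℝ M] [AddCommGroup N] [Module ℝ N]
variable {P : RootPairing ι ℝ M N} {L : ℂ} {m : ι → ℕ}

omit [Fintype ι] in
lemma IsQuasiInvariant.add_eq_sub {f : M → ℂ} (hf : IsQuasiInvariant P m f) {i : ι} {s : ℕ}
    (hs : s ≤ m i) {v : M} (hv : P.toLinearMap v (P.coroot i) = 0) :
    f (v + ((s : ℝ) / 2) • P.root i) = f (v - ((s : ℝ) / 2) • P.root i) := by
  have h := hf i s (by simpa using hs) (v + ((s : ℝ) / 2) • P.root i) (by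
    rw [pair_line, hv]
    push_cast
    ring)
  rw [← h, reflection_line, reflection_eq_self hv, neg_smul, sub_eq_add_neg]

omit [Fintype ι] in
lemma expFun_add_half_sub (y : N) (F : AddMonoidAlgebra ℂ N) (i : ι) (s : ℝ) (z : M) :
    expFun P L y F (z + (s / 2) • P.root i) - expFun P L y F (z - (s / 2) • P.root i) =
      ∑ ν ∈ F.coeff.support, F.coeff ν * (qpow L (s * P.toLinearMap (P.root i) (y + ν)) -
        qpow L (-(s * P.toLinearMap (P.root i) (y + ν)))) *
          qpow L (2 * P.toLinearMap z (y + ν)) := by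
  rw [expFun_eq_sum, expFun_eq_sum, Finsupp.sum, Finsupp.sum, ← Finset.sum_sub_distrib]
  refine Finset.sum_congr rfl fun ν _ => ?_
  rw [mul_assoc, sub_mul, ← qpow_add, ← qpow_add, ← mul_sub]
  simp only [map_add, map_sub, map_smul, LinearMap.add_apply, LinearMap.sub_apply,
    LinearMap.smul_apply, smul_eq_mul]
  congr 3 <;> ring

omit [Fintype ι] in
/-- Quasi-invariance in terms of the coefficients along a string of exponents. -/
lemma sum_string_eq_zero (hL : L ≠ 0) {y : N} {F : AddMonoidAlgebra ℂ N}
    (hF : IsQuasiInvariant P m (expFun P L y F)) {i : ι} {s : ℕ} (hs : s ≤ m i) (ν₀ : N) :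
    ∑ ν ∈ F.coeff.support with (∃ c : ℝ, ν = ν₀ + c • P.coroot i),
      F.coeff ν * (qpow L (s * P.toLinearMap (P.root i) (y + ν)) -
        qpow L (-(s * P.toLinearMap (P.root i) (y + ν)))) = 0 := by
  have h := sum_class_eq_zero (P := P) hL (LinearMap.ker (P.toLinearMap.flip (P.coroot i))) 0
    F.coeff.support (fun ν => y + ν)
    (fun ν => F.coeff ν * (qpow L (s * P.toLinearMap (P.root i) (y + ν)) -
        qpow L (-(s * P.toLinearMap (P.root i) (y + ν))))) (fun v hv => by
      rw [zero_add, ← expFun_add_half_sub, hF.add_eq_sub hs (by simpa using hv), sub_self])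
    (y + ν₀)
  refine Eq.trans ?_ h
  refine Finset.sum_congr ?_ fun ν _ => by simp [qpow]
  ext ν
  simp only [Finset.mem_filter, map_add, add_right_inj, forall_pair_eq_iff]

variable [P.IsRootSystem] [P.IsCrystallographic] [P.IsReduced]

/-- The quasi-invariance conditions hold at all `z` with `q ^ (2 (α^∨, z)) = 1`. -/
lemma expFun_add_eq_sub (hL : L ≠ 0) (b : P.Base) {y : N} {F : AddMonoidAlgebra ℂ N}
    (hF : F ∈ quasiInvariants P L m y) {i : ι} {s : ℕ} (hs : s ≤ m i) {z : M}
    (hz : qpow L (2 * P.toLinearMap z (P.coroot i)) = 1) :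
    expFun P L y F (z + ((s : ℝ) / 2) • P.root i) =
      expFun P L y F (z - ((s : ℝ) / 2) • P.root i) := by
  rw [← sub_eq_zero, expFun_add_half_sub]
  -- Exponents are grouped into strings. When q^{2(α^∨, z)} = 1, integral steps along α^∨ do not
  -- change q^{2(z, y + ν)}, so each group is a multiple of a vanishing string sum.
  let g : N → N ⧸ Submodule.span ℝ {P.coroot i} := Submodule.Quotient.mk
  rw [← Finset.sum_fiberwise_of_maps_to (g := g) (t := F.coeff.support.image g)
    (fun ν hν => Finset.mem_image_of_mem g hν)]
  refine Finset.sum_eq_zero fun j hj => ?_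
  obtain ⟨ν₀, hν₀, rfl⟩ := Finset.mem_image.1 hj
  have hg : ∀ ν, g ν = g ν₀ ↔ ∃ c : ℝ, ν = ν₀ + c • P.coroot i := by
    intro ν
    rw [Submodule.Quotient.eq, Submodule.mem_span_singleton]
    exact exists_congr fun c => ⟨fun h => by rw [h]; abel, fun h => by rw [h]; abel⟩
  simp_rw [hg]
  rw [← zero_mul (qpow L (2 * P.toLinearMap z (y + ν₀))), ← sum_string_eq_zero hL hF.2 hs ν₀,
    Finset.sum_mul]
  refine Finset.sum_congr rfl fun ν hν => ?_
  obtain ⟨hν, c, hc⟩ := Finset.mem_filter.1 hν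
  obtain ⟨n, hn⟩ : ∃ n : ℤ, c = n := by
    refine exists_int_of_smul_coroot_mem (m := m) (i := i) b ?_
    have h1 := AddSubgroup.sub_mem _ (hF.1 ν (by simpa using hν)) (hF.1 ν₀ (by simpa using hν₀))
    rwa [hc, add_sub_cancel_left] at h1
  congr 1
  have : 2 * P.toLinearMap z (y + ν) = 2 * P.toLinearMap z (y + ν₀) +
      n * (2 * P.toLinearMap z (P.coroot i)) := by
    rw [hc, hn]
    simp only [map_add, map_smul, smul_eq_mul]
    ring
  rw [this, qpow_add, qpow_int_mul, hz, one_zpow, mul_one]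

/-- No number `2 (α, y) + n` with `n` integral is a period of `a ↦ q ^ a`. -/
def IsNonresonant (P : RootPairing ι ℝ M N) (L : ℂ) (y : N) : Prop :=
  ∀ i, ∀ n : ℤ, qpow L (2 * P.toLinearMap (P.root i) y + n) ≠ 1

/-- For nonresonant `y` every string of exponents of a quasi-invariant is long. -/
lemma exists_long_string (hL : NotRootOfUnity L) (b : P.Base) {y : N}
    (hy : IsNonresonant P L y) {F : AddMonoidAlgebra ℂ N} (hF : F ∈ quasiInvariants P L m y) :
    ∀ v ∈ F.coeff.support, ∀ i, 0 < m i → ∃ a ∈ F.coeff.support, ∃ k : ℝ, m i ≤ k ∧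
      a + k • P.coroot i ∈ F.coeff.support ∧ ∃ c : ℝ, a = v + c • P.coroot i := by
  intro v hv i _
  set S := F.coeff.support.filter fun ν => ∃ c : ℝ, ν = v + c • P.coroot i with hS
  have hmem : ∀ ν ∈ S, ν ∈ corootLattice P m := fun ν hν =>
    hF.1 ν (by simpa using (Finset.mem_filter.1 hν).1)
  have hvS : v ∈ S := Finset.mem_filter.2 ⟨hv, 0, by simp⟩
  have hex : ∀ ν ∈ S, ∃ n : ℤ, ν = v + (n : ℝ) • P.coroot i := by
    intro ν hν
    obtain ⟨c, hc⟩ := (Finset.mem_filter.1 hν).2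
    obtain ⟨n, hn⟩ : ∃ n : ℤ, c = n := by
      refine exists_int_of_smul_coroot_mem (m := m) (i := i) b ?_
      have h1 := AddSubgroup.sub_mem _ (hmem ν hν) (hmem v hvS)
      rwa [hc, add_sub_cancel_left] at h1
    exact ⟨n, hn ▸ hc⟩
  choose! e he using hex
  let w : N → ℂ := fun ν => qpow L (P.toLinearMap (P.root i) (y + ν))
  -- Nonresonance: no two nodes of the string are mutually inverse, and no node is ±1.
  have hprod : ∀ ν ∈ S, ∀ μ ∈ S, w ν * w μ ≠ 1 := by
    intro ν hν μ hμ h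
    obtain ⟨k, hk⟩ := exists_int_of_mem_corootLattice (hmem ν hν) i
    obtain ⟨l, hl⟩ := exists_int_of_mem_corootLattice (hmem μ hμ) i
    refine hy i (k + l) ?_
    rw [← h]
    simp only [w]
    rw [← qpow_add, map_add, map_add, hk, hl]
    congr 1
    push_cast
    ring
  -- The conditions for s = 1, …, m_i are relations between these nodes. The values w + w⁻¹ are
  -- distinct because q is not a root of unity and no nodes are inverse.
  have hcard : m i < S.card := by
    refine lt_card_of_sum_zpow_sub_eq_zero (a := F.coeff) (w := w) ⟨v, hvS⟩
      (fun ν hν => by simpa using (Finset.mem_filter.1 hν).1) (fun _ _ => qpow_ne_zero _)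
      (fun ν hν h => ?_) (fun ν hν μ hμ h => ?_) (fun s _ hs => ?_)
    · refine hprod ν hν ν hν ?_
      nth_rw 2 [sub_eq_zero.1 h]
      exact mul_inv_cancel₀ (qpow_ne_zero _)
    · have h1 : w ν ≠ 0 := qpow_ne_zero _
      have h2 : w μ ≠ 0 := qpow_ne_zero _
      have h3 : (w ν - w μ) * (w ν * w μ - 1) = 0 := by
        field_simp at h
        linear_combination h
      rcases mul_eq_zero.1 h3 with h4 | h4
      · by_contra hne
        have hn : e ν - e μ ≠ 0 := by
          intro h0
          apply hne
          rw [he ν hν, he μ hμ, sub_eq_zero.1 h0]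
        refine hL (2 * (e ν - e μ)) (by omega) ?_
        have h5 : ((2 * (e ν - e μ) : ℤ) : ℝ) = P.toLinearMap (P.root i) (y + ν) -
            P.toLinearMap (P.root i) (y + μ) := by
          have h6 := congrArg (P.toLinearMap (P.root i)) (he ν hν)
          have h7 := congrArg (P.toLinearMap (P.root i)) (he μ hμ)
          have h8 : P.toLinearMap (P.root i) (P.coroot i) = 2 := P.root_coroot_two i
          simp only [map_add, map_smul, smul_eq_mul, h8] at h6 h7 ⊢
          push_cast
          linear_combination h7 - h6
        rw [h5, qpow_sub]
        exact (div_eq_one_iff_eq h2).2 (sub_eq_zero.1 h4)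
      · exact absurd (sub_eq_zero.1 h4) (hprod ν hν μ hμ)
    · rw [← sum_string_eq_zero hL.ne_zero hF.2 hs v]
      refine Finset.sum_congr rfl fun ν _ => ?_
      congr 1
      simp only [w]
      rw [← qpow_neg, ← zpow_natCast, ← zpow_natCast, ← qpow_int_mul, ← qpow_int_mul,
        Int.cast_natCast, mul_neg]
  have hinj : Set.InjOn e S := fun ν hν μ hμ h => by rw [he ν hν, he μ hμ, h]
  have hne : (S.image e).Nonempty := ⟨e v, Finset.mem_image_of_mem e hvS⟩
  obtain ⟨a, haS, ha⟩ := Finset.mem_image.1 ((S.image e).min'_mem hne)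
  obtain ⟨c, hcS, hc⟩ := Finset.mem_image.1 ((S.image e).max'_mem hne)
  -- More than m_i distinct integers span an interval of length at least m_i.
  have hle : (S.image e).card ≤ (Finset.Icc (e a) (e c)).card := by
    refine Finset.card_le_card fun n hn => ?_
    rw [ha, hc]
    exact Finset.mem_Icc.2 ⟨Finset.min'_le _ _ hn, Finset.le_max' _ _ hn⟩
  rw [Finset.card_image_of_injOn hinj, Int.card_Icc] at hle
  refine ⟨a, (Finset.mem_filter.1 haS).1, (e c - e a : ℤ), ?_, ?_, e a, he a haS⟩
  · have : (m i : ℤ) ≤ e c - e a := by omega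
    exact_mod_cast this
  · have : a + ((e c - e a : ℤ) : ℝ) • P.coroot i = c := by
      have h1 := he a haS
      have h2 := he c hcS
      push_cast
      calc a + ((e c : ℝ) - e a) • P.coroot i
          = v + (e a : ℝ) • P.coroot i + ((e c : ℝ) - e a) • P.coroot i := by rw [← h1]
        _ = v + (e c : ℝ) • P.coroot i := by module
        _ = c := h2.symm
    rw [this]
    exact (Finset.mem_filter.1 hcS).1

end Strings

end BakerAkhiezer

end

noncomputable section

namespace BakerAkhiezer

open scoped Classical Topology
open Filter AddMonoidAlgebra

/-! ### Generic functionals and the doubled polytope -/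

section Doubling

variable {ι M N : Type*} [Fintype ι] [AddCommGroup M] [Module ℝ M] [AddCommGroup N] [Module ℝ N]
variable {P : RootPairing ι ℝ M N} {m : ι → ℕ}

lemma supportFun_two_mul (ξ : M) : supportFun P (fun i => 2 * m i) ξ = 2 * supportFun P m ξ := by
  simp only [supportFun, Nat.cast_mul, Nat.cast_ofNat, mul_assoc]
  rw [← Finset.mul_sum]
  ring

lemma rhoOf_two_mul (ξ : M) : rhoOf P (fun i => 2 * m i) ξ = (2 : ℝ) • rhoOf P m ξ := by
  simp only [rhoOf, Nat.cast_mul, Nat.cast_ofNat, mul_smul]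
  rw [← Finset.smul_sum, smul_comm]

lemma rhoOf_neg (hm : ∀ i j, m (P.reflectionPerm i j) = m j) (ξ : M) :
    rhoOf P m (-ξ) = -rhoOf P m ξ := by
  rw [rhoOf, rhoOf, ← smul_neg, ← Finset.sum_neg_distrib]
  congr 1
  refine Finset.sum_equiv (oppPerm P) (fun i => by simp) fun i _ => ?_
  simp only [oppPerm_apply, coroot_opp, smul_neg, neg_neg]
  rw [opp, hm]

omit [Fintype ι] in
lemma IsRegular.neg {ξ : M} (h : IsRegular P ξ) : IsRegular P (-ξ) := fun i => by
  simpa using h i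

omit [Fintype ι] in
lemma corootLattice_two_mul : corootLattice P (fun i => 2 * m i) = corootLattice P m := by
  simp [corootLattice]

variable (P) in
/-- `ξ` is regular and separates the elements of `E`. -/
def IsGeneric (E : Finset N) (ξ : M) : Prop :=
  IsRegular P ξ ∧ ∀ a ∈ E, ∀ b ∈ E, P.toLinearMap ξ a = P.toLinearMap ξ b → a = b

lemma exists_isGeneric_line (E : Finset N) {S : Set N} (hS : S.Finite) (h0 : ∀ w ∈ S, w ≠ 0)
    (ξ : M) : ∃ v : M, ∀ᶠ t in 𝓝[≠] (0 : ℝ), IsGeneric P E (ξ + t • v) ∧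
      ∀ w ∈ S, P.toLinearMap (ξ + t • v) w ≠ 0 := by
  obtain ⟨v, hv⟩ := exists_generic_direction P
    (S := Set.range P.coroot ∪ ((fun p : N × N => p.1 - p.2) '' ↑(E ×ˢ E) \ {0}) ∪ S)
    (((Set.finite_range _).union ((Finset.finite_toSet _).image _).sdiff).union hS) (by
      rintro w ((⟨i, rfl⟩ | hw) | hw)
      · exact P.flip.ne_zero i
      · exact hw.2
      · exact h0 w hw) ξ
  refine ⟨v, hv.mono fun t ht => ⟨⟨fun i => ht _ (Or.inl (Or.inl ⟨i, rfl⟩)),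
    fun a ha c hc hac => ?_⟩, fun w hw => ht w (Or.inr hw)⟩⟩
  by_contra hne
  refine ht (a - c) (Or.inl (Or.inr ⟨⟨(a, c), by simp [ha, hc], rfl⟩, sub_ne_zero.2 hne⟩)) ?_
  rw [map_sub, hac, sub_self]

/-- Linear inequalities for the support function need only be checked in generic directions. -/
lemma pair_le_supportFun (E : Finset N) {S : Set N} (hS : S.Finite) (h0 : ∀ w ∈ S, w ≠ 0) {ν : N}
    (h : ∀ ξ, IsGeneric P E ξ → (∀ w ∈ S, P.toLinearMap ξ w ≠ 0) →
      P.toLinearMap ξ ν ≤ supportFun P m ξ) (ξ : M) :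
    P.toLinearMap ξ ν ≤ supportFun P m ξ := by
  obtain ⟨v, hv⟩ := exists_isGeneric_line (P := P) E hS h0 ξ
  have h1 := (pair_continuous_line P ξ v ν).tendsto 0
  have h2 := (supportFun_continuous_line P m ξ v).tendsto 0
  rw [zero_smul, add_zero] at h1 h2
  exact le_of_tendsto_of_tendsto (h1.mono_left (nhdsWithin_le_nhds (s := {0}ᶜ)))
    (h2.mono_left nhdsWithin_le_nhds) (hv.mono fun t ht => h _ ht.1 ht.2)

variable [P.IsRootSystem] [P.IsCrystallographic] [P.IsReduced]

/-- There are finitely many lattice points in the doubled polytope. -/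
lemma exists_finset_of_pair_le (hm : ∀ i j, m (P.reflectionPerm i j) = m j) (b : P.Base) :
    ∃ E : Finset N, ∀ ν ∈ corootLattice P m,
      (∀ ξ, P.toLinearMap ξ ν ≤ supportFun P (fun i => 2 * m i) ξ) → ν ∈ E := by
  obtain ⟨η, hη, -⟩ := exists_dominant b
  have hfin : {l : ι → ℤ | IsBalanced P (fun i => 2 * m i) l}.Finite := by
    refine (Set.Finite.pi' fun i => Set.finite_Icc (0 : ℤ) (2 * m i : ℕ)).subset fun l hl i => ?_
    exact ⟨(hl i).1, (hl i).2.1⟩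
  refine ⟨(hfin.image (wt P)).toFinset, fun ν hν h => ?_⟩
  rw [Set.Finite.mem_toFinset]
  -- For the multiplicities 2m the vector ρ_η becomes 2ρ_η, which is itself a lattice point, so the
  -- lattice condition is just that ν lies in the lattice.
  refine exists_balanced_of_lattice (m := fun i => 2 * m i) (fun i j => by simp [hm]) hη h ?_
  rw [corootLattice_two_mul]
  refine AddSubgroup.sub_mem _ hν ?_
  rw [rhoOf_two_mul, rhoOf, smul_smul, show (2 : ℝ) * (1 / 2) = 1 by norm_num, one_smul]
  exact AddSubgroup.sum_mem _ fun i _ => smul_coroot_mem_corootLattice i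

end Doubling

/-! ### The Macdonald operator on quasi-invariants of bounded support -/

section Space

variable {ι M N : Type*} [Fintype ι] [AddCommGroup M] [Module ℝ M] [AddCommGroup N] [Module ℝ N]
variable {P : RootPairing ι ℝ M N} {L : ℂ} {m : ι → ℕ}
variable [P.IsRootSystem] [P.IsCrystallographic] [P.IsReduced]

variable (P m L) in
/-- The quasi-invariants with exponents in the doubled polytope. -/
def boundedQuasiInvariants (y : N) : Submodule ℂ (AddMonoidAlgebra ℂ N) where
  carrier := {F | F ∈ quasiInvariants P L m y ∧
    ∀ ξ, IsBelow P ξ F (supportFun P (fun i => 2 * m i) ξ)}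
  zero_mem' := ⟨Submodule.zero_mem _, fun ξ ν h => by simp at h⟩
  add_mem' := fun h1 h2 => ⟨Submodule.add_mem _ h1.1 h2.1, fun ξ => (h1.2 ξ).add (h2.2 ξ)⟩
  smul_mem' := fun c _ h => ⟨Submodule.smul_mem _ c h.1, fun ξ => (h.2 ξ).smul c⟩

/-- `T` is the action of the Macdonald operator on quasi-invariants. -/
def IsMacdonaldEnd (b : P.Base) (ω : M) (y : N)
    (T : Module.End ℂ (boundedQuasiInvariants P L m y)) : Prop :=
  ∀ F, (∀ z ∈ nonsingularPoints P L,
      expFun P L y (T F) z = macdonaldOp b m L ω (expFun P L y F) z) ∧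
    denom P m L * (T F : AddMonoidAlgebra ℂ N) = opNum m L b ω y F

/-- D raises no exponent bound in any regular direction, so the doubled polytope is preserved.
Linearity follows because values at regular points determine an exponential polynomial. -/
lemma exists_isMacdonaldEnd (hL : NotRootOfUnity L)
    (hm : ∀ i j, m (P.reflectionPerm i j) = m j) (b : P.Base) {ω : M}
    (hω : IsMinuscule P ω ∨ IsQuasiminuscule P ω) (y : N) :
    ∃ T : Module.End ℂ (boundedQuasiInvariants P L m y), IsMacdonaldEnd b ω y T := by
  have hex : ∀ F : boundedQuasiInvariants P L m y, ∃ H : boundedQuasiInvariants P L m y,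
      (∀ z ∈ nonsingularPoints P L,
        expFun P L y H z = macdonaldOp b m L ω (expFun P L y F) z) ∧
      denom P m L * (H : AddMonoidAlgebra ℂ N) = opNum m L b ω y F := by
    rintro ⟨F, hF⟩
    obtain ⟨H, h1, h2, h3⟩ := exists_expFun_eq_macdonaldOp hL hm b hω hF.1
    refine ⟨⟨H, h1, fun ξ ν hν => ?_⟩, h2, h3⟩
    refine pair_le_supportFun ∅ Set.finite_empty (by simp) (fun ξ hξ _ => ?_) ξ
    exact isBelow_of_denom_mul_eq hm b hω hξ.1 (hF.2 ξ) h3 ν hν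
  choose T hT1 hT2 using hex
  refine ⟨⟨⟨T, fun F G => ?_⟩, fun c F => ?_⟩, fun F => ⟨hT1 F, hT2 F⟩⟩
  · refine Subtype.ext (eq_of_expFun_eq (P := P) hL.ne_zero y fun z hz => ?_)
    have hz' := regularPoints_subset hz
    have h : expFun P L y (↑(F + G) : AddMonoidAlgebra ℂ N) = expFun P L y F + expFun P L y G := by
      ext z
      simp [expFun, mul_add]
    rw [hT1 _ z hz', h, map_add, Pi.add_apply, ← hT1 F z hz', ← hT1 G z hz']
    simp [expFun, mul_add]
  · refine Subtype.ext (eq_of_expFun_eq (P := P) hL.ne_zero y fun z hz => ?_)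
    have hz' := regularPoints_subset hz
    have h : expFun P L y (↑(c • F) : AddMonoidAlgebra ℂ N) = c • expFun P L y F := by
      ext z
      simp only [expFun, Submodule.coe_smul, map_smul, smul_eq_mul, Pi.smul_apply]
      ring
    rw [hT1 _ z hz', h, map_smul, Pi.smul_apply, ← hT1 F z hz']
    simp only [expFun, RingHom.id_apply, Submodule.coe_smul, map_smul, smul_eq_mul]
    ring

omit [Fintype ι] [P.IsRootSystem] [P.IsCrystallographic] [P.IsReduced] in
lemma add_mem_regularPoints {z τ : M} (hz : z ∈ regularPoints P L) (hτ : IsWeight P τ) :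
    z + τ ∈ regularPoints P L := by
  intro i k
  obtain ⟨n, hn⟩ := hτ i
  have := hz i (n + k)
  rwa [map_add, LinearMap.add_apply, hn, add_assoc, ← Int.cast_add]

omit [P.IsReduced] in
lemma macdonaldOp_congr (b : P.Base) {ω : M} (hω : IsMinuscule P ω ∨ IsQuasiminuscule P ω)
    {f g : M → ℂ} (h : ∀ z ∈ regularPoints P L, f z = g z) :
    ∀ z ∈ regularPoints P L, macdonaldOp b m L ω f z = macdonaldOp b m L ω g z := by
  intro z hz
  rw [macdonaldOp_apply, macdonaldOp_apply, h z hz]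
  congr 1
  refine Finset.sum_congr rfl fun τ hτ => ?_
  rw [h _ (add_mem_regularPoints hz (isSmallWeight_of_mem hω hτ).isWeight)]

omit [P.IsReduced] in
-- Iterates of D evaluate at repeatedly shifted arguments, which is why the comparison is made on
-- the shift-stable set of regular points.
lemma IsMacdonaldEnd.expFun_aeval {b : P.Base} {ω : M}
    (hω : IsMinuscule P ω ∨ IsQuasiminuscule P ω) {y : N}
    {T : Module.End ℂ (boundedQuasiInvariants P L m y)} (hT : IsMacdonaldEnd b ω y T)
    (F : boundedQuasiInvariants P L m y) (p : Polynomial ℂ) :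
    ∀ z ∈ regularPoints P L, expFun P L y (Polynomial.aeval T p F) z =
      Polynomial.aeval (macdonaldOp b m L ω) p (expFun P L y F) z := by
  induction p using Polynomial.induction_on with
  | C a =>
    intro z _
    simp only [Polynomial.aeval_C, Module.algebraMap_end_apply, expFun, Submodule.coe_smul,
      map_smul, smul_eq_mul, Pi.smul_apply]
    ring
  | add p q hp hq =>
    intro z hz
    rw [map_add, map_add, LinearMap.add_apply, LinearMap.add_apply, Pi.add_apply, ← hp z hz,
      ← hq z hz]
    simp [expFun, mul_add]
  | monomial n a ih =>
    intro z hz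
    rw [show Polynomial.C a * Polynomial.X ^ (n + 1) =
      Polynomial.X * (Polynomial.C a * Polynomial.X ^ n) by ring, map_mul (Polynomial.aeval T),
      map_mul (Polynomial.aeval (macdonaldOp b m L ω)), Polynomial.aeval_X, Polynomial.aeval_X,
      Module.End.mul_apply, Module.End.mul_apply, (hT _).1 z (regularPoints_subset hz)]
    exact macdonaldOp_congr b hω ih z hz

lemma IsMacdonaldEnd.isTop_aeval (hm : ∀ i j, m (P.reflectionPerm i j) = m j) {b : P.Base} {ω : M}
    (hω : IsMinuscule P ω ∨ IsQuasiminuscule P ω) {y v : N}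
    {T : Module.End ℂ (boundedQuasiInvariants P L m y)} (hT : IsMacdonaldEnd b ω y T) {ξ : M}
    (hξ : IsRegular P ξ) {F : boundedQuasiInvariants P L m y} {c : ℂ}
    (hF : IsTop P ξ (F : AddMonoidAlgebra ℂ N) v c) (p : Polynomial ℂ) :
    IsTop P ξ (Polynomial.aeval T p F : AddMonoidAlgebra ℂ N) v
      (p.eval (orbitSum P L ω (y + v - rhoOf P m ξ)) * c) := by
  induction p using Polynomial.induction_on with
  | C a => simpa [Polynomial.aeval_C] using hF.smul a
  | add p q hp hq => simpa [add_mul] using hp.add hq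
  | monomial n a ih =>
    rw [show Polynomial.C a * Polynomial.X ^ (n + 1) =
      Polynomial.X * (Polynomial.C a * Polynomial.X ^ n) by ring, map_mul, Polynomial.aeval_X,
      Module.End.mul_apply, Polynomial.eval_mul, Polynomial.eval_X, mul_assoc]
    exact isTop_of_denom_mul_eq hm b hω hξ ih (hT _).2

end Space

end BakerAkhiezer

end

noncomputable section

namespace BakerAkhiezer

open scoped Classical Topology
open Filter AddMonoidAlgebra

/-! ### The initial function -/

section Initial

variable {ι M N : Type*} [Fintype ι] [AddCommGroup M] [Module ℝ M] [AddCommGroup N] [Module ℝ N]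
variable {P : RootPairing ι ℝ M N} {m : ι → ℕ} {L : ℂ}

variable (m L) in
/-- The product `∏_{α > 0} ∏_{j = 1}^{m_α} [α^∨ + j] [α^∨ - j]`. -/
def initialElement (b : P.Base) : AddMonoidAlgebra ℂ N :=
  ∏ i ∈ posRoots b, ∏ j ∈ Finset.Icc 1 (m i),
    (single (-P.coroot i) 1 * (binomial P L i j * binomial P L i (-j)))

lemma expFun_initialElement (b : P.Base) (x : N) (z : M) :
    expFun P L (x + rhoCheck b m) (initialElement m L b) z =
      qpow L (2 * P.toLinearMap z x) * polyQ b m L z := by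
  rw [expFun, initialElement, polyQ, map_add, mul_add, qpow_add, mul_assoc, map_prod]
  congr 2
  refine Finset.prod_congr rfl fun i _ => ?_
  rw [map_prod]
  refine Finset.prod_congr rfl fun j _ => ?_
  rw [map_mul, map_mul, evalAt_binomial, evalAt_binomial, evalAt_single, one_mul, map_neg,
    mul_mul_mul_comm, ← mul_assoc, ← qpow_add, ← qpow_add, ← sub_eq_add_neg]
  set u := P.toLinearMap z (P.coroot i)
  rw [show 2 * -u + (u - j + (u - -j)) = 0 by ring]
  simp [qpow]

lemma isPos_or_isPos_opp [P.IsRootSystem] [P.IsCrystallographic] (b : P.Base) (i : ι) :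
    b.IsPos i ∨ b.IsPos (opp P i) := by
  obtain ⟨ξ, hξ, hpos⟩ := exists_dominant b
  rw [hpos, hpos, coroot_opp, map_neg]
  rcases (hξ i).lt_or_gt with h | h
  · exact Or.inr (by linarith)
  · exact Or.inl h

lemma polyQ_eq_zero [P.IsRootSystem] [P.IsCrystallographic]
    (hm : ∀ i j, m (P.reflectionPerm i j) = m j) (b : P.Base) {i : ι} {n : ℤ} (hn0 : n ≠ 0)
    (hn : |n| ≤ m i) {z : M} (hz : P.toLinearMap z (P.coroot i) = n) : polyQ b m L z = 0 := by
  have key : ∀ k, b.IsPos k → ∀ l : ℤ, l ≠ 0 → |l| ≤ m k → P.toLinearMap z (P.coroot k) = l →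
      polyQ b m L z = 0 := by
    intro k hk l hl0 hl hzk
    rw [polyQ, Finset.prod_eq_zero (i := k) (by simpa [posRoots] using hk), mul_zero]
    refine Finset.prod_eq_zero (i := l.natAbs) (Finset.mem_Icc.2 (by
      rw [Int.abs_eq_natAbs] at hl
      omega)) ?_
    rw [hzk]
    rcases lt_or_gt_of_ne hl0 with h | h
    · have h1 : (l.natAbs : ℝ) = -l := by
        rw [Nat.cast_natAbs, abs_of_neg h]
        push_cast
        rfl
      rw [h1, add_neg_cancel, qbr_zero, zero_mul]
    · have h1 : (l.natAbs : ℝ) = l := by rw [Nat.cast_natAbs, abs_of_pos h]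
      rw [h1, sub_self, qbr_zero, mul_zero]
  rcases isPos_or_isPos_opp b i with h | h
  · exact key i h n hn0 hn hz
  · refine key _ h (-n) (by omega) (by rwa [abs_neg, opp, hm]) ?_
    rw [coroot_opp, map_neg, hz]
    simp

/-- Each [α^∨ + j][α^∨ - j] has extreme exponents ±α^∨ with coefficient 1, so the product has its
top at the vertex of the doubled polytope. -/
lemma isTop_initialElement [P.IsRootSystem] [P.IsCrystallographic]
    (hm : ∀ i j, m (P.reflectionPerm i j) = m j) (b : P.Base) {ξ : M} (hξ : IsRegular P ξ) :
    IsTop P ξ (initialElement m L b) (rhoOf P (fun i => 2 * m i) ξ) 1 := by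
  have h1 : ∀ i ∈ posRoots b, ∀ j ∈ Finset.Icc 1 (m i),
      IsTop P ξ (single (-P.coroot i) 1 * (binomial P L i j * binomial P L i (-j)))
        (if 0 < P.toLinearMap ξ (P.coroot i) then P.coroot i else -P.coroot i) 1 := by
    intro i _ j _
    split_ifs with h
    · have := (isTop_single (P := P) (ξ := ξ) (-P.coroot i) 1).mul
        ((isTop_binomial_of_pos (L := L) h j).mul (isTop_binomial_of_pos (L := L) h (-j)))
      simpa using this
    · have h' := lt_of_le_of_ne (not_lt.1 h) (hξ i)
      have := (isTop_single (P := P) (ξ := ξ) (-P.coroot i) 1).mul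
        ((isTop_binomial_of_neg (L := L) h' j).mul (isTop_binomial_of_neg (L := L) h' (-j)))
      have h2 : qpow L (-2 * (j : ℝ)) * qpow L (-2 * -(j : ℝ)) = 1 := by
        rw [← qpow_add, show -2 * (j : ℝ) + -2 * -(j : ℝ) = 0 by ring]
        simp [qpow]
      rwa [neg_mul_neg, h2, mul_one, add_zero, add_zero] at this
  have h2 : IsTop P ξ (initialElement m L b) _ _ := IsTop.prod fun i hi => IsTop.prod (h1 i hi)
  simp only [Finset.prod_const_one] at h2
  convert h2 using 1
  obtain ⟨ξ₀, hξ₀, hpos⟩ := exists_dominant b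
  have h3 : posRoots b = Finset.univ.filter fun i => 0 < P.toLinearMap ξ₀ (P.coroot i) := by
    ext i
    simp [posRoots, hpos]
  rw [rhoOf_two_mul, rhoOf, smul_smul, show (2 : ℝ) * (1 / 2) = 1 by norm_num, one_smul,
    Finset.sum_filter, sum_eq_sum_pos hξ₀, ← h3]
  refine Finset.sum_congr rfl fun i hi => ?_
  rw [Finset.sum_const, Nat.card_Icc, Nat.add_sub_cancel, coroot_opp, map_neg, opp, hm,
    ← Nat.cast_smul_eq_nsmul ℝ]
  rcases (hξ i).lt_or_gt with h | h
  · rw [if_neg h.le.not_gt, if_neg h.le.not_gt, if_pos (by linarith), zero_add]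
  · rw [if_pos h, if_pos h, if_neg (by linarith), add_zero]

variable [P.IsRootSystem] [P.IsCrystallographic]

/-- Quasi-invariance is immediate: for n ≠ 0 both values vanish, and for n = 0 the point z is fixed
by the reflection. -/
lemma initialElement_mem (hm : ∀ i j, m (P.reflectionPerm i j) = m j) (b : P.Base) (x : N) :
    initialElement m L b ∈ boundedQuasiInvariants P L m (x + rhoCheck b m) := by
  refine ⟨⟨Subalgebra.prod_mem _ fun i _ => Subalgebra.prod_mem _ fun j hj => ?_,
    fun i n hn z hz => ?_⟩, fun ξ ν hν => ?_⟩
  · have hi : 0 < m i := by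
      have := Finset.mem_Icc.1 hj
      omega
    exact Subalgebra.mul_mem _
      (single_mem_latticeAlgebra (AddSubgroup.neg_mem _ (coroot_mem_corootLattice hi)) _)
      (Subalgebra.mul_mem _ (binomial_mem hi _) (binomial_mem hi _))
  · rcases eq_or_ne n 0 with h0 | h0
    · rw [reflection_eq_self (by simp [hz, h0])]
    · rw [expFun_initialElement, expFun_initialElement, polyQ_eq_zero hm b h0 hn hz,
        polyQ_eq_zero hm b (i := opp P i) h0 (by rwa [opp, hm]) (by
          rw [opp, pair_coroot_reflectionPerm]
          rw [← P.reflection_same i z] at hz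
          simpa using hz), mul_zero, mul_zero]
  · refine pair_le_supportFun ∅ Set.finite_empty (by simp) (fun ξ hξ _ => ?_) ξ
    rw [← pair_rhoOf_self (m := fun i => 2 * m i) (fun i j => by simp [hm]) hξ.1]
    exact (isTop_initialElement hm b hξ.1).isBelow ν hν

end Initial

end BakerAkhiezer

end

noncomputable section

namespace BakerAkhiezer

open scoped Classical Topology
open Filter AddMonoidAlgebra

/-! ### Leading exponents and eigenvalues -/

section Spectrum

variable {ι M N : Type*} [Fintype ι] [AddCommGroup M] [Module ℝ M] [AddCommGroup N] [Module ℝ N]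
variable {P : RootPairing ι ℝ M N} {m : ι → ℕ} {L : ℂ}

omit [Fintype ι] in
lemma IsTop.coeff_eq {ξ : M} {F : AddMonoidAlgebra ℂ N} {v : N} {c : ℂ} (h : IsTop P ξ F v c) :
    F.coeff v = c := h.1

omit [Fintype ι] in
lemma IsTop.pair_le {ξ : M} {F : AddMonoidAlgebra ℂ N} {v : N} {c : ℂ} (h : IsTop P ξ F v c)
    {u : N} (hu : u ∈ F.coeff.support) : P.toLinearMap ξ u ≤ P.toLinearMap ξ v :=
  h.isBelow u (by simpa using hu)

omit [Fintype ι] in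
lemma exists_isTop {E : Finset N} {ξ : M} (hξ : IsGeneric P E ξ) {F : AddMonoidAlgebra ℂ N}
    (hF : F ≠ 0) (hE : F.coeff.support ⊆ E) :
    ∃ v ∈ F.coeff.support, IsTop P ξ F v (F.coeff v) := by
  have hne : F.coeff.support.Nonempty := by
    rw [Finsupp.support_nonempty_iff]
    intro h
    exact hF (coeff_inj.1 (by simpa using h))
  obtain ⟨v, hv, hmax⟩ := F.coeff.support.exists_max_image (P.toLinearMap ξ) hne
  refine ⟨v, hv, rfl, fun u hu => ?_⟩
  have hu' : u ∈ F.coeff.support := by simpa using hu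
  rcases (hmax u hu').eq_or_lt with h | h
  · exact Or.inl (hξ.2 u (hE hu') v (hE hv) h)
  · exact Or.inr h

omit [Fintype ι] in
lemma coroot_eq_of_proportional [P.IsReduced] [Finite ι] {ξ : M} (hξ : IsRegular P ξ) {i j : ι}
    (h : P.toLinearMap ξ (P.coroot i) • P.coroot j = P.toLinearMap ξ (P.coroot j) • P.coroot i) :
    j = i ∨ j = opp P i := by
  have h3 : ¬ LinearIndependent ℝ ![P.coroot i, P.coroot j] := by
    rw [LinearIndependent.pair_iff]
    push Not
    refine ⟨-P.toLinearMap ξ (P.coroot j), P.toLinearMap ξ (P.coroot i), ?_, fun _ => hξ i⟩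
    rw [h]
    module
  rcases RootPairing.IsReduced.eq_or_eq_neg (P := P.flip) i j h3 with h | h
  · exact Or.inl (P.coroot.injective h).symm
  · refine Or.inr (P.coroot.injective ?_)
    have h4 : P.coroot i = -P.coroot j := h
    rw [coroot_opp, h4, neg_neg]

variable [P.IsRootSystem] [P.IsCrystallographic] [P.IsReduced]

/-- Let u be the leading exponent for a generic η. By `pair_sub_rhoOf_le`, η(v - ρ_ξ) ≤ η(u) -
η(ρ_η). Here η(u) is at most twice the support function and η(ρ_η) equals it once, so one copy
remains. -/
lemma pair_top_sub_rhoOf_le (hL : NotRootOfUnity L)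
    (hm : ∀ i j, m (P.reflectionPerm i j) = m j) (b : P.Base) {y : N}
    (hy : IsNonresonant P L y) {F : AddMonoidAlgebra ℂ N}
    (hF : F ∈ boundedQuasiInvariants P L m y) {ξ : M} (hξ : IsRegular P ξ) {v : N} {c : ℂ}
    (hc : c ≠ 0) (hv : IsTop P ξ F v c) (η : M) :
    P.toLinearMap η (v - rhoOf P m ξ) ≤ supportFun P m η := by
  let w : ι × ι → N := fun p =>
    P.toLinearMap ξ (P.coroot p.1) • P.coroot p.2 - P.toLinearMap ξ (P.coroot p.2) • P.coroot p.1
  refine pair_le_supportFun F.coeff.support (S := Set.range w \ {0}) (Set.toFinite _)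
    (fun w hw => hw.2) (fun η hη hgen => ?_) η
  have hF0 : F ≠ 0 := by
    rintro rfl
    exact hc (by simpa using hv.coeff_eq.symm)
  obtain ⟨u, hu, htop⟩ := exists_isTop hη hF0 subset_rfl
  have h1 := pair_sub_rhoOf_le hm (exists_long_string hL b hy hF.1) hξ hη.1 (fun i j hij => by
    refine coroot_eq_of_proportional hξ ?_
    by_contra hne
    refine hgen (w (i, j)) ⟨⟨(i, j), rfl⟩, sub_ne_zero.2 hne⟩ ?_
    simp only [w, map_sub, map_smul, smul_eq_mul]
    linear_combination hij) (v := v) (w := u)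
    (by rw [Finsupp.mem_support_iff, hv.coeff_eq]; exact hc) (fun _ h => hv.pair_le h)
    (fun _ h => htop.pair_le h)
  have h2 := hF.2 η u (by simpa using hu)
  rw [supportFun_two_mul] at h2
  have h3 := pair_rhoOf_self hm hη.1
  rw [map_sub _ u, h3] at h1
  linarith

/-- The possible leading exponents. -/
lemma mem_insert_shifts (hL : NotRootOfUnity L)
    (hm : ∀ i j, m (P.reflectionPerm i j) = m j) (b : P.Base) {y : N}
    (hy : IsNonresonant P L y) {F : AddMonoidAlgebra ℂ N}
    (hF : F ∈ boundedQuasiInvariants P L m y) {ξ : M} (hξ : IsRegular P ξ) {v : N} {c : ℂ}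
    (hc : c ≠ 0) (hv : IsTop P ξ F v c) :
    rhoCheck b m + v - rhoOf P m ξ ∈ insert 0 (shifts b m) := by
  obtain ⟨l, hl, hwt⟩ := exists_balanced_of_lattice hm hξ.neg
    (pair_top_sub_rhoOf_le hL hm b hy hF hξ hc hv) (by
      rw [rhoOf_neg hm, sub_neg_eq_add, sub_add_cancel]
      exact hF.1.1 v (by rw [hv.coeff_eq]; exact hc))
  obtain ⟨ξ₀, hξ₀, hpos⟩ := exists_dominant b
  have h3 : posRoots b = Finset.univ.filter fun i => 0 < P.toLinearMap ξ₀ (P.coroot i) := by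
    ext i
    simp [posRoots, hpos]
  -- Adding ρ^∨ replaces the coefficients l_α - m_α/2 by l_α.
  have h4 : rhoCheck b m + v - rhoOf P m ξ =
      ∑ i ∈ posRoots b, (l i).toNat • P.coroot i := by
    rw [add_sub_assoc, ← hwt, wt_eq_of_regular hl hξ₀, ← h3, rhoCheck, Finset.smul_sum,
      ← Finset.sum_add_distrib]
    refine Finset.sum_congr rfl fun i _ => ?_
    have h5 : ((l i).toNat : ℝ) = l i := by
      have := Int.toNat_of_nonneg (hl i).1
      exact_mod_cast this
    rw [← Nat.cast_smul_eq_nsmul ℝ, h5]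
    module
  rw [h4]
  by_cases h0 : ∑ i ∈ posRoots b, (l i).toNat • P.coroot i = 0
  · rw [h0]
    exact Finset.mem_insert_self _ _
  · refine Finset.mem_insert_of_mem (Finset.mem_erase.2 ⟨h0, ?_⟩)
    refine Finset.mem_image.2 ⟨fun i => (l i).toNat, ?_, rfl⟩
    rw [Fintype.mem_piFinset]
    intro i
    rw [Finset.mem_range]
    have := hl i
    omega

/-- The Macdonald operator is annihilated by the polynomial with roots `𝔪_ω(x + u)`. -/
lemma aeval_prod_eq_zero (hL : NotRootOfUnity L)
    (hm : ∀ i j, m (P.reflectionPerm i j) = m j) (b : P.Base) {ω : M}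
    (hω : IsMinuscule P ω ∨ IsQuasiminuscule P ω) {x : N}
    (hy : IsNonresonant P L (x + rhoCheck b m))
    {T : Module.End ℂ (boundedQuasiInvariants P L m (x + rhoCheck b m))}
    (hT : IsMacdonaldEnd b ω (x + rhoCheck b m) T)
    (F : boundedQuasiInvariants P L m (x + rhoCheck b m)) :
    Polynomial.aeval T (∏ u ∈ insert 0 (shifts b m),
      (Polynomial.X - Polynomial.C (orbitSum P L ω (x + u)))) F = 0 := by
  obtain ⟨E, hE⟩ := exists_finset_of_pair_le hm b
  have hsupp : ∀ G : boundedQuasiInvariants P L m (x + rhoCheck b m),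
      (G : AddMonoidAlgebra ℂ N).coeff.support ⊆ E := by
    intro G ν hν
    have hν' : (G : AddMonoidAlgebra ℂ N).coeff ν ≠ 0 := by simpa using hν
    exact hE ν (G.2.1.1 ν hν') fun ξ => G.2.2 ξ ν hν'
  obtain ⟨v₀, hv₀⟩ := exists_isGeneric_line (P := P) E Set.finite_empty (by simp) 0
  obtain ⟨t, ht, -⟩ := hv₀.exists
  obtain ⟨ξ, hξ⟩ : ∃ ξ, IsGeneric P E ξ := ⟨_, ht⟩
  have htop : ∀ G : boundedQuasiInvariants P L m (x + rhoCheck b m), G ≠ 0 →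
      ∃ v c, c ≠ 0 ∧ IsTop P ξ (G : AddMonoidAlgebra ℂ N) v c := by
    intro G hG
    obtain ⟨v, hv, h⟩ := exists_isTop hξ (fun h => hG (Subtype.ext h)) (hsupp G)
    exact ⟨v, _, by simpa using hv, h⟩
  -- Triangularity: A is closed downwards in ξ-value among the possible leading positions. Removing
  -- an element a of largest ξ-value, its factor of the product pushes the leading position into the
  -- remaining set; when A is empty, F = 0.
  have key : ∀ A : Finset N,
      (∀ u ∈ insert 0 (shifts b m), ∀ w ∈ A, P.toLinearMap ξ u < P.toLinearMap ξ w → u ∈ A) →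
      ∀ F : boundedQuasiInvariants P L m (x + rhoCheck b m),
      (∀ v c, c ≠ 0 → IsTop P ξ (F : AddMonoidAlgebra ℂ N) v c →
        rhoCheck b m + v - rhoOf P m ξ ∈ A) →
      Polynomial.aeval T (∏ u ∈ A, (Polynomial.X - Polynomial.C (orbitSum P L ω (x + u)))) F
        = 0 := by
    intro A
    induction A using Finset.induction_on_max_value (P.toLinearMap ξ) with
    | empty =>
      intro _ F hF
      by_contra hne
      rw [Finset.prod_empty, map_one, Module.End.one_apply] at hne
      obtain ⟨v, c, hc, hv⟩ := htop F hne
      exact absurd (hF v c hc hv) (Finset.notMem_empty _)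
    | insert a s has hmax ih =>
      intro hlow F hF
      rw [Finset.prod_insert has, mul_comm, map_mul, Module.End.mul_apply]
      refine ih (fun u hu w hw huw => ?_) _ fun v c hc hv => ?_
      · refine (Finset.mem_insert.1 (hlow u hu w (Finset.mem_insert_of_mem hw) huw)).resolve_left ?_
        rintro rfl
        exact absurd huw (hmax w hw).not_gt
      · have hu := mem_insert_shifts hL hm b hy (Subtype.prop _) hξ.1 hc hv
        have hF0 : F ≠ 0 := by
          rintro rfl
          rw [map_zero] at hv
          exact hc (by simpa using hv.coeff_eq.symm)
        obtain ⟨v', c', hc', hv'⟩ := htop F hF0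
        have hmem := hF v' c' hc' hv'
        -- This factor multiplies the leading coefficient by a difference of orbit sums, which is
        -- zero exactly when needed: at the position a.
        have htop' := hT.isTop_aeval hm hω hξ.1 hv'
          (Polynomial.X - Polynomial.C (orbitSum P L ω (x + a)))
        rcases htop'.2 v (by rw [hv.coeff_eq]; exact hc) with h | h
        · subst h
          refine (Finset.mem_insert.1 hmem).resolve_left fun ha => hc ?_
          rw [← hv.coeff_eq, htop'.coeff_eq, ← ha]
          simp [add_assoc, add_sub_assoc]
        · have hlt : P.toLinearMap ξ (rhoCheck b m + v - rhoOf P m ξ) <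
              P.toLinearMap ξ (rhoCheck b m + v' - rhoOf P m ξ) := by
            simp only [map_add, map_sub]
            linarith
          refine (Finset.mem_insert.1 (hlow _ hu _ hmem hlt)).resolve_left fun ha => ?_
          rw [ha] at hlt
          rcases Finset.mem_insert.1 hmem with h1 | h1
          · rw [h1] at hlt
            exact lt_irrefl _ hlt
          · exact absurd hlt (hmax _ h1).not_gt
  exact key _ (fun u hu _ _ _ => hu) F fun v c hc hv =>
    mem_insert_shifts hL hm b hy F.2 hξ.1 hc hv

/-- The exponential polynomial given by the product formula. -/
theorem exists_berest (hL : NotRootOfUnity L)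
    (hm : ∀ i j, m (P.reflectionPerm i j) = m j) (b : P.Base) {ω : M}
    (hω : IsMinuscule P ω ∨ IsQuasiminuscule P ω) (x : N) :
    ∃ G ∈ boundedQuasiInvariants P L m (x + rhoCheck b m),
      (∀ z ∈ regularPoints P L,
        expFun P L (x + rhoCheck b m) G z = berestFunction b m L ω x z) ∧
      G.coeff (-(2 : ℝ) • rhoCheck b m) = ∏ ν ∈ shifts b m,
        (orbitSum P L ω x - orbitSum P L ω (x + ν)) ∧
      (IsNonresonant P L (x + rhoCheck b m) →
        ∀ z ∈ nonsingularPoints P L,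
          macdonaldOp b m L ω (expFun P L (x + rhoCheck b m) G) z =
            orbitSum P L ω x * expFun P L (x + rhoCheck b m) G z) ∧
      (IsNonresonant P L (x + rhoCheck b m) →
        (∀ ν ∈ shifts b m, orbitSum P L ω x ≠ orbitSum P L ω (x + ν)) →
        (∀ ν, G.coeff ν ≠ 0 → ∀ ξ, P.toLinearMap ξ (rhoCheck b m + ν) ≤ supportFun P m ξ) ∧
        ∀ ξ, IsGeneric P G.coeff.support ξ → G.coeff (rhoOf P m ξ - rhoCheck b m) ≠ 0) := by
  obtain ⟨T, hT⟩ := exists_isMacdonaldEnd hL hm b hω (x + rhoCheck b m)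
  let F : boundedQuasiInvariants P L m (x + rhoCheck b m) := ⟨_, initialElement_mem hm b x⟩
  let p : Polynomial ℂ := ∏ ν ∈ shifts b m,
    (Polynomial.X - Polynomial.C (orbitSum P L ω (x + ν)))
  let G := Polynomial.aeval T p F
  have hcoeff : (G : AddMonoidAlgebra ℂ N).coeff (-(2 : ℝ) • rhoCheck b m) =
      ∏ ν ∈ shifts b m, (orbitSum P L ω x - orbitSum P L ω (x + ν)) := by
    obtain ⟨ξ₀, hξ₀, hpos⟩ := exists_dominant b
    -- In the antidominant direction the initial function has leading exponent -2ρ^∨ relative to y,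
    -- and ρ_{-ξ₀} = -ρ^∨; the corresponding eigenvalue is 𝔪_ω(x).
    have h1 := hT.isTop_aeval hm hω hξ₀.neg (F := F)
      (isTop_initialElement (L := L) hm b hξ₀.neg) p
    rw [rhoOf_two_mul, rhoOf_neg hm, ← rhoCheck_eq_rhoOf m hpos, smul_neg, ← neg_smul] at h1
    rw [h1.coeff_eq, mul_one, show x + rhoCheck b m + -(2 : ℝ) • rhoCheck b m - -rhoCheck b m = x
      by module]
    simp [p, Polynomial.eval_prod]
  have hzero : IsNonresonant P L (x + rhoCheck b m) → T G = orbitSum P L ω x • G := by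
    intro hy
    have h0 : (0 : N) ∉ shifts b m := by simp [shifts]
    -- The annihilating product is the product defining ψ times the factor of u = 0.
    have h1 := aeval_prod_eq_zero hL hm b hω hy hT F
    rw [Finset.prod_insert h0, map_mul, Module.End.mul_apply, add_zero, map_sub,
      Polynomial.aeval_X, Polynomial.aeval_C, LinearMap.sub_apply,
      Module.algebraMap_end_apply] at h1
    exact sub_eq_zero.1 h1
  refine ⟨G, G.2, fun z hz => ?_, hcoeff, fun hy z hz => ?_, fun hy hx => ?_⟩
  · rw [hT.expFun_aeval hω F p z hz]
    have h1 : expFun P L (x + rhoCheck b m) (F : AddMonoidAlgebra ℂ N) =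
        fun z => qpow L (2 * P.toLinearMap z x) * polyQ b m L z :=
      funext fun z => expFun_initialElement b x z
    rw [h1]
    rfl
  · rw [← (hT G).1 z hz, hzero hy]
    simp only [expFun, Submodule.coe_smul, map_smul, smul_eq_mul]
    ring
  · have hG0 : (G : AddMonoidAlgebra ℂ N) ≠ 0 := by
      intro h
      have h1 : (G : AddMonoidAlgebra ℂ N).coeff (-(2 : ℝ) • rhoCheck b m) = 0 := by simp [h]
      rw [hcoeff] at h1
      obtain ⟨ν, hν, h2⟩ := Finset.prod_eq_zero_iff.1 h1
      exact hx ν hν (sub_eq_zero.1 h2)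
    have htop : ∀ ξ, IsGeneric P (G : AddMonoidAlgebra ℂ N).coeff.support ξ → ∃ c, c ≠ 0 ∧
        IsTop P ξ (G : AddMonoidAlgebra ℂ N) (rhoOf P m ξ - rhoCheck b m) c := by
      intro ξ hξ
      obtain ⟨v, hv, htop⟩ := exists_isTop hξ hG0 subset_rfl
      have hc : (G : AddMonoidAlgebra ℂ N).coeff v ≠ 0 := by simpa using hv
      -- The leading coefficient of D G is computed from the leading term and from the eigenvalue
      -- equation. Comparison gives 𝔪_ω(x + u) = 𝔪_ω(x), so u = 0 by the assumption on x.
      have h1 := hT.isTop_aeval hm hω hξ.1 htop Polynomial.X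
      rw [Polynomial.aeval_X, hzero hy, Polynomial.eval_X] at h1
      have h2 := (htop.smul (orbitSum P L ω x)).coeff_eq
      have h3 := h1.coeff_eq
      rw [Submodule.coe_smul, h2] at h3
      have h4 := mul_right_cancel₀ hc h3
      rw [show x + rhoCheck b m + v - rhoOf P m ξ = x + (rhoCheck b m + v - rhoOf P m ξ) by abel]
        at h4
      rcases Finset.mem_insert.1 (mem_insert_shifts hL hm b hy G.2 hξ.1 hc htop) with h5 | h5
      · have h6 : v = rhoOf P m ξ - rhoCheck b m := by
          rw [← sub_eq_zero, ← h5]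
          abel
        rw [← h6]
        exact ⟨_, hc, htop⟩
      · exact absurd h4 (hx _ h5)
    refine ⟨fun ν hν ξ => ?_, fun ξ hξ => ?_⟩
    · refine pair_le_supportFun (G : AddMonoidAlgebra ℂ N).coeff.support Set.finite_empty (by simp)
        (fun ξ hξ _ => ?_) ξ
      obtain ⟨c, -, htop⟩ := htop ξ hξ
      have h1 := htop.isBelow ν hν
      rw [← pair_rhoOf_self hm hξ.1]
      simp only [map_add, map_sub] at h1 ⊢
      linarith
    · obtain ⟨c, hc, h⟩ := htop ξ hξ
      rw [h.coeff_eq]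
      exact hc

end Spectrum

end BakerAkhiezer

end

noncomputable section

namespace BakerAkhiezer

open scoped Classical Topology
open Filter AddMonoidAlgebra

/-! ### Genericity in x -/

section Analyticity

variable {L : ℂ}

lemma analyticAt_qpow_line (a b t : ℝ) : AnalyticAt ℝ (fun t : ℝ => qpow L (a + b * t)) t := by
  refine (analyticAt_cexp.restrictScalars (𝕜 := ℝ)).comp
    (f := fun t : ℝ => ((a + b * t : ℝ) : ℂ) * L) ?_
  have : AnalyticAt ℝ (fun t : ℝ => (t : ℂ)) t := Complex.ofRealCLM.analyticAt t
  push_cast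
  fun_prop

end Analyticity

section Genericity

variable {ι M N : Type*} [Fintype ι] [AddCommGroup M] [Module ℝ M] [AddCommGroup N] [Module ℝ N]
variable {P : RootPairing ι ℝ M N} {m : ι → ℕ} {L : ℂ}

omit [Fintype ι] in
lemma countable_not_isNonresonant [Finite ι] (hL : L ≠ 0) (y : N) {v : N}
    (hv : ∀ i, P.toLinearMap (P.root i) v ≠ 0) :
    {t : ℝ | ¬ IsNonresonant P L (y + t • v)}.Countable := by
  have : {t : ℝ | ¬ IsNonresonant P L (y + t • v)} = ⋃ i, ⋃ n : ℤ,
      {t : ℝ | qpow L ((2 * P.toLinearMap (P.root i) y + n) +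
        (2 * P.toLinearMap (P.root i) v) * t) = 1} := by
    ext t
    simp only [IsNonresonant, Set.mem_ofPred_eq, Set.mem_iUnion]
    push Not
    refine exists_congr fun i => exists_congr fun n => ?_
    simp only [map_add, map_smul, smul_eq_mul]
    rw [show 2 * (P.toLinearMap (P.root i) y + t * P.toLinearMap (P.root i) v) + (n : ℝ) =
      2 * P.toLinearMap (P.root i) y + n + 2 * P.toLinearMap (P.root i) v * t by ring]
  rw [this]
  exact Set.countable_iUnion fun i => Set.countable_iUnion fun n =>
    countable_qpow_eq_one hL _ (mul_ne_zero two_ne_zero (hv i))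

variable [P.IsRootSystem] [P.IsCrystallographic]

omit [P.IsRootSystem] [P.IsCrystallographic] in
lemma exists_int_of_mem_shifts {b : P.Base} {τ : M} (hτ : IsWeight P τ) {u : N}
    (hu : u ∈ shifts b m) : ∃ n : ℤ, P.toLinearMap τ u = n := by
  obtain ⟨l, -, rfl⟩ := Finset.mem_image.1 (Finset.mem_erase.1 hu).2
  choose n hn using hτ
  refine ⟨∑ i ∈ posRoots b, l i * n i, ?_⟩
  rw [map_sum]
  push_cast
  refine Finset.sum_congr rfl fun i _ => ?_
  rw [map_nsmul, hn, nsmul_eq_mul]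

omit [P.IsCrystallographic] in
lemma orbitSum_line (ω : M) (x v : N) (t : ℝ) :
    orbitSum P L ω (x + t • v) = ∑ τ ∈ weylOrbit P ω,
      qpow L (2 * P.toLinearMap τ x + 2 * P.toLinearMap τ v * t) := by
  refine Finset.sum_congr rfl fun τ _ => ?_
  simp only [map_add, map_smul, smul_eq_mul]
  congr 1
  ring

omit [P.IsCrystallographic] in
lemma analyticOnNhd_orbitSum_line (ω : M) (x v : N) :
    AnalyticOnNhd ℝ (fun t : ℝ => orbitSum P L ω (x + t • v)) Set.univ := by
  intro t _
  simp_rw [orbitSum_line]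
  exact Finset.analyticAt_fun_sum _ fun τ _ => analyticAt_qpow_line _ _ _

omit [P.IsCrystallographic] in
lemma continuous_orbitSum_line (ω : M) (x v : N) :
    Continuous fun t : ℝ => orbitSum P L ω (x + t • v) := by
  simp_rw [orbitSum_line]
  exact continuous_finsetSum _ fun τ _ => continuous_qpow.comp (by fun_prop)

/-- Both sides are analytic in t. If they agreed identically, independence of characters would give
q^{2(τ, u)} = 1 for every τ of the orbit. As (τ, u) is an integer, it would be 0, and the orbit
spans, so u = 0. -/
lemma eventually_orbitSum_ne [P.IsIrreducible] (hL : NotRootOfUnity L) {b : P.Base} {ω : M}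
    (hω₀ : ω ≠ 0) (hω : IsMinuscule P ω ∨ IsQuasiminuscule P ω) (x : N) {v u : N}
    (hv : ∀ τ ∈ weylOrbit P ω, ∀ τ' ∈ weylOrbit P ω,
      P.toLinearMap τ v = P.toLinearMap τ' v → τ = τ') (hu : u ∈ shifts b m) :
    ∀ᶠ t in 𝓝[≠] (0 : ℝ), orbitSum P L ω (x + t • v) ≠ orbitSum P L ω (x + t • v + u) := by
  have han : AnalyticOnNhd ℝ (fun t : ℝ => orbitSum P L ω (x + t • v) -
      orbitSum P L ω (x + u + t • v)) Set.univ :=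
    (analyticOnNhd_orbitSum_line ω x v).sub (analyticOnNhd_orbitSum_line ω (x + u) v)
  rcases (han 0 (Set.mem_univ _)).eventually_eq_zero_or_eventually_ne_zero with h | h
  · exfalso
    have h0 := han.eq_of_eventuallyEq (analyticOnNhd_const (v := (0 : ℂ))) h
    refine (Finset.mem_erase.1 hu).1 (eq_zero_of_forall_mem_weylOrbit (P := P) hω₀ fun τ hτ => ?_)
    have h1 := sum_fiber_eq_zero hL.ne_zero (weylOrbit P ω)
      (fun τ => (2 * P.toLinearMap τ v) • (LinearMap.id : ℝ →ₗ[ℝ] ℝ))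
      (fun τ => qpow L (2 * P.toLinearMap τ x) - qpow L (2 * P.toLinearMap τ (x + u)))
      (fun t => by
        have h2 := congrFun h0 t
        simp only [orbitSum_line, ← Finset.sum_sub_distrib] at h2
        refine Eq.trans (Finset.sum_congr rfl fun τ _ => ?_) h2
        rw [sub_mul, ← qpow_add, ← qpow_add]
        simp)
      ((2 * P.toLinearMap τ v) • LinearMap.id)
    rw [Finset.sum_eq_single_of_mem τ (by simp [hτ])] at h1
    · obtain ⟨n, hn⟩ := exists_int_of_mem_shifts (isSmallWeight_of_mem hω hτ).isWeight hu
      rw [hn]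
      by_contra hne
      refine hL (2 * n) (fun h => hne (by
        have : n = 0 := by omega
        simp [this])) ?_
      have h2 := sub_eq_zero.1 h1
      rw [map_add, mul_add, qpow_add, hn] at h2
      have h3 := mul_left_cancel₀ (qpow_ne_zero _) ((mul_one _).trans h2)
      push_cast
      exact h3.symm
    · intro τ' hτ' hne
      exfalso
      obtain ⟨h3, h4⟩ := Finset.mem_filter.1 hτ'
      refine hne (hv τ' h3 τ hτ ?_)
      have h5 := LinearMap.congr_fun h4 1
      simpa using h5
  · refine h.mono fun t ht heq => ht ?_
    rw [heq, sub_eq_zero]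
    congr 1
    abel

/-- Through every point there is a line along which generic points accumulate. -/
lemma exists_frequently_generic [P.IsIrreducible] (hL : NotRootOfUnity L) (b : P.Base) {ω : M}
    (hω₀ : ω ≠ 0) (hω : IsMinuscule P ω ∨ IsQuasiminuscule P ω) (x : N) :
    ∃ v : N, ∃ᶠ t in 𝓝[≠] (0 : ℝ), IsNonresonant P L (x + t • v + rhoCheck b m) ∧
      ∀ u ∈ shifts b m, orbitSum P L ω (x + t • v) ≠ orbitSum P L ω (x + t • v + u) := by
  obtain ⟨v, hv⟩ := exists_pair_ne_zero_of_finite P.flip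
    (S := Set.range P.root ∪ ((fun p : M × M => p.1 - p.2) '' ↑(weylOrbit P ω ×ˢ weylOrbit P ω) \
      {0})) ((Set.finite_range _).union ((Finset.finite_toSet _).image _).sdiff) (by
      rintro w (⟨i, rfl⟩ | hw)
      · exact P.ne_zero i
      · exact hw.2)
  have hv1 : ∀ i, P.toLinearMap (P.root i) v ≠ 0 := fun i => hv _ (Or.inl ⟨i, rfl⟩)
  have hv2 : ∀ τ ∈ weylOrbit P ω, ∀ τ' ∈ weylOrbit P ω,
      P.toLinearMap τ v = P.toLinearMap τ' v → τ = τ' := by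
    intro τ hτ τ' hτ' h
    by_contra hne
    refine hv (τ - τ') (Or.inr ⟨⟨(τ, τ'), by simp [hτ, hτ'], rfl⟩, sub_ne_zero.2 hne⟩) ?_
    change P.toLinearMap (τ - τ') v = 0
    rw [map_sub, LinearMap.sub_apply, h, sub_self]
  refine ⟨v, ?_⟩
  have h1 : ∀ᶠ t in 𝓝[≠] (0 : ℝ), ∀ u ∈ shifts b m,
      orbitSum P L ω (x + t • v) ≠ orbitSum P L ω (x + t • v + u) :=
    (Finset.eventually_all _).2 fun u hu => eventually_orbitSum_ne hL hω₀ hω x hv2 hu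
  -- Only "frequently" can be expected: resonant parameters are countable, but may be dense if |q| =
  -- 1.
  have h2 : ∃ᶠ t in 𝓝[≠] (0 : ℝ), IsNonresonant P L (x + t • v + rhoCheck b m) := by
    have h3 : Dense ({t : ℝ | ¬ IsNonresonant P L (x + rhoCheck b m + t • v)} ∪ {0})ᶜ :=
      ((countable_not_isNonresonant hL.ne_zero _ hv1).union
        (Set.countable_singleton 0)).dense_compl ℝ
    rw [frequently_nhdsWithin_iff]
    refine (mem_closure_iff_frequently.1 (h3 0)).mono fun t ht => ?_
    simp only [Set.mem_compl_iff, Set.mem_union, Set.mem_ofPred_eq, not_or, not_not] at ht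
    rw [show x + t • v + rhoCheck b m = x + rhoCheck b m + t • v by abel]
    exact ht
  exact h2.and_eventually h1

end Genericity

/-! ### Continuity in x -/

section Continuity

variable {ι M N : Type*} [Fintype ι] [AddCommGroup M] [Module ℝ M] [AddCommGroup N] [Module ℝ N]
variable {P : RootPairing ι ℝ M N} {m : ι → ℕ} {L : ℂ}

omit [Fintype ι] in
/-- Coefficients are linear combinations of values. -/
lemma exists_coeff_eq_sum [Finite ι] (hL : L ≠ 0) (P : RootPairing ι ℝ M N) (E : Finset N) {ν : N}
    (hν : ν ∈ E) : ∃ c : regularPoints P L →₀ ℂ, ∀ F : AddMonoidAlgebra ℂ N,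
      F.coeff.support ⊆ E → F.coeff ν = c.sum fun z a => a * evalAt P L z F := by
  let f : E → regularPoints P L → ℂ := fun μ z => qpow L (2 * P.toLinearMap z μ)
  -- Independent exponentials on the regular points have evaluation vectors spanning the whole
  -- coordinate space, which yields each coordinate as a finite combination of values.
  have hf : LinearIndependent ℂ f := by
    rw [Fintype.linearIndependent_iff]
    intro g hg
    have h0 : (∑ μ : E, single (μ : N) (g μ) : AddMonoidAlgebra ℂ N) = 0 := by
      refine eq_zero_of_forall_regular (P := P) hL fun z hz => ?_
      have h1 := congrFun hg ⟨z, hz⟩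
      rw [map_sum]
      simpa [f, Finset.sum_apply] using h1
    intro μ
    have h1 := congrArg (fun F : AddMonoidAlgebra ℂ N => F.coeff μ) h0
    simp only [coeff_sum, Finsupp.finsetSum_apply, coeff_single, coeff_zero,
      Finsupp.coe_zero, Pi.zero_apply] at h1
    rw [Finset.sum_eq_single μ (fun μ' _ h => by
      rw [Finsupp.single_eq_of_ne]
      exact fun h' => h (Subtype.ext h'.symm)) (by simp)] at h1
    simpa using h1
  have h1 := span_flip_eq_top_iff_linearIndependent.2 hf
  have h2 : (Pi.single ⟨ν, hν⟩ 1 : E → ℂ) ∈ Submodule.span ℂ (Set.range (flip f)) := by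
    rw [h1]
    trivial
  obtain ⟨c, hc⟩ := Finsupp.mem_span_range_iff_exists_finsupp.1 h2
  refine ⟨c, fun F hF => ?_⟩
  have h3 : F.coeff ν = ∑ μ : E, F.coeff μ * (Pi.single ⟨ν, hν⟩ 1 : E → ℂ) μ := by
    rw [Finset.sum_eq_single ⟨ν, hν⟩ (fun μ _ h => by simp [h]) (by simp)]
    simp
  rw [h3, ← hc]
  simp only [Finsupp.sum, Finset.sum_apply, Pi.smul_apply, smul_eq_mul, Finset.mul_sum, flip, f]
  rw [Finset.sum_comm]
  refine Finset.sum_congr rfl fun z _ => ?_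
  rw [evalAt_eq_sum _ F hF, Finset.mul_sum, ← Finset.sum_coe_sort E]
  refine Finset.sum_congr rfl fun μ _ => ?_
  ring

variable [P.IsRootSystem]

lemma continuous_macdonaldOp (b : P.Base) (ω : M) {f : ℝ → M → ℂ}
    (hf : ∀ z, Continuous fun t => f t z) (z : M) :
    Continuous fun t => macdonaldOp b m L ω (f t) z := by
  simp_rw [macdonaldOp_apply]
  refine Continuous.add ?_ (continuous_const.mul (hf _))
  refine continuous_finsetSum _ fun τ _ => ?_
  exact continuous_const.mul ((hf _).sub (hf _))

lemma continuous_berestFunction_line (b : P.Base) (ω : M) (x v : N) (z : M) :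
    Continuous fun t : ℝ => berestFunction b m L ω (x + t • v) z := by
  have key : ∀ s : Finset N, ∀ z, Continuous fun t : ℝ =>
      Polynomial.aeval (macdonaldOp b m L ω)
        (∏ ν ∈ s, (Polynomial.X - Polynomial.C (orbitSum P L ω (x + t • v + ν))))
        (fun z => qpow L (2 * P.toLinearMap z (x + t • v)) * polyQ b m L z) z := by
    intro s
    induction s using Finset.induction_on with
    | empty =>
      intro z
      simp only [Finset.prod_empty, map_one, Module.End.one_apply, map_add, map_smul, smul_eq_mul]
      exact (continuous_qpow.comp (by fun_prop)).mul continuous_const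
    | insert u s hu ih =>
      intro z
      simp_rw [Finset.prod_insert hu, map_mul, Module.End.mul_apply, map_sub, Polynomial.aeval_X,
        Polynomial.aeval_C, LinearMap.sub_apply, Module.algebraMap_end_apply, Pi.sub_apply,
        Pi.smul_apply, smul_eq_mul]
      refine (continuous_macdonaldOp b ω ih z).sub (Continuous.mul ?_ (ih z))
      simp_rw [add_right_comm x _ u]
      exact continuous_orbitSum_line ω (x + u) v
  exact key _ z

end Continuity

end BakerAkhiezer

end

noncomputable section

namespace BakerAkhiezer

open scoped Classical Topology
open Filter AddMonoidAlgebra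

/-! ### Extension from generic x to all x -/

section Extension

variable {ι M N : Type*} [Fintype ι] [AddCommGroup M] [Module ℝ M] [AddCommGroup N] [Module ℝ N]
variable {P : RootPairing ι ℝ M N} {m : ι → ℕ} {L : ℂ}
variable [P.IsRootSystem] [P.IsCrystallographic]

/-- ρ^∨ - s_i ρ^∨ = (α_i, ρ^∨) α_i^∨ is a difference of two ρ's, hence a lattice point, and α_i^∨ is
primitive. -/
lemma isCoweight_rhoCheck [P.IsReduced] (hm : ∀ i j, m (P.reflectionPerm i j) = m j)
    (b : P.Base) : IsCoweight P (rhoCheck b m) := by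
  intro i
  obtain ⟨ξ, hξ, hpos⟩ := exists_dominant b
  refine exists_int_of_smul_coroot_mem (m := m) (i := i) b ?_
  have h := rhoOf_sub_rhoOf_mem m hm hξ (hξ.reflection P i)
  rw [rhoOf_reflection hm, ← rhoCheck_eq_rhoOf m hpos, P.coreflection_apply, sub_sub_cancel] at h
  exact h

lemma convex_polytope (hm : ∀ i j, m (P.reflectionPerm i j) = m j) (b : P.Base) :
    Convex ℝ (polytope b m) := by
  intro p hp p' hp' s t hs ht hst
  rw [mem_polytope_iff hm] at hp hp' ⊢
  intro ξ
  rw [map_add, map_smul, map_smul, smul_eq_mul, smul_eq_mul,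
    ← one_mul (supportFun P m ξ), ← hst, add_mul]
  exact add_le_add (mul_le_mul_of_nonneg_left (hp ξ) hs) (mul_le_mul_of_nonneg_left (hp' ξ) ht)

/-- The polytope is the convex hull of any finite subset containing its vertices. -/
lemma convexHull_eq_polytope (hm : ∀ i j, m (P.reflectionPerm i j) = m j) (b : P.Base)
    {S : Set N} (hS : S.Finite) (hsub : S ⊆ polytope b m) (E : Finset N)
    (hE : ∀ ξ, IsGeneric P E ξ → rhoOf P m ξ ∈ S) : convexHull ℝ S = polytope b m := by
  refine (convexHull_min hsub (convex_polytope hm b)).antisymm fun p hp => ?_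
  by_contra hpS
  let _ : Fintype S := hS.fintype
  have : Module.Finite ℝ N := Base.module_finite b
  rw [hS.convexHull_eq_image] at hpS
  obtain ⟨ξ, u, h1, h2⟩ := exists_separating P (isCompact_stdSimplex ℝ S) (convex_stdSimplex ℝ S) _
    hpS
  rw [← hS.convexHull_eq_image] at hpS
  have h3 : ∀ ν ∈ S, P.toLinearMap ξ ν < P.toLinearMap ξ p := fun ν hν => by
    have h4 := h1 _ (single_mem_stdSimplex ℝ (⟨ν, hν⟩ : S))
    rw [LinearMap.sum_apply, Finset.sum_eq_single ⟨ν, hν⟩ (fun μ _ h => by simp [h]) (by simp)]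
      at h4
    refine lt_trans ?_ h2
    simpa using h4
  -- The separating functional is perturbed to a generic one; finitely many strict inequalities
  -- survive. It then exceeds at p its value at the vertex ρ_ξ, the maximum on the polytope.
  obtain ⟨v, hv⟩ := exists_isGeneric_line (P := P) E Set.finite_empty (by simp) ξ
  have h5 : ∀ᶠ t in 𝓝[≠] (0 : ℝ), ∀ ν ∈ S,
      P.toLinearMap (ξ + t • v) ν < P.toLinearMap (ξ + t • v) p := by
    refine (hS.eventually_all).2 fun ν hν => nhdsWithin_le_nhds ?_
    refine (pair_continuous_line P ξ v ν).continuousAt.eventually_lt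
      (pair_continuous_line P ξ v p).continuousAt ?_
    simpa using h3 ν hν
  obtain ⟨t, ⟨ht, -⟩, ht'⟩ := (hv.and h5).exists
  have h6 := ht' _ (hE _ ht)
  rw [pair_rhoOf_self hm ht.1] at h6
  exact absurd ((mem_polytope_iff hm).1 hp _) h6.not_ge

/-- A coefficient is a fixed finite combination of values at regular points, where the product
formula is visibly continuous in x. The finite set of possible exponents does not depend on x. -/
lemma continuous_coeff_line [P.IsReduced] (hL : L ≠ 0)
    (hm : ∀ i j, m (P.reflectionPerm i j) = m j) (b : P.Base) {ω : M}
    {G : N → AddMonoidAlgebra ℂ N}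
    (hG : ∀ x, G x ∈ boundedQuasiInvariants P L m (x + rhoCheck b m))
    (hGb : ∀ x, ∀ z ∈ regularPoints P L,
      expFun P L (x + rhoCheck b m) (G x) z = berestFunction b m L ω x z) (x v ν : N) :
    Continuous fun t : ℝ => (G (x + t • v)).coeff ν := by
  obtain ⟨E, hE⟩ := exists_finset_of_pair_le hm b
  have hsupp : ∀ x, (G x).coeff.support ⊆ E := fun x ν hν =>
    hE ν ((hG x).1.1 ν (by simpa using hν)) fun ξ => (hG x).2 ξ ν (by simpa using hν)
  by_cases hν : ν ∈ E
  · obtain ⟨c, hc⟩ := exists_coeff_eq_sum hL P E hν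
    simp_rw [hc _ (hsupp _), Finsupp.sum]
    refine continuous_finsetSum _ fun z _ => continuous_const.mul ?_
    have h : ∀ t : ℝ, evalAt P L z (G (x + t • v)) =
        qpow L (-(2 * P.toLinearMap z (x + t • v + rhoCheck b m))) *
          berestFunction b m L ω (x + t • v) z := by
      intro t
      rw [← hGb _ _ z.2, expFun, ← mul_assoc, ← qpow_add]
      simp [qpow]
    simp_rw [h]
    refine Continuous.mul ?_ (continuous_berestFunction_line b ω x v z)
    simp only [map_add, map_smul, smul_eq_mul]
    exact continuous_qpow.comp (by fun_prop)
  · have h : ∀ t : ℝ, (G (x + t • v)).coeff ν = 0 := fun t => by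
      by_contra h
      exact hν (hsupp _ (by simpa using h))
    simp_rw [h]
    exact continuous_const

lemma continuous_expFun_family [P.IsReduced] (hL : L ≠ 0)
    (hm : ∀ i j, m (P.reflectionPerm i j) = m j) (b : P.Base) {ω : M}
    {G : N → AddMonoidAlgebra ℂ N}
    (hG : ∀ x, G x ∈ boundedQuasiInvariants P L m (x + rhoCheck b m))
    (hGb : ∀ x, ∀ z ∈ regularPoints P L,
      expFun P L (x + rhoCheck b m) (G x) z = berestFunction b m L ω x z) (x v : N) (z : M) :
    Continuous fun t : ℝ => expFun P L (x + t • v + rhoCheck b m) (G (x + t • v)) z := by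
  obtain ⟨E, hE⟩ := exists_finset_of_pair_le hm b
  have hsupp : ∀ x, (G x).coeff.support ⊆ E := fun x ν hν =>
    hE ν ((hG x).1.1 ν (by simpa using hν)) fun ξ => (hG x).2 ξ ν (by simpa using hν)
  simp_rw [expFun, evalAt_eq_sum z _ (hsupp _)]
  refine Continuous.mul ?_ (continuous_finsetSum _ fun ν _ =>
    (continuous_coeff_line hL hm b hG hGb x v ν).mul continuous_const)
  simp only [map_add, map_smul, smul_eq_mul]
  exact continuous_qpow.comp (by fun_prop)

lemma eq_of_frequently_eq {f g : ℝ → ℂ} (hf : Continuous f) (hg : Continuous g)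
    (h : ∃ᶠ t in 𝓝[≠] (0 : ℝ), f t = g t) : f 0 = g 0 :=
  (isClosed_eq hf hg).mem_of_frequently_of_tendsto h
    (tendsto_id.mono_left (nhdsWithin_le_nhds (s := {0}ᶜ)))

/-- The product formula defines a family of eigenfunctions of the Macdonald operator. -/
theorem exists_berest_family [P.IsReduced] [P.IsIrreducible] (hL : NotRootOfUnity L)
    (hm : ∀ i j, m (P.reflectionPerm i j) = m j) (b : P.Base) {ω : M} (hω₀ : ω ≠ 0)
    (hω : IsMinuscule P ω ∨ IsQuasiminuscule P ω) :
    ∃ G : N → AddMonoidAlgebra ℂ N,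
      (∀ x, G x ∈ boundedQuasiInvariants P L m (x + rhoCheck b m)) ∧
      (∀ x, ∀ z ∈ regularPoints P L,
        expFun P L (x + rhoCheck b m) (G x) z = berestFunction b m L ω x z) ∧
      (∀ x, (G x).coeff (-(2 : ℝ) • rhoCheck b m) = ∏ ν ∈ shifts b m,
        (orbitSum P L ω x - orbitSum P L ω (x + ν))) ∧
      (∀ x, ∀ z ∈ nonsingularPoints P L,
        macdonaldOp b m L ω (expFun P L (x + rhoCheck b m) (G x)) z =
          orbitSum P L ω x * expFun P L (x + rhoCheck b m) (G x) z) ∧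
      (∀ x ν, (G x).coeff ν ≠ 0 → rhoCheck b m + ν ∈ polytope b m) ∧
      ∃ x, (G x).coeff (-(2 : ℝ) • rhoCheck b m) ≠ 0 ∧
        ∀ ξ, IsGeneric P (G x).coeff.support ξ →
          (G x).coeff (rhoOf P m ξ - rhoCheck b m) ≠ 0 := by
  choose G hG hGb hcoeff hD hgen using fun x => exists_berest (P := P) hL hm b hω x
  refine ⟨G, hG, hGb, hcoeff, fun x z hz => ?_, fun x ν hν => ?_, ?_⟩
  -- The eigenvalue equation is a closed condition that holds at points accumulating at x.
  · obtain ⟨v, hv⟩ := exists_frequently_generic hL b hω₀ hω x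
    have hc := continuous_expFun_family hL.ne_zero hm b hG hGb x v
    have h := eq_of_frequently_eq (continuous_macdonaldOp (m := m) (L := L) b ω hc z)
      ((continuous_orbitSum_line (P := P) (L := L) ω x v).mul (hc z))
      (hv.mono fun t ht => hD _ ht.1 z hz)
    simpa using h
  · rw [mem_polytope_iff hm]
    intro ξ
    by_contra hξ
    obtain ⟨v, hv⟩ := exists_frequently_generic hL b hω₀ hω x
    refine hν ?_
    have h := eq_of_frequently_eq (continuous_coeff_line hL.ne_zero hm b hG hGb x v ν)
      (continuous_const (y := 0)) (hv.mono fun t ht => by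
        by_contra hne
        exact hξ ((hgen _ ht.1 ht.2).1 ν hne ξ))
    simpa using h
  · obtain ⟨v, hv⟩ := exists_frequently_generic hL b hω₀ hω 0
    obtain ⟨t, ht⟩ := hv.exists
    refine ⟨_, ?_, (hgen _ ht.1 ht.2).2⟩
    rw [hcoeff]
    exact Finset.prod_ne_zero_iff.2 fun u hu => sub_ne_zero.2 (ht.2 u hu)

end Extension

end BakerAkhiezer

end

theorem theorem3 {ι M N : Type*} [Fintype ι] [AddCommGroup M] [Module ℝ M]
    [AddCommGroup N] [Module ℝ N]
    (P : RootPairing ι ℝ M N) [P.IsRootSystem] [P.IsCrystallographic] [P.IsReduced]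
    [P.IsIrreducible] (b : P.Base)
    (m : ι → ℕ) (hm : ∀ i j, m (P.reflectionPerm i j) = m j)
    (q L : ℂ) (hL : Complex.exp L = q) (hq : ∀ n : ℕ, 0 < n → q ^ n ≠ 1)
    (ω : M) (hω₀ : ω ≠ 0)
    (hω : BakerAkhiezer.IsMinuscule P ω ∨ BakerAkhiezer.IsQuasiminuscule P ω) :
    ∃ (ψ : N → M → ℂ) (c : N → N →₀ ℂ),
      -- `ψ` is given by the product formula
      (∀ x, ∀ z ∈ BakerAkhiezer.regularPoints P L,
        ψ x z = BakerAkhiezer.berestFunction b m L ω x z) ∧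
      -- (i) with coefficients `ψ_ν(x) = c x ν`
      BakerAkhiezer.HasExpansion b m L ψ c ∧
      -- (ii)
      (∀ x, c x (-BakerAkhiezer.rhoCheck b m) =
        ∏ ν ∈ BakerAkhiezer.shifts b m,
          (BakerAkhiezer.orbitSum P L ω x - BakerAkhiezer.orbitSum P L ω (x + ν))) ∧
      (∃ x, c x (-BakerAkhiezer.rhoCheck b m) ≠ 0) ∧
      -- the support is the whole polytope
      convexHull ℝ {ν | ∃ x, c x ν ≠ 0} = BakerAkhiezer.polytope b m ∧
      -- (iii)
      BakerAkhiezer.IsBakerAkhiezer b m L ψ ∧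
      -- (iv)
      ∀ x, ∀ z ∈ BakerAkhiezer.nonsingularPoints P L,
        BakerAkhiezer.macdonaldOp b m L ω (ψ x) z = BakerAkhiezer.orbitSum P L ω x * ψ x z := by
  have hLq : BakerAkhiezer.NotRootOfUnity L := BakerAkhiezer.notRootOfUnity_of_pow hL hq
  obtain ⟨G, hG, hGb, hcoeff, hD, hpoly, x₀, hx₀, hvert⟩ :=
    BakerAkhiezer.exists_berest_family hLq hm b hω₀ hω
  -- The exponents of `G x` are relative to x + ρ^∨; multiplication by the monomial of ρ^∨ makes
  -- them relative to x.
  let c : N → N →₀ ℂ := fun x =>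
    (AddMonoidAlgebra.single (BakerAkhiezer.rhoCheck b m) 1 * G x).coeff
  have hc : ∀ x ν, c x ν = (G x).coeff (ν - BakerAkhiezer.rhoCheck b m) := fun x ν => by
    simp only [c]
    rw [AddMonoidAlgebra.coeff_single_mul_apply, one_mul, neg_add_eq_sub]
  have hcρ : ∀ x, c x (-BakerAkhiezer.rhoCheck b m) =
      (G x).coeff (-(2 : ℝ) • BakerAkhiezer.rhoCheck b m) := fun x => by
    rw [hc]
    congr 1
    module
  have hcpoly : ∀ x ν, c x ν ≠ 0 → ν ∈ BakerAkhiezer.polytope b m := fun x ν hν => by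
    have h := hpoly x _ (by rwa [hc] at hν)
    rwa [add_sub_cancel] at h
  have hexp : BakerAkhiezer.HasExpansion b m L
      (fun x => BakerAkhiezer.expFun P L (x + BakerAkhiezer.rhoCheck b m) (G x)) c := by
    refine ⟨fun x ν hν => ?_, fun x z => ?_⟩
    · have hν' : c x ν ≠ 0 := by simpa using hν
      refine ⟨fun i => ?_, hcpoly x ν hν'⟩
      obtain ⟨n, hn⟩ := BakerAkhiezer.isCoweight_rhoCheck hm b i
      obtain ⟨k, hk⟩ := BakerAkhiezer.exists_int_of_mem_corootLattice
        ((hG x).1.1 _ (by rwa [hc] at hν')) i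
      refine ⟨k + n, ?_⟩
      rw [map_sub, hn] at hk
      push_cast
      linarith
    · have h := BakerAkhiezer.evalAt_apply (P := P) (L := L) z
        (AddMonoidAlgebra.single (BakerAkhiezer.rhoCheck b m) 1 * G x)
      rw [← h, map_mul, BakerAkhiezer.evalAt_single, one_mul, ← mul_assoc,
        ← BakerAkhiezer.qpow_add, ← mul_add, ← map_add]
      rfl
  refine ⟨_, c, hGb, hexp, fun x => by rw [hcρ, hcoeff], ⟨x₀, by rwa [hcρ]⟩, ?_,
    ⟨⟨c, hexp⟩, fun i s hs x z hz => ?_⟩, hD⟩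
  · obtain ⟨E, hE⟩ := BakerAkhiezer.exists_finset_of_pair_le (P := P) hm b
    refine BakerAkhiezer.convexHull_eq_polytope hm b ?_ (fun ν ⟨x, hx⟩ => hcpoly x ν hx)
      (G x₀).coeff.support fun ξ hξ => ⟨x₀, by rw [hc]; exact hvert ξ hξ⟩
    refine (E.finite_toSet.image (BakerAkhiezer.rhoCheck b m + ·)).subset ?_
    rintro ν ⟨x, hx⟩
    rw [hc] at hx
    exact ⟨ν - BakerAkhiezer.rhoCheck b m,
      hE _ ((hG x).1.1 _ hx) fun ξ => (hG x).2 ξ _ hx, by simp⟩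
  · exact BakerAkhiezer.expFun_add_eq_sub hLq.ne_zero b (hG x).1 (Finset.mem_Icc.1 hs).2 hz
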